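/- Let $R$ be either (a) a Noetherian local Gorenstein ring with maximal ideal $\mathfrak m$, or (b) a standard graded Gorenstein algebra over a field $K=[R]_0$ with irrelevant ideal $\mathfrak m$. "Module" means finitely generated $R$-module; in case (b) all modules, homomorphisms, isomorphisms and Ext modules are graded, homomorphisms have degree $0$, and $[M(j)]_i=[M]_{i+j}$ (in case (a) all shifts are ignored). A module is *perfect* if it is Cohen–Macaulay of finite projective dimension. A *quasi-Gorenstein* module is a nonzero perfect module $C$ such that, with $c=\dim R-\dim C$, there is an isomorphism $\alpha\colon C\to \operatorname{Ext}^c_R(C,R)(s)$ for some integer $s$. If $\varphi\colon C\to M$ is an epimorphism with $\dim M=\dim C$, let $L_C(\varphi)\colon C\to \operatorname{Ext}^c_R(\ker\varphi,R)(s)$ be the composition of $\alpha$ with the map induced by $\ker\varphi\hookrightarrow C$. Two modules $M,N$ are *directly m-linked* if there are a quasi-Gorenstein module $C$ and epimorphisms $\varphi\colon C\to M$, $\psi\colon C\to N$ with $\dim M=\dim N=\dim C$, $M\cong \operatorname{im}L_C(\psi)$ and $N\cong\operatorname{im}L_C(\varphi)$. The *m-liaison class* of $M$ consists of the modules $N$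 for which there is a chain $M\cong N_0,N_1,\dots,N_r= N$, $r\ge 0$, with $N_i$ and $N_{i+1}$ directly m-linked; the *even m-liaison class* of $M$ consists of those $N$ for which there is such a chain with $r$ even (modules being considered up to isomorphism). A module $M$ is *unmixed* if all its associated primes have the same height, and *maximal* if $\dim M=\dim R$ (in particular $M\ne0$). Two maximal modules $M,N$ are *stably equivalent* if $M\oplus F\cong N(s)\oplus G$ for some finitely generated free modules $F,G$ and some integer $s$ (free means a direct sum of shifts $R(a)$ in case (b)). Then: 1. If $M$ is an unmixed maximal module, then a module $N$ is in the even m-liaison class of $M$ if and only if $M$ and $N$ are stably equivalent. 2. A module $N$ is in the m-liaison class of $R$ if and only if $N$ is a nonzero finitely generated free module. -/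

import Mathlib

universe u v

open CategoryTheory

namespace ModuleLiaison

/-! ### Ring-theoretic and module-theoretic notions used in both settings -/

/-- A (commutative) Gorenstein ring: a Noetherian ring all of whose localizations at prime ideals
have finite injective dimension as modules over themselves. -/
structure IsGorensteinRing (R : Type u) [CommRing R] : Prop where
  noetherian : IsNoetherianRing R
  injDim : ∀ (p : Ideal R) [p.IsPrime], ∃ n : ℕ,
    HasInjectiveDimensionLE
      (ModuleCat.of (Localization.AtPrime p) (Localization.AtPrime p)) n

section

variable (R : Type u) [CommRing R] (M : Type u) [AddCommGroup M] [Module R M]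

/-- `codim M = dim R - dim M` equals `c`. The zero module (of dimension `⊥`) has no codimension
when `R` is nontrivial. -/
def HasCodim (c : ℕ) : Prop :=
  Module.supportDim R M + (c : WithBot ℕ∞) = ringKrullDim R

/-- `M` is a maximal module: `dim M = dim R`. -/
def IsMaximalModule : Prop := Module.supportDim R M = ringKrullDim R

/-- `M` is unmixed: all associated primes of `M` have the same height. -/
def IsUnmixed : Prop :=
  ∀ p ∈ associatedPrimes R M, ∀ q ∈ associatedPrimes R M, p.height = q.height

variable {R}

/-- A (nonzero, finitely generated) module `M` is Cohen-Macaulay with respect to the maximal ideal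
`m`: there is an `M`-regular sequence in `m` of length `dim M`, i.e. `depth M = dim M`. -/
def IsCohenMacaulay (m : Ideal R) : Prop :=
  ∃ rs : List R, (∀ r ∈ rs, r ∈ m) ∧ RingTheory.Sequence.IsRegular M rs ∧
    (rs.length : WithBot ℕ∞) = Module.supportDim R M

/-- A perfect module: Cohen-Macaulay of finite projective dimension. -/
def IsPerfectModule (m : Ideal R) : Prop :=
  IsCohenMacaulay M m ∧ ∃ n : ℕ, HasProjectiveDimensionLE (ModuleCat.of R M) n

variable (R)

/-- The `R`-module `Ext^c_R(M, R)`. -/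
abbrev ExtToRing (c : ℕ) : Type u :=
  Abelian.Ext.{u} (ModuleCat.of R M) (ModuleCat.of R R) c

end

section

variable {R : Type u} [CommRing R] {C M : Type u} [AddCommGroup C] [Module R C]
  [AddCommGroup M] [Module R M]

/-- The natural map `Ext^c_R(C, R) → Ext^c_R(ker φ, R)` induced by the inclusion of `ker φ`
into `C`. -/
noncomputable def extRestrict (c : ℕ) (φ : C →ₗ[R] M) :
    ExtToRing R C c →ₗ[R] ExtToRing R (LinearMap.ker φ) c :=
  Abelian.Ext.bilinearCompOfLinear R (ModuleCat.of R (LinearMap.ker φ)) (ModuleCat.of R C)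
    (ModuleCat.of R R) 0 c c (zero_add c)
    (Abelian.Ext.mk₀ (ModuleCat.ofHom (LinearMap.ker φ).subtype))

/-- The homomorphism `L_C(φ) : C → Ext^c_R(ker φ, R)` obtained from `φ : C → M` and an isomorphism
`α : C → Ext^c_R(C, R)`. -/
noncomputable def linkMap {c : ℕ} (α : C ≃ₗ[R] ExtToRing R C c) (φ : C →ₗ[R] M) :
    C →ₗ[R] ExtToRing R (LinearMap.ker φ) c :=
  extRestrict c φ ∘ₗ α.toLinearMap

/-- `φ : C → M` is an epimorphism onto a module of the same dimension as `C`, so that `φ` is an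
element of `Epi(C)` with image `M`. -/
def IsEpiSameDim (φ : C →ₗ[R] M) : Prop :=
  Function.Surjective φ ∧ Module.supportDim R M = Module.supportDim R C

end

/-! ### Module liaison over a local ring -/

namespace Loc

variable {R : Type u} [CommRing R] [IsLocalRing R]

/-- A quasi-Gorenstein module over a local ring: finitely generated, perfect, and isomorphic to its
canonical module `Ext^c_R(C, R)`, where `c = codim C`. -/
def IsQuasiGorenstein (C : ModuleCat.{u} R) : Prop :=
  Module.Finite R C ∧ IsPerfectModule C (IsLocalRing.maximalIdeal R) ∧
    ∃ c : ℕ, HasCodim R C c ∧ Nonempty (C ≃ₗ[R] ExtToRing R C c)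

/-- `M` and `N` are module linked in one step: for some quasi-Gorenstein module `C` there are
`φ : C → M` and `ψ : C → N` in `Epi(C)` with images `M` and `N` such that `M ≅ im L_C(ψ)` and
`N ≅ im L_C(φ)`. -/
def DirectlyLinked (M N : ModuleCat.{u} R) : Prop :=
  ∃ C : ModuleCat.{u} R, IsQuasiGorenstein C ∧
    ∃ (c : ℕ) (α : C ≃ₗ[R] ExtToRing R C c) (φ : C →ₗ[R] M) (ψ : C →ₗ[R] N),
      HasCodim R C c ∧ IsEpiSameDim φ ∧ IsEpiSameDim ψ ∧
      Nonempty (M ≃ₗ[R] LinearMap.range (linkMap α ψ)) ∧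
      Nonempty (N ≃ₗ[R] LinearMap.range (linkMap α φ))

/-- `M` and `N` are linked in `s` steps (modules being considered up to isomorphism). -/
def LinkedInSteps : ℕ → ModuleCat.{u} R → ModuleCat.{u} R → Prop
  | 0, M, N => Nonempty (M ≃ₗ[R] N)
  | s + 1, M, N => ∃ P : ModuleCat.{u} R, LinkedInSteps s M P ∧ DirectlyLinked P N

/-- `N` is in the m-liaison class of `M`. -/
def InLiaisonClass (M N : ModuleCat.{u} R) : Prop := ∃ s : ℕ, LinkedInSteps s M N

/-- `N` is in the even m-liaison class of `M`. -/
def InEvenLiaisonClass (M N : ModuleCat.{u} R) : Prop :=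
  ∃ s : ℕ, Even s ∧ LinkedInSteps s M N

/-- Two maximal modules `M` and `N` are stably equivalent if `M ⊕ F ≅ N ⊕ G` for some finitely
generated free modules `F`, `G`. -/
def StablyEquivalent (M N : ModuleCat.{u} R) : Prop :=
  IsMaximalModule R M ∧ IsMaximalModule R N ∧
    ∃ F G : ModuleCat.{u} R, Module.Finite R F ∧ Module.Free R F ∧
      Module.Finite R G ∧ Module.Free R G ∧ Nonempty ((M × F) ≃ₗ[R] (N × G))

end Loc

/-! ### Module liaison over a standard graded algebra -/

namespace Gr

variable {K : Type v} [Field K] {R : Type u} [CommRing R] [Algebra K R]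

/-- `R = ⨁ 𝒜 i` is a standard graded `K`-algebra: it is concentrated in nonnegative degrees, with
`[R]_0 = K`, and generated over `K` by the finite-dimensional space `[R]_1`. -/
structure IsStandardGraded (𝒜 : ℤ → Submodule K R) [GradedAlgebra 𝒜] : Prop where
  nontrivial : Nontrivial R
  neg : ∀ i < 0, 𝒜 i = ⊥
  zero : 𝒜 0 = 1
  finite : Module.Finite K (𝒜 1)
  adjoin : Algebra.adjoin K (𝒜 1 : Set R) = ⊤

/-- The irrelevant maximal ideal, generated by the homogeneous elements of positive degree. -/
def irrelevant (𝒜 : ℤ → Submodule K R) : Ideal R :=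
  Ideal.span {r | ∃ i : ℤ, 0 < i ∧ r ∈ 𝒜 i}

/-- A (`ℤ`-)graded module over the graded ring `R`; `deg i` is the component `[M]_i`. -/
structure GrMod (𝒜 : ℤ → Submodule K R) where
  carrier : Type u
  [addCommGroup : AddCommGroup carrier]
  [module : Module R carrier]
  deg : ℤ → AddSubgroup carrier
  isInternal : DirectSum.IsInternal deg
  smul_mem : ∀ {i j : ℤ} {r : R} {x : carrier}, r ∈ 𝒜 i → x ∈ deg j → r • x ∈ deg (i + j)

attribute [instance] GrMod.addCommGroup GrMod.module

variable {𝒜 : ℤ → Submodule K R}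

instance : CoeSort (GrMod 𝒜) (Type u) := ⟨GrMod.carrier⟩

/-- The graded module `R`. -/
def ringMod (𝒜 : ℤ → Submodule K R) [GradedAlgebra 𝒜] : GrMod 𝒜 where
  carrier := R
  deg i := (𝒜 i).toAddSubgroup
  isInternal := DirectSum.Decomposition.isInternal 𝒜
  smul_mem hr hx := SetLike.mul_mem_graded hr hx

/-- A graded homomorphism (of degree zero). -/
def IsGradedHom {M N : GrMod 𝒜} (f : M →ₗ[R] N) : Prop := ∀ i, ∀ x ∈ M.deg i, f x ∈ N.deg i

/-- A finitely generated graded free module `⨁ R(-d k)`: one with a finite basis of homogeneous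
elements. -/
def IsGradedFree (M : GrMod 𝒜) : Prop :=
  ∃ (n : ℕ) (b : Module.Basis (Fin n) R M) (d : Fin n → ℤ), ∀ k, b k ∈ M.deg (d k)

/-- The graded isomorphism relation `M ≅ N`. -/
def GradedIso (M N : GrMod 𝒜) : Prop :=
  ∃ e : M ≃ₗ[R] N, ∀ i x, x ∈ M.deg i ↔ e x ∈ N.deg i

/-- `IsHomogExt c M i e` says that `e ∈ Ext^c_R(M, R)` lies in the component
`[Ext^c_R(M, R)]_i = Ext^c(M, R(i))` (`Ext` in the category of graded modules) of the natural
grading of `Ext^c_R(M, R)`. In terms of Yoneda extensions: `e` is a homomorphism `M → R` of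
degree `i` if `c = 0`; and in cohomological degree `c + 1` it is the product of the class of a
short exact sequence `0 → L → F → M → 0` of graded modules with an element of
`[Ext^c_R(L, R)]_i`. -/
def IsHomogExt : (c : ℕ) → (M : GrMod 𝒜) → ℤ → ExtToRing R M c → Prop
  | 0, M, i, e => ∃ f : M →ₗ[R] R, (∀ j, ∀ x ∈ M.deg j, f x ∈ 𝒜 (j + i)) ∧
      e = Abelian.Ext.mk₀ (ModuleCat.ofHom f)
  | c + 1, M, i, e => ∃ (L F : GrMod 𝒜) (f : L →ₗ[R] F) (g : F →ₗ[R] M)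
      (w : ModuleCat.ofHom f ≫ ModuleCat.ofHom g = 0)
      (hS : (ShortComplex.mk (ModuleCat.ofHom f) (ModuleCat.ofHom g) w).ShortExact)
      (e' : ExtToRing R L c),
      IsGradedHom f ∧ IsGradedHom g ∧ IsHomogExt c L i e' ∧
        e = hS.extClass.comp e' (add_comm 1 c)

/-- The linear isomorphism `α` is a graded isomorphism `C → Ext^c_R(C, R)(s)`. -/
def IsGradedDuality {C : GrMod 𝒜} {c : ℕ} (s : ℤ) (α : C ≃ₗ[R] ExtToRing R C c) : Prop :=
  ∀ i x, x ∈ C.deg i ↔ IsHomogExt c C (i + s) (α x)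

/-- A graded quasi-Gorenstein module: finitely generated, perfect, and isomorphic as a graded module
to a shift of its canonical module, i.e. to a shift of `Ext^c_R(C, R)`, where `c = codim C`. -/
def IsQuasiGorenstein (C : GrMod 𝒜) : Prop :=
  Module.Finite R C ∧ IsPerfectModule C (irrelevant 𝒜) ∧
    ∃ (c : ℕ) (s : ℤ) (α : C ≃ₗ[R] ExtToRing R C c), HasCodim R C c ∧ IsGradedDuality s α

/-- There is a graded isomorphism between `N` and the image of the map `f` from the graded module
`C`. The image of a graded homomorphism has as its component of degree `i` the image of `[C]_i`. -/
def IsoToGradedImage (N : GrMod 𝒜) {C : GrMod 𝒜} {E : Type u} [AddCommGroup E] [Module R E]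
    (f : C →ₗ[R] E) : Prop :=
  ∃ e : N ≃ₗ[R] LinearMap.range f, ∀ i x, x ∈ N.deg i ↔ ∃ y ∈ C.deg i, f y = e x

/-- The graded modules `M` and `N` are module linked in one step: for some quasi-Gorenstein module
`C` there are graded homomorphisms `φ : C → M` and `ψ : C → N` in `Epi(C)` with images `M` and `N`
such that `M ≅ im L_C(ψ)` and `N ≅ im L_C(φ)` as graded modules. -/
def DirectlyLinked (M N : GrMod 𝒜) : Prop :=
  ∃ C : GrMod 𝒜, IsQuasiGorenstein C ∧
    ∃ (c : ℕ) (s : ℤ) (α : C ≃ₗ[R] ExtToRing R C c) (φ : C →ₗ[R] M) (ψ : C →ₗ[R] N),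
      HasCodim R C c ∧ IsGradedDuality s α ∧
      IsGradedHom φ ∧ IsEpiSameDim φ ∧ IsGradedHom ψ ∧ IsEpiSameDim ψ ∧
      IsoToGradedImage M (linkMap α ψ) ∧ IsoToGradedImage N (linkMap α φ)

/-- `M` and `N` are linked in `s` steps (modules being considered up to graded isomorphism). -/
def LinkedInSteps : ℕ → GrMod 𝒜 → GrMod 𝒜 → Prop
  | 0, M, N => GradedIso M N
  | s + 1, M, N => ∃ P : GrMod 𝒜, LinkedInSteps s M P ∧ DirectlyLinked P N

/-- `N` is in the m-liaison class of `M`. -/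
def InLiaisonClass (M N : GrMod 𝒜) : Prop := ∃ s : ℕ, LinkedInSteps s M N

/-- `N` is in the even m-liaison class of `M`. -/
def InEvenLiaisonClass (M N : GrMod 𝒜) : Prop := ∃ s : ℕ, Even s ∧ LinkedInSteps s M N

/-- Two graded maximal modules `M` and `N` are stably equivalent if `M ⊕ F ≅ N(s) ⊕ G` (as graded
modules) for some integer `s` and finitely generated graded free modules `F`, `G`. Here
`[M ⊕ F]_i = [M]_i ⊕ [F]_i` and `[N(s)]_i = [N]_{i+s}`. -/
def StablyEquivalent (M N : GrMod 𝒜) : Prop :=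
  IsMaximalModule R M ∧ IsMaximalModule R N ∧
    ∃ (F G : GrMod 𝒜) (s : ℤ) (e : (M × F) ≃ₗ[R] (N × G)), IsGradedFree F ∧ IsGradedFree G ∧
      ∀ i x, x ∈ (M.deg i).prod (F.deg i) ↔ e x ∈ (N.deg (i + s)).prod (G.deg i)

end Gr

end ModuleLiaison

/-!
All the modules in question are maximal, so a quasi-Gorenstein module `C` used to link them has
codimension `0`: it is a Cohen-Macaulay module of finite projective dimension with
`dim C = dim R`, together with an isomorphism `β` of `C` onto a shift of its dual.

*Such a `C` is free.* A Gorenstein local ring, or standard graded Gorenstein algebra, has a regular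
sequence of length `dim R` in `m` (`exists_hasGradeDim_of_isLocalRing`, `Gr.exists_hasGradeDim`). The
reason is that, modulo a maximal regular sequence in `m`, every prime ideal (in the graded case:
every homogeneous one) is `m`, because `Ext^i(-, R)` vanishes beyond the length of the sequence. A
module of finite projective dimension with `Ext^i(R / m, C) = 0` for `i < dim R` is then projective
(`projective_of_subsingleton_ext`): otherwise the inclusion of its last syzygy would induce an
injection on `Ext^d(R / m, -)`, `d = dim R`, which is zero since its entries are in `m`.

*Two links give a stable equivalence.* If `M` and `P` are linked to `N` by `C` and `C'`, lift the two
epimorphisms onto `N` to maps `C → C'` and `C' → C`. With these, `M ⊕ C'` and `C ⊕ P` are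
presented as quotients of `C ⊕ C'` by the same submodule (`exists_equiv_of_linked`). Similarly a
module linked to a free module is a direct summand of `C` (`projective_of_linked`).

*A stable equivalence gives an even chain of links.* The pairing `∑ x (σ k) * y k` of an involution
`σ` makes `R^ι` a quasi-Gorenstein module. A torsionless module `M` covered by `φ : R^ι → M` is linked
to `P = R^ι / (ker φ)^⊥`. For an involution `τ` of `ι ⊕ κ`, the composition of `R^(ι ⊕ κ) → R^ι` with
`R^ι → P` links `P` to `M ⊕ R^κ`, in the graded case up to shifts that depend on `τ`
(`IsDualPair.extendLink`). If `τ` fixes `κ`, this adds a free module to `M`; if `κ = ι` and `τ` swaps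
the summands, it moreover shifts `M` by an arbitrary degree. Unmixed maximal modules are torsionless,
because `R` is self-injective at its minimal primes (`exists_dual_ne_zero_of_isUnmixed`).
-/

namespace ModuleLiaison

open RingTheory.Sequence Abelian IsLocalRing

/-! ### Injective dimension and torsionless modules over Gorenstein rings -/

theorem length_le_height {R : Type u} [CommRing R] [IsNoetherianRing R] (p : Ideal R) [p.IsPrime]
    {rs : List R} (hmem : ∀ r ∈ rs, r ∈ p) (hreg : IsWeaklyRegular R rs) :
    (rs.length : ℕ∞) ≤ p.height := by
  have h := hreg.isRegular_of_isLocalization_of_mem (Localization.AtPrime p) p hmem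
  have h1 := ringKrullDim_add_length_eq_ringKrullDim_of_isRegular _ h
  rw [IsLocalization.AtPrime.ringKrullDim_eq_height p (Localization.AtPrime p),
    List.length_map] at h1
  have h2 : (0 : WithBot ℕ∞) ≤ ringKrullDim (Localization.AtPrime p ⧸
      Ideal.ofList (rs.map (algebraMap R (Localization.AtPrime p)))) := by
    have : Nontrivial (Localization.AtPrime p ⧸
      Ideal.ofList (rs.map (algebraMap R (Localization.AtPrime p)))) := by
      apply Ideal.Quotient.nontrivial_iff.mpr
      have := h.top_ne_smul
      simpa using this.symm
    exact ringKrullDim_nonneg_of_nontrivial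
  have h3 : ((rs.length : ℕ∞) : WithBot ℕ∞) ≤ (p.height : WithBot ℕ∞) := by
    rw [← h1]
    calc ((rs.length : ℕ∞) : WithBot ℕ∞) = 0 + (rs.length : WithBot ℕ∞) := by simp
      _ ≤ _ := by gcongr
  exact_mod_cast h3

theorem mk₀_smul_id_comp {R : Type u} [CommRing R] (N M : ModuleCat.{u} R) (x : R) {i : ℕ}
    (z : Ext N M i) : (Ext.mk₀ (x • 𝟙 N)).comp z (zero_add i) = x • z := by
  rw [Ext.mk₀_smul, Ext.smul_comp, Ext.mk₀_id_comp]

theorem shortExact_of_linearMap {R : Type u} [CommRing R] {A B C : Type u} [AddCommGroup A]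
    [AddCommGroup B] [AddCommGroup C] [Module R A] [Module R B] [Module R C]
    (f : A →ₗ[R] B) (g : B →ₗ[R] C) (hf : Function.Injective f) (hg : Function.Surjective g)
    (h : Function.Exact f g) :
    (ShortComplex.mk (ModuleCat.ofHom f) (ModuleCat.ofHom g)
      (by ext x; exact h.apply_apply_eq_zero x)).ShortExact where
  exact := (ShortComplex.ShortExact.moduleCat_exact_iff_function_exact _).2 h
  mono_f := (ModuleCat.mono_iff_injective _).2 hf
  epi_g := (ModuleCat.epi_iff_surjective _).2 hg

section Local

variable {S : Type u} [CommRing S] [IsLocalRing S] [IsNoetherianRing S]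

/-- By the long exact sequence, multiplication by `x` is surjective on `Ext N M i`, which is therefore
zero by Nakayama's lemma. -/
theorem subsingleton_ext_of_subsingleton_quotSMulTop (N M : ModuleCat.{u} S) [Module.Finite S N]
    [Module.Finite S M] (x : S) (hx : x ∈ maximalIdeal S) (hreg : IsSMulRegular N x) (i : ℕ)
    (h : Subsingleton (Ext (ModuleCat.of S (QuotSMulTop x N)) M (i + 1))) :
    Subsingleton (Ext N M i) := by
  have hS := hreg.smulShortComplex_shortExact
  by_contra! ntr
  have : x ∈ (Module.annihilator S (Ext N M i)).jacobson :=
    (IsLocalRing.maximalIdeal_le_jacobson _) hx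
  absurd Submodule.top_ne_pointwise_smul_of_mem_jacobson_annihilator this
  rw [eq_comm, eq_top_iff]
  intro y _
  obtain ⟨z, hz⟩ := Ext.contravariant_sequence_exact₁ hS M y (add_comm 1 i)
    (@Subsingleton.elim _ h _ _)
  have hz' : x • (show Ext N M i from z) = y := (mk₀_smul_id_comp N M x z).symm.trans hz
  rw [← hz']
  exact Submodule.smul_mem_pointwise_smul _ _ ⊤ trivial

/-- Over a local ring of finite injective dimension, `Ext^i(-, S)` vanishes beyond the length of any
regular sequence `rs` that is maximal, i.e. with the maximal ideal associated to `S / (rs)`. The proof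
is a descending induction on `i`, starting beyond the injective dimension. By a prime filtration it
is enough to consider `S / p`. If `p` is not maximal, multiplication by an element outside `p` reduces
the claim to `Ext^(i+1)`; the residue field embeds in `S / (rs)`, whose projective dimension is the
length of `rs`. -/
theorem subsingleton_ext_of_hasInjectiveDimensionLE
    {n : ℕ} (hn : HasInjectiveDimensionLE (ModuleCat.of S S) n) {rs : List S}
    (hmem : ∀ r ∈ rs, r ∈ maximalIdeal S) (hreg : IsWeaklyRegular S rs)
    (hass : maximalIdeal S ∈ associatedPrimes S (S ⧸ Ideal.ofList rs • (⊤ : Submodule S S)))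
    (i : ℕ) (hi : rs.length < i) (N : Type u) [AddCommGroup N] [Module S N] [Module.Finite S N] :
    Subsingleton (Ext (ModuleCat.of S N) (ModuleCat.of S S) i) := by
  suffices H : ∀ c i : ℕ, n < i + c → rs.length < i →
      ∀ (N : Type u) [AddCommGroup N] [Module S N] [Module.Finite S N],
        Subsingleton (Ext (ModuleCat.of S N) (ModuleCat.of S S) i) from
    H (n + 1) i (by omega) hi N
  intro c
  induction c with
  | zero =>
    intro i hi _ N _ _ _
    exact HasInjectiveDimensionLT.subsingleton (ModuleCat.of S S) (n + 1) i (by omega) _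
  | succ c ih =>
    intro i hi hi' N _ _ hN
    have ih' := ih (i + 1) (by omega) (by omega)
    induction hN using IsNoetherianRing.induction_on_isQuotientEquivQuotientPrime S with
    | subsingleton N =>
      have : Limits.IsZero (ModuleCat.of S N) := ModuleCat.isZero_of_subsingleton _
      have := this.hasProjectiveDimensionLT_zero
      exact HasProjectiveDimensionLT.subsingleton _ 0 i (by omega) _
    | exact N₁ N₂ N₃ f g hf hg hfg h1 h3 =>
      have hS := shortExact_of_linearMap f g hf hg hfg
      refine subsingleton_of_forall_eq 0 fun e ↦ ?_
      obtain ⟨e', rfl⟩ := Ext.contravariant_sequence_exact₂ hS (ModuleCat.of S S) e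
        (@Subsingleton.elim _ h1 _ _)
      rw [@Subsingleton.elim _ h3 e' 0, Ext.comp_zero]
    | quotient N p e =>
      by_cases hp : p.1 = maximalIdeal S
      · -- the residue field embeds in `S / (rs)`
        obtain ⟨-, f, hf⟩ := (isAssociatedPrime_iff_exists_injective_linearMap _ _).1 (hp ▸ hass)
        have hf' : Function.Injective (f ∘ₗ e.toLinearMap) := by
          simpa using hf.comp e.injective
        have hS := shortExact_of_linearMap (f ∘ₗ e.toLinearMap)
          (Submodule.mkQ (LinearMap.range (f ∘ₗ e.toLinearMap))) hf' (Submodule.mkQ_surjective _)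
          (LinearMap.exact_map_mkQ_range _)
        have hpd : HasProjectiveDimensionLE
            (ModuleCat.of S (S ⧸ Ideal.ofList rs • (⊤ : Submodule S S))) rs.length := by
          rw [← projectiveDimension_le_iff,
            ModuleCat.projectiveDimension_quotient_eq_add_length_of_isWeaklyRegular
              (ModuleCat.of S S) rs hreg hmem,
            ModuleCat.projectiveDimension_eq_zero_of_projective, zero_add]
        refine subsingleton_of_forall_eq 0 fun e' ↦ ?_
        obtain ⟨e'', rfl⟩ := Ext.contravariant_sequence_exact₁ hS (ModuleCat.of S S) e'
          (add_comm 1 i) (@Subsingleton.elim _ (ih' _) _ _)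
        have := HasProjectiveDimensionLT.subsingleton
          (ModuleCat.of S (S ⧸ Ideal.ofList rs • (⊤ : Submodule S S))) (rs.length + 1) i
            (by omega) (ModuleCat.of S S)
        rw [@Subsingleton.elim _ this e'' 0, Ext.comp_zero]
      · obtain ⟨x, hx, hxp⟩ : ∃ x ∈ maximalIdeal S, x ∉ p.1 := by
          by_contra! h
          exact hp (le_antisymm (le_maximalIdeal p.2.ne_top) h)
        refine subsingleton_ext_of_subsingleton_quotSMulTop _ _ x hx ?_ i (ih' _)
        refine (LinearEquiv.isSMulRegular_congr e x).2 ?_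
        rw [isSMulRegular_iff_right_eq_zero_of_smul]
        intro a ha
        obtain ⟨a, rfl⟩ := Ideal.Quotient.mk_surjective a
        rw [Algebra.smul_def, Ideal.Quotient.algebraMap_eq, ← map_mul,
          Ideal.Quotient.eq_zero_iff_mem] at ha
        exact Ideal.Quotient.eq_zero_iff_mem.2 ((p.2.mem_or_mem ha).resolve_left hxp)

/-- A maximal regular sequence in a local ring of finite injective dimension generates an ideal that
is primary to the maximal ideal: such a ring is Cohen-Macaulay. -/
theorem eq_maximalIdeal_of_hasInjectiveDimensionLE
    {n : ℕ} (hn : HasInjectiveDimensionLE (ModuleCat.of S S) n) {rs : List S}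
    (hmem : ∀ r ∈ rs, r ∈ maximalIdeal S) (hreg : IsWeaklyRegular S rs)
    (hass : maximalIdeal S ∈ associatedPrimes S (S ⧸ Ideal.ofList rs • (⊤ : Submodule S S)))
    (p : Ideal S) [p.IsPrime] (hp : Ideal.ofList rs ≤ p) : p = maximalIdeal S := by
  obtain ⟨q, hq, hqp⟩ := Ideal.exists_minimalPrimes_le hp
  have hqprime : q.IsPrime := hq.1.1
  suffices q = maximalIdeal S from
    le_antisymm (le_maximalIdeal Ideal.IsPrime.ne_top') (this ▸ hqp)
  by_contra hne
  obtain ⟨x, hx, hxp⟩ : ∃ x ∈ maximalIdeal S, x ∉ q := by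
    by_contra! h
    exact hne (le_antisymm (le_maximalIdeal hqprime.ne_top) h)
  have hx' : IsSMulRegular (S ⧸ q) x := by
    rw [isSMulRegular_iff_right_eq_zero_of_smul]
    intro a ha
    obtain ⟨a, rfl⟩ := Ideal.Quotient.mk_surjective a
    rw [Algebra.smul_def, Ideal.Quotient.algebraMap_eq, ← map_mul,
      Ideal.Quotient.eq_zero_iff_mem] at ha
    exact Ideal.Quotient.eq_zero_iff_mem.2 ((hqprime.mem_or_mem ha).resolve_left hxp)
  have hreg' : IsRegular S rs :=
    (IsLocalRing.isRegular_iff_isWeaklyRegular_of_subset_maximalIdeal hmem).2 hreg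
  have hlt : ∀ I : Ideal S, I ≠ ⊤ → I • (⊤ : Submodule S S) < ⊤ := fun I hI ↦ by
    simpa using lt_top_iff_ne_top.2 hI
  have hsupp : Module.support S (S ⧸ q) = PrimeSpectrum.zeroLocus q := by
    rw [Module.support_eq_zeroLocus, Ideal.annihilator_quotient]
  have hqe : ∀ i < rs.length + 1,
      Subsingleton (Ext (ModuleCat.of S (S ⧸ q)) (ModuleCat.of S S) i) := by
    intro i hi
    rcases Nat.lt_succ_iff_lt_or_eq.1 hi with hi | rfl
    · refine ModuleCat.subsingleton_ext_of_exists_isRegular (Ideal.ofList rs) _ ?_ _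
        (hlt _ ?_) rs (fun r hr ↦ Ideal.subset_span hr) hreg' i hi
      · change Module.support S (S ⧸ q) ⊆ _
        rw [hsupp]
        exact PrimeSpectrum.zeroLocus_anti_mono hq.1.2
      · exact fun h ↦ hqprime.ne_top (top_le_iff.1 (h ▸ hq.1.2))
    · refine subsingleton_ext_of_subsingleton_quotSMulTop _ _ x hx hx' _ ?_
      exact subsingleton_ext_of_hasInjectiveDimensionLE hn hmem hreg hass _ (Nat.lt_succ_self _) _
  obtain ⟨ys, hlen, hys, hysreg⟩ := ModuleCat.exists_isRegular_of_exists_subsingleton_ext q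
    (rs.length + 1) (ModuleCat.of S S) (hlt _ hqprime.ne_top) (ModuleCat.of S (S ⧸ q)) hsupp hqe
  have h1 := length_le_height q hys hysreg.toIsWeaklyRegular
  have h2 : q.height ≤ (rs.length : ℕ∞) := by
    classical
    have hq' : q ∈ (Ideal.span (rs.toFinset : Set S)).minimalPrimes := by
      convert! hq using 2
      simp [Ideal.ofList, List.coe_toFinset]
    refine (Ideal.height_le_card_of_mem_minimalPrimes_span_finset hq').trans ?_
    exact_mod_cast rs.toFinset_card_le
  rw [hlen] at h1
  have := h1.trans h2
  have : rs.length + 1 ≤ rs.length := by exact_mod_cast this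
  omega

end Local

/-- Homomorphisms to `R` extend along an injection if `Ext¹` of its cokernel into `R` vanishes. -/
theorem exists_extension_of_subsingleton_ext {R : Type u} [CommRing R] {A B : Type u}
    [AddCommGroup A] [AddCommGroup B] [Module R A] [Module R B] (f : A →ₗ[R] B)
    (hf : Function.Injective f)
    (h : Subsingleton (Ext (ModuleCat.of R (B ⧸ LinearMap.range f)) (ModuleCat.of R R) 1))
    (j : A →ₗ[R] R) : ∃ g : B →ₗ[R] R, g ∘ₗ f = j := by
  have hS := shortExact_of_linearMap f (Submodule.mkQ (LinearMap.range f)) hf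
    (Submodule.mkQ_surjective _) (LinearMap.exact_map_mkQ_range _)
  obtain ⟨y, hy⟩ := Ext.contravariant_sequence_exact₁ hS (ModuleCat.of R R)
    (Ext.mk₀ (ModuleCat.ofHom j)) (add_comm 1 0) (@Subsingleton.elim _ h _ _)
  obtain ⟨g, rfl⟩ := (Ext.mk₀_bijective _ _).2 y
  rw [Ext.mk₀_comp_mk₀] at hy
  refine ⟨g.hom, ?_⟩
  have := (Ext.mk₀_bijective _ _).1 hy
  simpa using congrArg ModuleCat.Hom.hom this

section Torsionless

variable {R : Type u} [CommRing R] (hR : IsGorensteinRing R) {M : Type u} [AddCommGroup M]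
  [Module R M] [Module.Finite R M]

include hR

/-- A finitely generated module over a Gorenstein ring whose associated primes are minimal primes of
the ring is torsionless: localizing at an associated prime `p = ann x` gives a self-injective ring,
into which a copy of the residue field generated by `x` embeds. -/
theorem exists_dual_ne_zero_of_height_eq_zero (hM : ∀ p ∈ associatedPrimes R M, p.height = 0)
    {x : M} (hx : x ≠ 0) : ∃ f : M →ₗ[R] R, f x ≠ 0 := by
  have := hR.noetherian
  by_contra! hcon
  let T : Submodule R M := ⨅ f : M →ₗ[R] R, LinearMap.ker f
  have hT : ∀ y : M, y ∈ T ↔ ∀ f : M →ₗ[R] R, f y = 0 := fun y ↦ by simp [T]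
  obtain ⟨p, hp, -⟩ := exists_le_isAssociatedPrime_of_isNoetherianRing R
    (⟨x, (hT x).2 hcon⟩ : T) (by simpa using hx)
  have hpM : p.height = 0 := hM p (hp.map_of_injective T.subtype T.subtype_injective)
  obtain ⟨hprime, ⟨⟨y, hyT⟩, hpy⟩⟩ := isAssociatedPrime_iff.1 hp
  have hpy' : ∀ r, r ∈ p ↔ r • y = 0 := fun r ↦ by
    rw [hpy, Submodule.mem_colon_singleton]; simp
  rw [Ideal.height_eq_zero_iff] at hpM
  let S := Localization.AtPrime p
  let N := LocalizedModule p.primeCompl M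
  let ι : M →ₗ[R] N := LocalizedModule.mkLinearMap p.primeCompl M
  obtain ⟨n, hn⟩ := hR.injDim p
  have hass : maximalIdeal S ∈ associatedPrimes S S := by
    have hp' : p ∈ associatedPrimes R R := by
      apply Module.associatedPrimes.minimalPrimes_annihilator_subset_associatedPrimes
      rw [Module.annihilator_eq_bot.2 inferInstance]
      exact hpM
    apply Module.associatedPrimes.mem_associatedPrimes_of_comap_mem_associatedPrimes_of_isLocalizedModule
      p.primeCompl (Algebra.linearMap R S)
    rwa [show Ideal.comap (algebraMap R S) (maximalIdeal S) = p from
      Localization.AtPrime.under_maximalIdeal]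
  have hext : ∀ (Q : Type u) [AddCommGroup Q] [Module S Q] [Module.Finite S Q],
      Subsingleton (Ext (ModuleCat.of S Q) (ModuleCat.of S S) 1) := by
    intro Q _ _ _
    refine subsingleton_ext_of_hasInjectiveDimensionLE (S := S) hn (rs := []) (by simp)
      (IsWeaklyRegular.nil S S) ?_ 1 (by simp) Q
    have hbot : Ideal.ofList ([] : List S) • (⊤ : Submodule S S) = ⊥ := by simp
    rw [hbot]
    exact (LinearEquiv.isAssociatedPrime_iff (Submodule.quotEquivOfEqBot (R := S) (M := S) ⊥ rfl)).2 hass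
  have hιy : ι y ≠ 0 := by
    intro h0
    obtain ⟨s, hs0⟩ := (IsLocalizedModule.eq_zero_iff p.primeCompl ι).1 h0
    exact s.2 ((hpy' s).2 hs0)
  have hker : maximalIdeal S ≤ LinearMap.ker (LinearMap.toSpanSingleton S N (ι y)) := by
    rw [← Localization.AtPrime.map_eq_maximalIdeal, Ideal.map_le_iff_le_comap]
    intro r hr
    change algebraMap R S r • ι y = 0
    rw [algebraMap_smul, ← map_smul, (hpy' r).1 hr, map_zero]
  let u : (S ⧸ maximalIdeal S) →ₗ[S] N := Submodule.liftQ _ _ hker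
  have hu : Function.Injective u := by
    rw [← LinearMap.ker_eq_bot, Submodule.ker_liftQ_eq_bot']
    refine le_antisymm hker (le_maximalIdeal ?_)
    rw [Ideal.ne_top_iff_one]
    simpa using hιy
  obtain ⟨-, j, hj⟩ := (isAssociatedPrime_iff_exists_injective_linearMap _ _).1 hass
  obtain ⟨G, hG⟩ := exists_extension_of_subsingleton_ext u hu (hext _) j
  have hGy : G (ι y) ≠ 0 := by
    have h1 : u (Submodule.Quotient.mk 1) = ι y := by
      change (1 : S) • ι y = ι y
      rw [one_smul]
    rw [← h1, ← LinearMap.comp_apply, hG, ne_eq, map_eq_zero_iff j hj]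
    exact fun h ↦ (Ideal.ne_top_iff_one _).1 (maximalIdeal.isMaximal S).ne_top
      ((Submodule.Quotient.mk_eq_zero _).1 h)
  have := Module.finitePresentation_of_finite R M
  obtain ⟨φ, s, hφ⟩ := Module.FinitePresentation.exists_lift_of_isLocalizedModule p.primeCompl
    (Algebra.linearMap R S) (G.restrictScalars R ∘ₗ ι)
  have h1 := LinearMap.congr_fun hφ y
  simp only [LinearMap.comp_apply, (hT y).1 hyT φ, map_zero, LinearMap.smul_apply,
    LinearMap.restrictScalars_apply] at h1
  have hs : IsUnit (algebraMap R S s) := IsLocalization.map_units S s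
  rw [Submonoid.smul_def, Algebra.smul_def] at h1
  exact hGy ((hs.mul_right_eq_zero).1 h1.symm)

/-- A chain of length `dim R` in the support of `M` starts at a minimal prime ideal of `R`, which is
associated to `M`. -/
theorem height_eq_zero_of_isUnmixed [FiniteRingKrullDim R]
    (hunm : IsUnmixed R M) (hmax : IsMaximalModule R M) :
    ∀ p ∈ associatedPrimes R M, p.height = 0 := by
  have := hR.noetherian
  suffices ∃ p ∈ associatedPrimes R M, p.height = 0 by
    obtain ⟨p, hp, h0⟩ := this
    exact fun q hq ↦ (hunm q hq p hp).trans h0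
  have hfin : Order.krullDim (Module.support R M) = ringKrullDim R := hmax
  obtain ⟨d, hd⟩ : ∃ d : ℕ, ringKrullDim R = d := by
    obtain ⟨d, hd⟩ := WithBot.ne_bot_iff_exists.1 (ringKrullDim_ne_bot (R := R))
    have : d ≠ ⊤ := by
      rintro rfl
      exact ringKrullDim_ne_top (R := R) hd.symm
    obtain ⟨n, rfl⟩ := ENat.ne_top_iff_exists.1 this
    exact ⟨n, hd.symm⟩
  obtain ⟨l, hl⟩ := Order.le_krullDim_iff.1 (hd.symm.trans hfin.symm).le
  let q : PrimeSpectrum R := l.head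
  have hq0 : q.1.height = 0 := by
    by_contra hne
    obtain ⟨q', hq'⟩ : ∃ q' : PrimeSpectrum R, q' < q := by
      have : ¬ IsMin q := by
        rw [← Order.height_eq_zero, ← PrimeSpectrum.height_eq_orderHeight]
        exact hne
      exact not_isMin_iff.1 this
    let l' : LTSeries (PrimeSpectrum R) := (l.map Subtype.val (fun _ _ h ↦ h)).cons q' hq'
    have := Order.LTSeries.length_le_krullDim l'
    rw [← ringKrullDim, hd] at this
    have h3 : l'.length = d + 1 := by
      change 0 + l.length + 1 = d + 1
      omega
    rw [h3] at this
    have : d + 1 ≤ d := by exact_mod_cast this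
    omega
  refine ⟨q.1, ?_, hq0⟩
  apply Module.associatedPrimes.minimalPrimes_annihilator_subset_associatedPrimes
  rw [Ideal.height_eq_zero_iff] at hq0
  have hmem : q ∈ Module.support R M := l.head.2
  rw [Module.support_eq_zeroLocus] at hmem
  exact ⟨⟨q.2, hmem⟩, fun J hJ hJq ↦ hq0.2 ⟨hJ.1, bot_le⟩ hJq⟩

/-- Unmixed maximal modules over a Gorenstein ring are torsionless. -/
theorem exists_dual_ne_zero_of_isUnmixed [FiniteRingKrullDim R]
    (hunm : IsUnmixed R M) (hmax : IsMaximalModule R M) {x : M} (hx : x ≠ 0) :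
    ∃ f : M →ₗ[R] R, f x ≠ 0 :=
  exists_dual_ne_zero_of_height_eq_zero hR (height_eq_zero_of_isUnmixed hR hunm hmax) hx

end Torsionless

/-! ### Regular sequences of maximal length -/

/-- Regular sequences with entries in a subset `H` of a prime ideal can be prolonged until no element
of `H` is regular on the quotient. -/
theorem exists_maximal_isWeaklyRegular {R : Type u} [CommRing R] [IsNoetherianRing R]
    (m : Ideal R) [m.IsPrime] (H : Set R) (hH : H ⊆ m) :
    ∃ rs : List R, (∀ r ∈ rs, r ∈ H) ∧ IsWeaklyRegular R rs ∧
      ∀ x ∈ H, ¬ IsSMulRegular (R ⧸ Ideal.ofList rs • (⊤ : Submodule R R)) x := by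
  classical
  let P : ℕ → Prop := fun n ↦ ∃ rs : List R, (∀ r ∈ rs, r ∈ H) ∧ IsWeaklyRegular R rs ∧
    rs.length = n
  obtain ⟨b, hb⟩ := ENat.ne_top_iff_exists.1 (Ideal.height_ne_top (I := m) Ideal.IsPrime.ne_top')
  have hbd : ∀ n, P n → n ≤ b := by
    rintro n ⟨rs, h1, h2, rfl⟩
    have := length_le_height m (fun r hr ↦ hH (h1 r hr)) h2
    rw [← hb] at this
    exact_mod_cast this
  have h0 : P 0 := ⟨[], by simp, IsWeaklyRegular.nil R R, rfl⟩
  obtain ⟨rs, h1, h2, h3⟩ := Nat.findGreatest_spec (P := P) (Nat.zero_le b) h0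
  refine ⟨rs, h1, h2, fun x hx hreg ↦ ?_⟩
  have : P (rs.length + 1) := by
    refine ⟨rs ++ [x], ?_, ?_, by simp⟩
    · intro r hr
      rcases List.mem_append.1 hr with hr | hr
      · exact h1 r hr
      · rw [List.mem_singleton.1 hr]; exact hx
    · rw [isWeaklyRegular_append_iff]
      exact ⟨h2, (isWeaklyRegular_singleton_iff _ _).2 hreg⟩
  have h4 := Nat.le_findGreatest (hbd _ this) this
  omega

/-- If `rs` is a maximal regular sequence in the prime ideal `m` of a Gorenstein ring, `m` is minimal
over `(rs)`. Everything is preserved by the localization at `m`, where the local case applies. -/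
theorem eq_of_isWeaklyRegular_of_mem_associatedPrimes {R : Type u} [CommRing R]
    (hR : IsGorensteinRing R) (m : Ideal R) [m.IsPrime] {rs : List R}
    (hmem : ∀ r ∈ rs, r ∈ m) (hreg : IsWeaklyRegular R rs)
    (hass : m ∈ associatedPrimes R (R ⧸ Ideal.ofList rs • (⊤ : Submodule R R)))
    (p : Ideal R) [p.IsPrime] (hp : Ideal.ofList rs ≤ p) (hpm : p ≤ m) : p = m := by
  have := hR.noetherian
  let S := Localization.AtPrime m
  obtain ⟨n, hn⟩ := hR.injDim m
  let rs' := rs.map (algebraMap R S)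
  have hofList : Ideal.ofList rs' = (Ideal.ofList rs).map (algebraMap R S) :=
    (Ideal.map_ofList _ _).symm
  obtain ⟨-, a, ha⟩ := isAssociatedPrime_iff.1 hass
  obtain ⟨a, rfl⟩ := Submodule.Quotient.mk_surjective _ a
  have ha' : ∀ r, r ∈ m ↔ r * a ∈ Ideal.ofList rs := fun r ↦ by
    rw [ha, Submodule.mem_colon_singleton, ← Submodule.Quotient.mk_smul, Submodule.mem_bot,
      Submodule.Quotient.mk_eq_zero]
    simp
  have hass' : maximalIdeal S ∈
      associatedPrimes S (S ⧸ Ideal.ofList rs' • (⊤ : Submodule S S)) := by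
    refine isAssociatedPrime_iff.2 ⟨inferInstance, Submodule.Quotient.mk (algebraMap R S a), ?_⟩
    have hcolon : ∀ s : S, s ∈ (⊥ : Submodule S (S ⧸ Ideal.ofList rs' •
        (⊤ : Submodule S S))).colon {Submodule.Quotient.mk (algebraMap R S a)} ↔
        s * algebraMap R S a ∈ Ideal.ofList rs' := fun s ↦ by
      rw [Submodule.mem_colon_singleton, ← Submodule.Quotient.mk_smul, Submodule.mem_bot,
        Submodule.Quotient.mk_eq_zero]
      simp
    refine ((maximalIdeal.isMaximal S).eq_of_le ?_ ?_)
    · rw [Ideal.ne_top_iff_one, hcolon, one_mul, hofList,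
        IsLocalization.algebraMap_mem_map_algebraMap_iff m.primeCompl]
      rintro ⟨s, hs, hsa⟩
      exact hs ((ha' s).2 hsa)
    · rw [← Localization.AtPrime.map_eq_maximalIdeal, Ideal.map_le_iff_le_comap]
      intro r hr
      rw [Ideal.mem_comap, hcolon, ← map_mul, hofList]
      exact Ideal.mem_map_of_mem _ ((ha' r).1 hr)
  have hdisj : Disjoint (m.primeCompl : Set R) (p : Set R) := by
    rw [Set.disjoint_left]
    exact fun x hx hxp ↦ hx (hpm hxp)
  have hprime : (p.map (algebraMap R S)).IsPrime :=
    IsLocalization.isPrime_of_isPrime_disjoint m.primeCompl S p inferInstance hdisj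
  have := eq_maximalIdeal_of_hasInjectiveDimensionLE (S := S) hn (rs := rs')
    (fun r hr ↦ by
      obtain ⟨x, hx, rfl⟩ := List.mem_map.1 hr
      exact (IsLocalization.AtPrime.to_map_mem_maximal_iff S m x).2 (hmem x hx))
    (hreg.of_isLocalization S m.primeCompl) hass' (p.map (algebraMap R S))
    (hofList ▸ Ideal.map_mono hp)
  have h1 := IsLocalization.under_map_of_isPrime_disjoint m.primeCompl S ‹p.IsPrime› hdisj
  rw [Ideal.under_def] at h1
  rw [← h1, this]
  exact Localization.AtPrime.under_maximalIdeal

/-- A ring with an ideal `m` whose grade equals the Krull dimension, a natural number. -/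
def HasGradeDim (R : Type u) [CommRing R] (m : Ideal R) (d : ℕ) : Prop :=
  ringKrullDim R = d ∧ ∃ rs : List R, (∀ r ∈ rs, r ∈ m) ∧ IsWeaklyRegular R rs ∧ rs.length = d

theorem exists_hasGradeDim_of_isLocalRing {R : Type u} [CommRing R] [IsLocalRing R]
    (hR : IsGorensteinRing R) : ∃ d : ℕ, HasGradeDim R (maximalIdeal R) d := by
  have := hR.noetherian
  obtain ⟨rs, h1, h2, h3⟩ := exists_maximal_isWeaklyRegular (maximalIdeal R) (maximalIdeal R)
    subset_rfl
  have hass : maximalIdeal R ∈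
      associatedPrimes R (R ⧸ Ideal.ofList rs • (⊤ : Submodule R R)) := by
    have hsub : (maximalIdeal R : Set R) ⊆
        ⋃ p ∈ associatedPrimes R (R ⧸ Ideal.ofList rs • (⊤ : Submodule R R)), p := by
      rw [biUnion_associatedPrimes_eq_compl_regular]
      exact fun x hx ↦ h3 x hx
    obtain ⟨p, hp, hle⟩ := (Ideal.subset_union_prime_finite
      (associatedPrimes.finite R (R ⧸ Ideal.ofList rs • (⊤ : Submodule R R))) (f := id) ⊥ ⊥
      (fun p hp _ _ ↦ hp.isPrime)).1 hsub
    have : p.IsPrime := hp.isPrime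
    rwa [(maximalIdeal.isMaximal R).eq_of_le this.ne_top hle]
  refine ⟨rs.length, ?_, rs, h1, h2, rfl⟩
  have hreg : IsRegular R rs :=
    (IsLocalRing.isRegular_iff_isWeaklyRegular_of_subset_maximalIdeal h1).2 h2
  have hne : Ideal.ofList rs ≠ ⊤ := by
    simpa using hreg.top_ne_smul.symm
  have : Nontrivial (R ⧸ Ideal.ofList rs) := Ideal.Quotient.nontrivial_iff.2 hne
  rw [← ringKrullDim_add_length_eq_ringKrullDim_of_isRegular rs hreg]
  have h0 : Ring.KrullDimLE 0 (R ⧸ Ideal.ofList rs) := by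
    rw [Ideal.krullDimLE_zero_quotient_iff_forall_minimalPrimes_isMaximal]
    intro p hp
    have := hp.1.1
    rw [eq_of_isWeaklyRegular_of_mem_associatedPrimes hR (maximalIdeal R) h1 h2 hass p hp.1.2
      (le_maximalIdeal Ideal.IsPrime.ne_top')]
    infer_instance
  rw [ringKrullDimZero_iff_ringKrullDim_eq_zero.1 h0, zero_add]

section HasGradeDim

variable {R : Type u} [CommRing R] {m : Ideal R} {d : ℕ}

theorem HasGradeDim.finiteRingKrullDim (h : HasGradeDim R m d) : FiniteRingKrullDim R := by
  rw [finiteRingKrullDim_iff_ne_bot_and_top, h.1]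
  exact ⟨WithBot.natCast_ne_bot d, fun h ↦ ENat.natCast_ne_top d (WithBot.coe_injective h)⟩

variable [IsNoetherianRing R] [m.IsMaximal]

theorem HasGradeDim.subsingleton_ext (h : HasGradeDim R m d) {i : ℕ} (hi : i < d) :
    Subsingleton (Ext (ModuleCat.of R (R ⧸ m)) (ModuleCat.of R R) i) := by
  obtain ⟨rs, h1, h2, rfl⟩ := h.2
  have hm : m ≠ ⊤ := Ideal.IsPrime.ne_top'
  refine ModuleCat.subsingleton_ext_of_exists_isRegular m _ ?_ _ ?_ rs h1 ⟨h2, ?_⟩ i hi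
  · change Module.support R (R ⧸ m) ⊆ _
    rw [Module.support_eq_zeroLocus, Ideal.annihilator_quotient]
  · change m • (⊤ : Submodule R R) < ⊤
    simpa using lt_top_iff_ne_top.2 hm
  · intro htop
    apply hm
    rw [eq_top_iff]
    calc (⊤ : Ideal R) = Ideal.ofList rs • ⊤ := htop
      _ ≤ m := by
        rw [smul_eq_mul, Ideal.mul_top]
        exact Ideal.span_le.2 h1

/-- If `Ext^d` vanished too, Rees' theorem would give a regular sequence of length `d + 1` in `m`,
and `m` would have height greater than `d = dim R`. -/
theorem HasGradeDim.nontrivial_ext (h : HasGradeDim R m d) :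
    Nontrivial (Ext (ModuleCat.of R (R ⧸ m)) (ModuleCat.of R R) d) := by
  by_contra hcon
  rw [not_nontrivial_iff_subsingleton] at hcon
  have hm : m ≠ ⊤ := Ideal.IsPrime.ne_top'
  obtain ⟨ys, hlen, hys, hysreg⟩ := ModuleCat.exists_isRegular_of_exists_subsingleton_ext m
    (d + 1) (ModuleCat.of R R) (by
      change m • (⊤ : Submodule R R) < ⊤
      simpa using lt_top_iff_ne_top.2 hm) (ModuleCat.of R (R ⧸ m))
    (by
      change Module.support R (R ⧸ m) = _
      rw [Module.support_eq_zeroLocus, Ideal.annihilator_quotient])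
    (fun i hi ↦ (Nat.lt_succ_iff_lt_or_eq.1 hi).elim (h.subsingleton_ext ·) (· ▸ hcon))
  have h1 : ((d + 1 : ℕ) : ℕ∞) ≤ m.height := hlen ▸ length_le_height m hys hysreg.toIsWeaklyRegular
  have h2 : (m.height : WithBot ℕ∞) ≤ ringKrullDim R := Ideal.height_le_ringKrullDim_of_isPrime
  rw [h.1] at h2
  have h3 : m.height ≤ d := by exact_mod_cast h2
  have : d + 1 ≤ d := by exact_mod_cast h1.trans h3
  omega

end HasGradeDim

/-! ### Standard graded Gorenstein algebras -/

namespace Gr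

open DirectSum

variable {K : Type v} [Field K] {R : Type u} [CommRing R] [Algebra K R]
  (𝒜 : ℤ → Submodule K R) [GradedAlgebra 𝒜]

section StandardGraded

variable {𝒜} (h𝒜 : IsStandardGraded 𝒜)

omit [GradedAlgebra 𝒜] in
theorem mem_irrelevant_of_mem {i : ℤ} (hi : 0 < i) {x : R} (hx : x ∈ 𝒜 i) : x ∈ irrelevant 𝒜 :=
  Ideal.subset_span ⟨i, hi, hx⟩

include h𝒜

theorem eq_zero_of_mem_neg {i : ℤ} (hi : i < 0) {x : R} (hx : x ∈ 𝒜 i) : x = 0 := by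
  rwa [h𝒜.neg i hi, Submodule.mem_bot] at hx

theorem exists_algebraMap_of_mem_zero {x : R} (hx : x ∈ 𝒜 0) : ∃ c : K, algebraMap K R c = x := by
  rwa [h𝒜.zero, Submodule.mem_one] at hx

theorem mem_irrelevant_iff {x : R} : x ∈ irrelevant 𝒜 ↔ (decompose 𝒜 x 0 : R) = 0 := by
  constructor
  · intro hx
    induction hx using Submodule.closure_induction with
    | zero => simp
    | add x y _ _ hx hy => simp [hx, hy]
    | smul_mem r x hx =>
      obtain ⟨i, hi, hx⟩ := hx
      have := coe_decompose_mul_add_of_right_mem 𝒜 (i := -i) (a := r) hx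
      rw [neg_add_cancel] at this
      rw [smul_eq_mul, this]
      have h0 : (decompose 𝒜 r (-i) : R) ∈ 𝒜 (-i) := SetLike.coe_mem _
      rw [eq_zero_of_mem_neg h𝒜 (by omega) h0, zero_mul]
  · intro hx
    classical
    rw [← sum_support_decompose 𝒜 x]
    refine Ideal.sum_mem _ fun i _ ↦ ?_
    have hi : (decompose 𝒜 x i : R) ∈ 𝒜 i := SetLike.coe_mem _
    rcases lt_trichotomy i 0 with h | rfl | h
    · rw [eq_zero_of_mem_neg h𝒜 h hi]; exact Ideal.zero_mem _
    · rw [hx]; exact Ideal.zero_mem _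
    · exact mem_irrelevant_of_mem h hi

theorem exists_algebraMap_sub_mem (x : R) : ∃ c : K, x - algebraMap K R c ∈ irrelevant 𝒜 := by
  have h0 : (decompose 𝒜 x 0 : R) ∈ 𝒜 0 := SetLike.coe_mem _
  obtain ⟨c, hc⟩ := exists_algebraMap_of_mem_zero h𝒜 h0
  refine ⟨c, (mem_irrelevant_iff h𝒜).2 ?_⟩
  have : algebraMap K R c ∈ 𝒜 0 := SetLike.algebraMap_mem_graded 𝒜 c
  rw [decompose_sub, DirectSum.sub_apply, AddSubgroupClass.coe_sub, decompose_of_mem_same 𝒜 this, hc, sub_self]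

theorem irrelevant_isMaximal : (irrelevant 𝒜).IsMaximal := by
  have := h𝒜.nontrivial
  rw [Ideal.isMaximal_iff]
  constructor
  · rw [mem_irrelevant_iff h𝒜, decompose_of_mem_same 𝒜 SetLike.GradedOne.one_mem]
    exact one_ne_zero
  · intro J x hle hx hxJ
    obtain ⟨c, hc⟩ := exists_algebraMap_sub_mem h𝒜 x
    have hcJ : algebraMap K R c ∈ J := by
      have := J.sub_mem hxJ (hle hc)
      rwa [sub_sub_cancel] at this
    have hc0 : c ≠ 0 := by
      rintro rfl
      rw [map_zero, sub_zero] at hc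
      exact hx hc
    have := J.mul_mem_left (algebraMap K R c⁻¹) hcJ
    rwa [← map_mul, inv_mul_cancel₀ hc0, map_one] at this

theorem isUnit_of_mem_zero {x : R} (hx : x ∈ 𝒜 0) (hx' : x ∉ irrelevant 𝒜) : IsUnit x := by
  rw [h𝒜.zero, Submodule.mem_one] at hx
  obtain ⟨c, rfl⟩ := hx
  refine (IsUnit.mk0 c ?_).map _
  rintro rfl
  simp at hx'

theorem le_irrelevant_of_isHomogeneous {I : Ideal R} (hI : I.IsHomogeneous 𝒜) (hne : I ≠ ⊤) :
    I ≤ irrelevant 𝒜 := by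
  intro x hx
  rw [mem_irrelevant_iff h𝒜]
  by_contra h0
  have h1 : (decompose 𝒜 x 0 : R) ∈ 𝒜 0 := SetLike.coe_mem _
  refine hne (Ideal.eq_top_of_isUnit_mem _ (hI 0 hx) (isUnit_of_mem_zero h𝒜 h1 ?_))
  rwa [mem_irrelevant_iff h𝒜, decompose_of_mem_same 𝒜 h1]

theorem exists_homogeneous_notMem {I J : Ideal R} (hI : I.IsHomogeneous 𝒜) (h : ¬ I ≤ J) :
    ∃ i : ℤ, 0 ≤ i ∧ ∃ x ∈ 𝒜 i, x ∈ I ∧ x ∉ J := by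
  classical
  obtain ⟨x, hxI, hxJ⟩ := Set.not_subset.1 h
  rw [SetLike.mem_coe, ← sum_support_decompose 𝒜 x] at hxJ
  obtain ⟨i, -, hi⟩ : ∃ i ∈ (decompose 𝒜 x).support, (decompose 𝒜 x i : R) ∉ J := by
    by_contra! hcon
    exact hxJ (Ideal.sum_mem _ hcon)
  refine ⟨i, ?_, _, SetLike.coe_mem _, hI i hxI, hi⟩
  by_contra! hneg
  have h0 : (decompose 𝒜 x i : R) ∈ 𝒜 i := SetLike.coe_mem _
  rw [eq_zero_of_mem_neg h𝒜 hneg h0] at hi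
  exact hi J.zero_mem

omit [GradedAlgebra 𝒜] h𝒜 in
theorem exists_pos_notMem_of_not_irrelevant_le {J : Ideal R} (h : ¬ irrelevant 𝒜 ≤ J) :
    ∃ i : ℤ, 0 < i ∧ ∃ x ∈ 𝒜 i, x ∉ J := by
  by_contra! hcon
  refine h (Ideal.span_le.2 ?_)
  rintro x ⟨i, hi, hx⟩
  exact hcon i hi x hx

/-- Homogeneous prime avoidance for homogeneous primes. -/
theorem exists_pos_forall_notMem_of_isHomogeneous (T : Finset (Ideal R))
    (hT : ∀ p ∈ T, p.IsPrime ∧ p.IsHomogeneous 𝒜 ∧ ¬ irrelevant 𝒜 ≤ p) :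
    ∃ i : ℤ, 0 < i ∧ ∃ x ∈ 𝒜 i, ∀ p ∈ T, x ∉ p := by
  classical
  induction T using Finset.strongInduction with
  | H T ih =>
    rcases T.eq_empty_or_nonempty with rfl | hne
    · exact ⟨1, one_pos, 0, Submodule.zero_mem _, by simp⟩
    obtain ⟨q, hq⟩ := T.exists_minimal hne
    obtain ⟨i, hi, x, hx, hxT⟩ := ih (T.erase q) (Finset.erase_ssubset hq.1)
      (fun p hp ↦ hT p (Finset.mem_of_mem_erase hp))
    by_cases hxq : x ∈ q
    swap
    · refine ⟨i, hi, x, hx, fun p hp ↦ ?_⟩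
      by_cases hpq : p = q
      · rwa [hpq]
      · exact hxT p (Finset.mem_erase.2 ⟨hpq, hp⟩)
    have := (hT q hq.1).1
    -- a homogeneous element of positive degree lying in all the other primes, but not in `q`
    obtain ⟨j, hj, z, hz, hzq, hzT⟩ : ∃ j : ℤ, 0 < j ∧ ∃ z ∈ 𝒜 j, z ∉ q ∧
        ∀ p ∈ T.erase q, z ∈ p := by
      have key : ∀ T' ⊆ T.erase q, ∃ j : ℤ, 0 < j ∧ ∃ z ∈ 𝒜 j, z ∉ q ∧ ∀ p ∈ T', z ∈ p := by
        intro T'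
        induction T' using Finset.induction_on with
        | empty =>
          intro _
          obtain ⟨j, hj, z, hz, hzq⟩ := exists_pos_notMem_of_not_irrelevant_le (hT q hq.1).2.2
          exact ⟨j, hj, z, hz, hzq, by simp⟩
        | insert p T' _ ih' =>
          intro hsub
          obtain ⟨j, hj, z, hz, hzq, hzT⟩ :=
            ih' ((Finset.subset_insert _ _).trans hsub)
          have hp := Finset.mem_erase.1 (hsub (Finset.mem_insert_self _ _))
          have hpq : ¬ p ≤ q := fun hle ↦ hp.1 (le_antisymm hle (hq.2 hp.2 hle))
          obtain ⟨k, hk, y, hy, hyp, hyq⟩ := exists_homogeneous_notMem h𝒜 (hT p hp.2).2.1 hpq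
          refine ⟨j + k, by omega, z * y, SetLike.mul_mem_graded hz hy, ?_, ?_⟩
          · exact fun hmem ↦ (this.mem_or_mem hmem).elim hzq hyq
          · intro p' hp'
            rcases Finset.mem_insert.1 hp' with rfl | hp'
            · exact Ideal.mul_mem_left _ _ hyp
            · exact Ideal.mul_mem_right _ _ (hzT p' hp')
      exact key _ subset_rfl
    refine ⟨j * i, mul_pos hj hi, x ^ j.toNat + z ^ i.toNat, ?_, ?_⟩
    · refine Submodule.add_mem _ ?_ ?_
      · have := SetLike.pow_mem_graded j.toNat hx
        rwa [nsmul_eq_mul, show ((j.toNat : ℕ) : ℤ) = j by omega] at this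
      · have := SetLike.pow_mem_graded i.toNat hz
        rwa [nsmul_eq_mul, show ((i.toNat : ℕ) : ℤ) = i by omega, mul_comm] at this
    · intro p hp hmem
      have := (hT p hp).1
      by_cases hpq : p = q
      · subst hpq
        have h1 := Ideal.pow_mem_of_mem p hxq j.toNat (by omega)
        exact hzq (this.mem_of_pow_mem _ ((p.add_mem_iff_right h1).1 hmem))
      · have hp' := Finset.mem_erase.2 ⟨hpq, hp⟩
        have h1 := Ideal.pow_mem_of_mem p (hzT p hp') i.toNat (by omega)
        exact hxT p hp' (this.mem_of_pow_mem _ ((p.add_mem_iff_left h1).1 hmem))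

/-- Homogeneous prime avoidance for arbitrary prime ideals. They may be replaced by their homogeneous
cores, which contain the same homogeneous elements. -/
theorem exists_pos_forall_notMem (T : Finset (Ideal R))
    (hT : ∀ p ∈ T, p.IsPrime ∧ ¬ irrelevant 𝒜 ≤ p) :
    ∃ i : ℤ, 0 < i ∧ ∃ x ∈ 𝒜 i, ∀ p ∈ T, x ∉ p := by
  classical
  obtain ⟨i, hi, x, hx, hxT⟩ := exists_pos_forall_notMem_of_isHomogeneous h𝒜
    (T.image fun p ↦ (p.homogeneousCore 𝒜).toIdeal) (by
      intro p' hp'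
      obtain ⟨p, hp, rfl⟩ := Finset.mem_image.1 hp'
      exact ⟨(hT p hp).1.homogeneousCore, (p.homogeneousCore 𝒜).isHomogeneous,
        fun h ↦ (hT p hp).2 (h.trans (p.toIdeal_homogeneousCore_le 𝒜))⟩)
  refine ⟨i, hi, x, hx, fun p hp hxp ↦ hxT _ (Finset.mem_image_of_mem _ hp) ?_⟩
  exact Ideal.mem_homogeneousCore_of_homogeneous_of_mem ⟨i, hx⟩ hxp

theorem le_pow_one (n : ℕ) : 𝒜 n ≤ 𝒜 1 ^ n := by
  have hle : ∀ {i : ℕ} {x : R}, x ∈ 𝒜 1 ^ i → x ∈ 𝒜 i := by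
    intro i x hx
    induction hx using Submodule.pow_induction_on_left' with
    | algebraMap r => exact SetLike.algebraMap_mem_graded 𝒜 r
    | add x y i _ _ hx hy => exact Submodule.add_mem _ hx hy
    | mem_mul m hm i x _ hx =>
      have := SetLike.mul_mem_graded hm hx
      rwa [add_comm] at this
  have hclos : ∀ x ∈ Submonoid.closure (𝒜 1 : Set R), ∃ i : ℕ, x ∈ 𝒜 1 ^ i := by
    intro x hx
    induction hx using Submonoid.closure_induction with
    | mem x hx => exact ⟨1, by rwa [pow_one]⟩
    | one => exact ⟨0, by rw [pow_zero]; exact Submodule.one_le.1 le_rfl⟩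
    | mul x y _ _ hx hy =>
      obtain ⟨i, hi⟩ := hx
      obtain ⟨j, hj⟩ := hy
      exact ⟨i + j, by rw [pow_add]; exact Submodule.mul_mem_mul hi hj⟩
  have hmain : ∀ x ∈ Submodule.span K (Submonoid.closure (𝒜 1 : Set R) : Set R),
      (decompose 𝒜 x n : R) ∈ 𝒜 1 ^ n := by
    intro x hx
    induction hx using Submodule.span_induction with
    | mem x hx =>
      obtain ⟨i, hi⟩ := hclos x hx
      by_cases hin : i = n
      · subst hin
        rwa [decompose_of_mem_same 𝒜 (hle hi)]
      · rw [decompose_of_mem_ne 𝒜 (hle hi) (by exact_mod_cast hin)]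
        exact Submodule.zero_mem _
    | zero => simp
    | add x y _ _ hx hy => simpa using Submodule.add_mem _ hx hy
    | smul c x _ hx =>
      rw [decompose_smul]
      exact Submodule.smul_mem _ c hx
  intro x hx
  rw [← decompose_of_mem_same 𝒜 hx]
  apply hmain
  rw [← Algebra.adjoin_eq_span, h𝒜.adjoin]
  trivial

/-- If a power of the irrelevant ideal is contained in the ideal generated by homogeneous elements
`y j` of positive degree, then `R` is finite over `K[y]`, so its dimension is at most the number of
the `y j`. -/
theorem ringKrullDim_le_of_irrelevant_pow_le {t : ℕ} (y : Fin t → R) (d : Fin t → ℤ)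
    (hd : ∀ j, 0 < d j) (hy : ∀ j, y j ∈ 𝒜 (d j)) {N : ℕ}
    (hN : irrelevant 𝒜 ^ N ≤ Ideal.span (Set.range y)) : ringKrullDim R ≤ t := by
  let T : Subalgebra K R := (MvPolynomial.aeval (R := K) y).range
  have hyT : ∀ j, y j ∈ T := fun j ↦ ⟨MvPolynomial.X j, MvPolynomial.aeval_X _ _⟩
  let B : Submodule K R := ⨆ n : Fin N, 𝒜 1 ^ (n : ℕ)
  have hB : B.FG := by
    refine Submodule.fg_iSup _ fun n ↦ Submodule.FG.pow ?_ _
    exact Module.Finite.iff_fg.1 h𝒜.finite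
  let W : Submodule T R := Submodule.span T (B : Set R)
  have hpow : ∀ {n : ℕ} {x : R}, x ∈ 𝒜 1 ^ n → x ∈ irrelevant 𝒜 ^ n := by
    intro n x hx
    induction hx using Submodule.pow_induction_on_left' with
    | algebraMap r => simp
    | add x y i _ _ hx hy => exact Ideal.add_mem _ hx hy
    | mem_mul m hm i x _ hx =>
      rw [pow_succ']
      exact Ideal.mul_mem_mul (mem_irrelevant_of_mem one_pos hm) hx
  have hstep : ∀ n : ℕ, (∀ k < n, ∀ x ∈ 𝒜 k, x ∈ W) → ∀ x ∈ Ideal.span (Set.range y),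
      (decompose 𝒜 x n : R) ∈ W := by
    intro n hn x hx
    induction hx using Submodule.closure_induction with
    | zero => simp
    | add x y _ _ hx hy => simpa using Submodule.add_mem _ hx hy
    | smul_mem r x hx =>
      obtain ⟨j, rfl⟩ := hx
      have := coe_decompose_mul_add_of_right_mem 𝒜 (i := (n : ℤ) - d j) (a := r) (hy j)
      rw [sub_add_cancel] at this
      rw [smul_eq_mul, this, mul_comm]
      have h0 : (decompose 𝒜 r ((n : ℤ) - d j) : R) ∈ 𝒜 ((n : ℤ) - d j) := SetLike.coe_mem _
      refine W.smul_mem (⟨y j, hyT j⟩ : T) ?_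
      by_cases hneg : (n : ℤ) - d j < 0
      · rw [eq_zero_of_mem_neg h𝒜 hneg h0]; exact W.zero_mem
      · have hdj := hd j
        refine hn ((n : ℤ) - d j).toNat (by omega) _ ?_
        rwa [show ((((n : ℤ) - d j).toNat : ℕ) : ℤ) = (n : ℤ) - d j by omega]
  have hall : ∀ n : ℕ, ∀ x ∈ 𝒜 n, x ∈ W := by
    intro n
    induction n using Nat.strong_induction_on with
    | _ n ih =>
      intro x hx
      have hx1 := le_pow_one h𝒜 n hx
      by_cases hnN : n < N
      · exact Submodule.subset_span (Submodule.mem_iSup_of_mem (⟨n, hnN⟩ : Fin N) hx1)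
      · have := hstep n ih x (hN (Ideal.pow_le_pow_right (not_lt.1 hnN) (hpow hx1)))
        rwa [decompose_of_mem_same 𝒜 hx] at this
  have htop : W = ⊤ := by
    classical
    rw [eq_top_iff]
    intro x _
    rw [← sum_support_decompose 𝒜 x]
    refine Submodule.sum_mem _ fun i _ ↦ ?_
    have hi : (decompose 𝒜 x i : R) ∈ 𝒜 i := SetLike.coe_mem _
    by_cases hneg : i < 0
    · rw [eq_zero_of_mem_neg h𝒜 hneg hi]; exact W.zero_mem
    · refine hall i.toNat _ ?_
      rwa [show ((i.toNat : ℕ) : ℤ) = i by omega]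
  have hfin : Module.Finite T R := by
    obtain ⟨s, hs⟩ := hB
    refine ⟨⟨s, ?_⟩⟩
    rw [eq_top_iff, ← htop]
    refine Submodule.span_le.2 ?_
    rw [← hs]
    intro x hx
    exact Submodule.span_le_restrictScalars K T (s : Set R) hx
  have hint : Algebra.IsIntegral T R := Algebra.IsIntegral.of_finite T R
  calc ringKrullDim R ≤ ringKrullDim T := by
        refine Order.krullDim_le_of_strictMono (PrimeSpectrum.comap (algebraMap T R)) ?_
        intro p q hpq
        exact Ideal.IsIntegral.comap_lt_comap (R := T) hpq
    _ ≤ ringKrullDim (MvPolynomial (Fin t) K) :=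
        ringKrullDim_le_of_surjective (MvPolynomial.aeval (R := K) y).rangeRestrict.toRingHom
          (MvPolynomial.aeval (R := K) y).rangeRestrict_surjective
    _ = t := by
        rw [MvPolynomial.ringKrullDim_of_isNoetherianRing, ringKrullDim_eq_zero_of_field]
        simp

/-- A maximal sequence of homogeneous elements of positive degree that is regular is, by homogeneous
prime avoidance, also a maximal regular sequence in the irrelevant ideal. The irrelevant ideal is then
the only homogeneous prime ideal containing the sequence, which thus generates an ideal containing a
power of the irrelevant ideal, and `dim R` is at most its length. -/
theorem exists_hasGradeDim (hR : IsGorensteinRing R) : ∃ d : ℕ, HasGradeDim R (irrelevant 𝒜) d := by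
  have := hR.noetherian
  have hmax := irrelevant_isMaximal h𝒜
  obtain ⟨rs, h1, h2, h3⟩ := exists_maximal_isWeaklyRegular (irrelevant 𝒜)
    {r | ∃ i : ℤ, 0 < i ∧ r ∈ 𝒜 i} Ideal.subset_span
  have h1' : ∀ r ∈ rs, r ∈ irrelevant 𝒜 := fun r hr ↦ Ideal.subset_span (h1 r hr)
  have hass : irrelevant 𝒜 ∈
      associatedPrimes R (R ⧸ Ideal.ofList rs • (⊤ : Submodule R R)) := by
    by_contra hcon
    have hfin := associatedPrimes.finite R (R ⧸ Ideal.ofList rs • (⊤ : Submodule R R))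
    obtain ⟨i, hi, x, hx, hxT⟩ := exists_pos_forall_notMem h𝒜 hfin.toFinset (by
      intro p hp
      have hp' := hfin.mem_toFinset.1 hp
      refine ⟨hp'.isPrime, fun hle ↦ hcon ?_⟩
      rwa [hmax.eq_of_le hp'.isPrime.ne_top hle])
    refine h3 x ⟨i, hi, hx⟩ ?_
    by_contra hreg
    have : x ∈ {r : R | IsSMulRegular (R ⧸ Ideal.ofList rs • (⊤ : Submodule R R)) r}ᶜ := hreg
    rw [← biUnion_associatedPrimes_eq_compl_regular] at this
    obtain ⟨p, hp, hxp⟩ := Set.mem_iUnion₂.1 this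
    exact hxT p (hfin.mem_toFinset.2 hp) hxp
  have hhom : (Ideal.ofList rs).IsHomogeneous 𝒜 := by
    refine Ideal.homogeneous_span 𝒜 _ fun r hr ↦ ?_
    obtain ⟨i, -, hi⟩ := h1 r hr
    exact ⟨i, hi⟩
  have hrad : irrelevant 𝒜 ≤ (Ideal.ofList rs).radical := by
    rw [hhom.radical_eq]
    refine le_sInf fun J hJ ↦ ?_
    have := hJ.2.2
    rw [eq_of_isWeaklyRegular_of_mem_associatedPrimes hR (irrelevant 𝒜) h1' h2 hass J hJ.2.1
      (le_irrelevant_of_isHomogeneous h𝒜 hJ.1 this.ne_top)]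
  obtain ⟨N, hN⟩ := Ideal.exists_pow_le_of_le_radical_of_fg hrad (IsNoetherian.noetherian _)
  choose d hd hdmem using fun j : Fin rs.length ↦ h1 (rs.get j) (List.get_mem rs j)
  have hspan : Ideal.span (Set.range rs.get) = Ideal.ofList rs := by
    rw [Set.range_list_get, Ideal.ofList]
  refine ⟨rs.length, le_antisymm ?_ ?_, rs, h1', h2, rfl⟩
  · exact ringKrullDim_le_of_irrelevant_pow_le h𝒜 rs.get d hd hdmem (hspan ▸ hN)
  · have h4 := length_le_height (irrelevant 𝒜) h1' h2
    calc ((rs.length : ℕ∞) : WithBot ℕ∞) ≤ ((irrelevant 𝒜).height : WithBot ℕ∞) := by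
          exact_mod_cast h4
      _ ≤ ringKrullDim R := Ideal.height_le_ringKrullDim_of_isPrime

end StandardGraded

end Gr

/-! ### Modules of maximal depth and finite projective dimension -/

section AuslanderBuchsbaum

variable {R : Type u} [CommRing R]

theorem smul_ext_eq_zero {m : Ideal R} {M : ModuleCat.{u} R} {i : ℕ} {x : R} (hx : x ∈ m)
    (z : Ext (ModuleCat.of R (R ⧸ m)) M i) : x • z = 0 := by
  have h0 : x • 𝟙 (ModuleCat.of R (R ⧸ m)) = 0 := by
    ext
    change x • Ideal.Quotient.mk m 1 = 0
    rw [← Ideal.Quotient.mk_eq_mk, ← Submodule.Quotient.mk_smul, Submodule.Quotient.mk_eq_zero]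
    simpa using hx
  rw [← mk₀_smul_id_comp, h0, Ext.mk₀_zero, Ext.zero_comp]

/-- The map induced by `f : R^n → M` on `Ext N` is given by the matrix of `f`. In particular it is zero
if the entries of `f` annihilate `N`. -/
theorem ext_comp_eq_sum {N M : ModuleCat.{u} R} {n i : ℕ}
    (z : Ext N (ModuleCat.of R (Fin n → R)) i) (f : (Fin n → R) →ₗ[R] M) :
    z.comp (Ext.mk₀ (ModuleCat.ofHom f)) (add_zero i) =
      ∑ j, (z.comp (Ext.mk₀ (ModuleCat.ofHom (LinearMap.proj j))) (add_zero i)).comp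
        (Ext.mk₀ (ModuleCat.ofHom (LinearMap.toSpanSingleton R M (f (Pi.single j 1)))))
        (add_zero i) := by
  have hf : ModuleCat.ofHom f = ∑ j, (ModuleCat.ofHom (LinearMap.proj j) :
      ModuleCat.of R (Fin n → R) ⟶ ModuleCat.of R R) ≫
      ModuleCat.ofHom (LinearMap.toSpanSingleton R M (f (Pi.single j 1))) := by
    refine ModuleCat.hom_ext (LinearMap.ext fun x ↦ ?_)
    rw [ModuleCat.hom_sum, LinearMap.sum_apply]
    change f x = ∑ j, x j • f (Pi.single j 1)
    simp_rw [← map_smul, ← map_sum]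
    rw [← pi_eq_sum_univ' x]
  rw [hf, Ext.mk₀_sum, Ext.comp_sum]
  refine Finset.sum_congr rfl fun j _ ↦ ?_
  rw [← Ext.mk₀_comp_mk₀, Ext.comp_assoc_of_third_deg_zero]

theorem subsingleton_ext_pi {N : ModuleCat.{u} R} {i : ℕ}
    (h : Subsingleton (Ext N (ModuleCat.of R R) i)) (n : ℕ) :
    Subsingleton (Ext N (ModuleCat.of R (Fin n → R)) i) := by
  refine subsingleton_of_forall_eq 0 fun z ↦ ?_
  have := ext_comp_eq_sum z (M := ModuleCat.of R (Fin n → R)) LinearMap.id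
  rw [ModuleCat.ofHom_id, Ext.comp_mk₀_id] at this
  rw [this]
  refine Finset.sum_eq_zero fun j _ ↦ ?_
  rw [Subsingleton.elim (z.comp _ _) 0, Ext.zero_comp]

/-- A homomorphism of free modules with entries in `m` induces the zero map on `Ext(R / m, -)`. -/
theorem ext_comp_eq_zero {m : Ideal R} {n k i : ℕ} (f : (Fin n → R) →ₗ[R] (Fin k → R))
    (hf : ∀ x j, f x j ∈ m) (z : Ext (ModuleCat.of R (R ⧸ m)) (ModuleCat.of R (Fin n → R)) i) :
    z.comp (Ext.mk₀ (ModuleCat.ofHom f)) (add_zero i) = 0 := by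
  rw [ext_comp_eq_sum z (M := ModuleCat.of R (Fin k → R)) f]
  refine Finset.sum_eq_zero fun j _ ↦ ?_
  generalize (z.comp (Ext.mk₀ (ModuleCat.ofHom (LinearMap.proj j))) (add_zero i) :
    Ext _ (ModuleCat.of R R) i) = w
  have : (ModuleCat.ofHom (LinearMap.toSpanSingleton R (Fin k → R) (f (Pi.single j 1))) :
      ModuleCat.of R R ⟶ ModuleCat.of R (Fin k → R)) =
      ∑ l, f (Pi.single j 1) l • ModuleCat.ofHom (LinearMap.toSpanSingleton R (Fin k → R)
        (Pi.single l 1)) := by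
    refine ModuleCat.hom_ext (LinearMap.ext fun x ↦ ?_)
    rw [ModuleCat.hom_sum, LinearMap.sum_apply]
    change x • f (Pi.single j 1) = ∑ l, f (Pi.single j 1) l • x • Pi.single l 1
    simp_rw [smul_comm _ x]
    rw [← Finset.smul_sum, ← pi_eq_sum_univ' (f (Pi.single j 1))]
  rw [this, Ext.mk₀_sum, Ext.comp_sum]
  refine Finset.sum_eq_zero fun l _ ↦ ?_
  rw [Ext.mk₀_smul, Ext.comp_smul, ← Ext.smul_comp, smul_ext_eq_zero (hf _ l), Ext.zero_comp]

theorem mem_of_mem_smul_top_pi {m : Ideal R} {n : ℕ} {x : Fin n → R}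
    (hx : x ∈ m • (⊤ : Submodule R (Fin n → R))) (j : Fin n) : x j ∈ m := by
  have := Submodule.mem_map_of_mem (f := LinearMap.proj (R := R) (φ := fun _ : Fin n ↦ R) j) hx
  rw [Submodule.map_smul''] at this
  exact Submodule.smul_le.2 (fun r hr y _ ↦ m.mul_mem_right y hr) this

/-- Nakayama's lemma for a module that is covered by a free module `F` with kernel in `m F`. -/
theorem subsingleton_of_top_le_smul {m : Ideal R} (hm : m ≠ ⊤) {n : ℕ} {X : Type u}
    [AddCommGroup X] [Module R X] (f : (Fin n → R) →ₗ[R] X) (hf : Function.Surjective f)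
    (hker : ∀ x ∈ LinearMap.ker f, ∀ j, x j ∈ m) (h : (⊤ : Submodule R X) ≤ m • ⊤) :
    Subsingleton X := by
  rcases n with _ | n
  · exact hf.subsingleton
  exfalso
  have h1 : f (Pi.single 0 1) ∈ m • (⊤ : Submodule R X) := h trivial
  rw [← LinearMap.range_eq_top.2 hf, LinearMap.range_eq_map, ← Submodule.map_smul''] at h1
  obtain ⟨y, hy, hy'⟩ := h1
  have h2 := hker (Pi.single 0 1 - y) (by rw [LinearMap.mem_ker, map_sub, hy', sub_self]) 0
  have h3 := m.add_mem h2 (mem_of_mem_smul_top_pi hy 0)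
  rw [Pi.sub_apply, Pi.single_eq_same, sub_add_cancel] at h3
  exact hm ((Ideal.eq_top_iff_one m).2 h3)

/-- A cover of a projective module by a free module with kernel in `m F` is an isomorphism as soon
as Nakayama's lemma holds for its kernel. -/
theorem injective_of_projective {m : Ideal R} {n : ℕ} {X : Type u} [AddCommGroup X] [Module R X]
    [Module.Projective R X] (f : (Fin n → R) →ₗ[R] X) (hf : Function.Surjective f)
    (hker : ∀ x ∈ LinearMap.ker f, ∀ j, x j ∈ m)
    (hnak : (⊤ : Submodule R (LinearMap.ker f)) ≤ m • ⊤ → Subsingleton (LinearMap.ker f)) :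
    Function.Injective f := by
  obtain ⟨s, hs⟩ := Module.projective_lifting_property f LinearMap.id hf
  let r : (Fin n → R) →ₗ[R] LinearMap.ker f :=
    LinearMap.codRestrict _ (LinearMap.id - s ∘ₗ f) fun x ↦ by
      have := LinearMap.congr_fun hs (f x)
      simp only [LinearMap.comp_apply, LinearMap.id_apply] at this
      simp [this]
  have hr : ∀ x : LinearMap.ker f, r x = x := fun x ↦ Subtype.ext (by simp [r])
  have := hnak fun x _ ↦ by
    have hx := hr x
    rw [pi_eq_sum_univ' (x : Fin n → R), map_sum] at hx
    rw [← hx]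
    refine Submodule.sum_mem _ fun j _ ↦ ?_
    rw [map_smul]
    exact Submodule.smul_mem_smul (hker _ x.2 j) trivial
  rw [← LinearMap.ker_eq_bot, ← Submodule.subsingleton_iff_eq_bot]
  exact this

/-- The map `Ext N X₁ i → Ext N X₂ i` is injective if `Ext N X₃ (i - 1)` vanishes. -/
theorem ext_eq_zero_of_comp_eq_zero {S : ShortComplex (ModuleCat.{u} R)} (hS : S.ShortExact)
    {N : ModuleCat.{u} R} {i : ℕ} (h : ∀ j, j + 1 = i → Subsingleton (Ext N S.X₃ j))
    (z : Ext N S.X₁ i) (hz : z.comp (Ext.mk₀ S.f) (add_zero i) = 0) : z = 0 := by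
  cases i with
  | zero =>
    have := hS.mono_f
    exact (injective_iff_map_eq_zero _).1 (Ext.postcomp_mk₀_injective_of_mono N S.f) z hz
  | succ i =>
    obtain ⟨w, rfl⟩ := Ext.covariant_sequence_exact₁ _ hS z hz rfl
    rw [(h i rfl).elim w 0, Ext.zero_comp]

variable [IsNoetherianRing R] {m : Ideal R} [m.IsMaximal] {d : ℕ} (hd : HasGradeDim R m d)

include hd

/-- The Auslander–Buchsbaum theorem for modules of maximal depth, for a class `P` of modules that
admit covers by free modules `F` with kernel in `m F` and again belonging to `P`: the modules in `P` of finite projective dimension such that `Ext^i(R / m, X) = 0` for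
`i < d` are projective. -/
theorem projective_of_subsingleton_ext (P : ModuleCat.{u} R → Prop)
    (hcov : ∀ X, P X → ∃ (n : ℕ) (f : (Fin n → R) →ₗ[R] X), Function.Surjective f ∧
      (∀ x ∈ LinearMap.ker f, ∀ j, x j ∈ m) ∧ P (ModuleCat.of R (LinearMap.ker f)))
    (n : ℕ)
    (X : ModuleCat.{u} R) (hX : P X) (hpd : HasProjectiveDimensionLE X n)
    (hext : ∀ i < d, Subsingleton (Ext (ModuleCat.of R (R ⧸ m)) X i)) :
    Module.Projective R X := by
  induction n generalizing X with
  | zero =>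
    exact (IsProjective.iff_projective X).2 (projective_iff_hasProjectiveDimensionLE_zero _ |>.2 hpd)
  | succ n ih =>
    have hm : m ≠ ⊤ := Ideal.IsPrime.ne_top'
    obtain ⟨a, f, hf, hker, hK⟩ := hcov X hX
    have hS := LinearMap.shortExact_shortComplexKer hf
    have hFext : ∀ i < d, Subsingleton
        (Ext (ModuleCat.of R (R ⧸ m)) (ModuleCat.of R (Fin a → R)) i) :=
      fun i hi ↦ subsingleton_ext_pi (hd.subsingleton_ext hi) a
    -- the syzygy module again satisfies the hypotheses
    have hKproj : Module.Projective R (LinearMap.ker f) := by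
      refine ih (ModuleCat.of R (LinearMap.ker f)) hK ?_ ?_
      · exact (hS.hasProjectiveDimensionLT_X₃_iff n (by
          exact (IsProjective.iff_projective _).1 inferInstance)).1 hpd
      · intro i hi
        exact subsingleton_of_forall_eq 0 fun z ↦ ext_eq_zero_of_comp_eq_zero hS
          (fun j hj ↦ hext j (by omega)) z ((hFext i hi).elim _ 0)
    obtain ⟨b, g, hg, hkerg, hKg⟩ := hcov _ hK
    have hginj := injective_of_projective (X := LinearMap.ker f) g hg hkerg (by
      obtain ⟨c, h, hh, hkerh, -⟩ := hcov _ hKg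
      exact subsingleton_of_top_le_smul hm h hh hkerh)
    -- the syzygy module is free, and `Ext^d` is injective on its inclusion, which has entries in `m`
    have hzero : ∀ z : Ext (ModuleCat.of R (R ⧸ m)) (ModuleCat.of R (Fin b → R)) d, z = 0 := by
      intro z
      have h1 : z.comp (Ext.mk₀ (ModuleCat.ofHom ((LinearMap.ker f).subtype ∘ₗ g)))
          (add_zero d) = 0 := ext_comp_eq_zero _ (fun x j ↦ hker _ (g x).2 j) z
      have h2 : z.comp (Ext.mk₀ (ModuleCat.ofHom g)) (add_zero d) = 0 := by
        refine ext_eq_zero_of_comp_eq_zero hS (fun j hj ↦ hext j (by omega)) _ ?_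
        rw [Ext.comp_assoc_of_third_deg_zero, Ext.mk₀_comp_mk₀]
        exact h1
      have h3 : z.comp (Ext.mk₀ (ModuleCat.ofHom g ≫ ModuleCat.ofHom
          (LinearEquiv.ofBijective g ⟨hginj, hg⟩).symm.toLinearMap)) (add_zero d) = 0 := by
        rw [← Ext.mk₀_comp_mk₀, ← Ext.comp_assoc_of_third_deg_zero, h2, Ext.zero_comp]
      have h4 : ModuleCat.ofHom g ≫ ModuleCat.ofHom
          (LinearEquiv.ofBijective g ⟨hginj, hg⟩).symm.toLinearMap =
          𝟙 (ModuleCat.of R (Fin b → R)) :=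
        ModuleCat.hom_ext (LinearMap.ext fun x ↦
          (LinearEquiv.ofBijective g ⟨hginj, hg⟩).symm_apply_apply x)
      rwa [h4, Ext.comp_mk₀_id] at h3
    have hb : b = 0 := by
      by_contra hb
      have := hd.nontrivial_ext
      obtain ⟨y, hy⟩ := exists_ne (0 : Ext (ModuleCat.of R (R ⧸ m)) (ModuleCat.of R R) d)
      let j : Fin b := ⟨0, Nat.pos_of_ne_zero hb⟩
      have h1 : y.comp (Ext.mk₀ (ModuleCat.ofHom (LinearMap.single R (fun _ : Fin b ↦ R) j) ≫
          ModuleCat.ofHom (LinearMap.proj j))) (add_zero d) = 0 := by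
        rw [← Ext.mk₀_comp_mk₀, ← Ext.comp_assoc_of_third_deg_zero, hzero (y.comp _ _),
          Ext.zero_comp]
      have h2 : ModuleCat.ofHom (LinearMap.single R (fun _ : Fin b ↦ R) j) ≫
          ModuleCat.ofHom (LinearMap.proj j) = 𝟙 (ModuleCat.of R R) :=
        ModuleCat.hom_ext (LinearMap.ext fun x ↦ Pi.single_eq_same (M := fun _ : Fin b ↦ R) j x)
      rw [h2, Ext.comp_mk₀_id] at h1
      exact hy h1
    subst hb
    have hfinj : Function.Injective f := by
      rw [← LinearMap.ker_eq_bot, ← Submodule.subsingleton_iff_eq_bot]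
      exact hg.subsingleton
    exact Module.Projective.of_equiv (LinearEquiv.ofBijective f ⟨hfinj, hf⟩)

omit [m.IsMaximal] hd in
theorem IsCohenMacaulay.subsingleton_ext {C : Type u} [AddCommGroup C] [Module R C]
    [Module.Finite R C] (hm : m • (⊤ : Submodule R C) ≠ ⊤) (h : IsCohenMacaulay C m) {i : ℕ}
    (hi : (i : WithBot ℕ∞) < Module.supportDim R C) :
    Subsingleton (Ext (ModuleCat.of R (R ⧸ m)) (ModuleCat.of R C) i) := by
  obtain ⟨rs, h1, h2, h3⟩ := h
  rw [← h3] at hi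
  refine ModuleCat.subsingleton_ext_of_exists_isRegular m _ ?_ _ (lt_top_iff_ne_top.2 hm) rs h1 h2 i
    (by exact_mod_cast hi)
  change Module.support R (R ⧸ m) ⊆ _
  rw [Module.support_eq_zeroLocus, Ideal.annihilator_quotient]

end AuslanderBuchsbaum

section Local

variable {R : Type u} [CommRing R]

/-- A generator that has a unit coefficient in some relation is superfluous. -/
theorem span_succAbove_eq_top {X : Type u} [AddCommGroup X] [Module R X] {n : ℕ}
    {v : Fin (n + 1) → X} (hv : Submodule.span R (Set.range v) = ⊤) {x : Fin (n + 1) → R}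
    (hx : ∑ k, x k • v k = 0) (j : Fin (n + 1)) (hj : IsUnit (x j)) :
    Submodule.span R (Set.range (v ∘ j.succAbove)) = ⊤ := by
  rw [eq_top_iff, ← hv, Submodule.span_le]
  rintro _ ⟨k, rfl⟩
  have hmem : ∀ i, v (j.succAbove i) ∈ Submodule.span R (Set.range (v ∘ j.succAbove)) :=
    fun i ↦ Submodule.subset_span ⟨i, rfl⟩
  rcases Fin.eq_self_or_eq_succAbove j k with rfl | ⟨i, rfl⟩
  · rw [Fin.sum_univ_succAbove _ k, add_eq_zero_iff_eq_neg] at hx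
    have h1 : x k • v k ∈ Submodule.span R (Set.range (v ∘ k.succAbove)) := by
      rw [hx]
      exact Submodule.neg_mem _ (Submodule.sum_mem _ fun i _ ↦ Submodule.smul_mem _ _ (hmem i))
    exact (Submodule.smul_mem_iff_of_isUnit _ hj).1 h1
  · exact hmem i

variable [IsLocalRing R]

/-- A minimal system of generators: a relation with a unit coefficient would make one of the generators
redundant. -/
theorem exists_minimal_cover (X : Type u) [AddCommGroup X] [Module R X] [Module.Finite R X] :
    ∃ (n : ℕ) (f : (Fin n → R) →ₗ[R] X), Function.Surjective f ∧
      ∀ x ∈ LinearMap.ker f, ∀ j, x j ∈ maximalIdeal R := by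
  classical
  have hex : ∃ n, ∃ v : Fin n → X, Submodule.span R (Set.range v) = ⊤ := Module.Finite.exists_fin
  obtain ⟨v, hv⟩ := Nat.find_spec hex
  have hmin : ∀ k, k < Nat.find hex → _ := fun k hk ↦ Nat.find_min hex hk
  generalize Nat.find hex = n at v hv hmin
  refine ⟨n, Fintype.linearCombination R v, ?_, fun x hx j ↦ ?_⟩
  · rw [← LinearMap.range_eq_top, Fintype.range_linearCombination, hv]
  · by_contra hj
    rcases n with _ | n
    · exact j.elim0
    · refine hmin n (Nat.lt_succ_self n) ⟨_, span_succAbove_eq_top hv hx j ?_⟩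
      rwa [mem_maximalIdeal, mem_nonunits_iff, not_not] at hj

/-- By the Auslander–Buchsbaum argument, perfect modules of maximal dimension over a local Gorenstein
ring are free. -/
theorem free_of_isPerfectModule (hR : IsGorensteinRing R) {C : Type u} [AddCommGroup C] [Module R C]
    [Module.Finite R C] (hC : IsPerfectModule C (maximalIdeal R)) (hmax : IsMaximalModule R C) :
    Module.Free R C := by
  have := hR.noetherian
  obtain ⟨d, hd⟩ := exists_hasGradeDim_of_isLocalRing hR
  obtain ⟨hCM, n, hn⟩ := hC
  have hm : maximalIdeal R • (⊤ : Submodule R C) ≠ ⊤ := by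
    obtain ⟨rs, -, h2, -⟩ := hCM
    have := h2.nontrivial
    exact (Submodule.top_ne_ideal_smul_of_le_jacobson_annihilator
      (maximalIdeal_le_jacobson _)).symm
  have := projective_of_subsingleton_ext hd (fun X ↦ Module.Finite R X)
    (fun X hX ↦ by
      obtain ⟨n, f, hf, hker⟩ := exists_minimal_cover (R := R) X
      exact ⟨n, f, hf, hker, inferInstanceAs (Module.Finite R (LinearMap.ker f))⟩)
    n (ModuleCat.of R C) ‹_› hn
    (fun i hi ↦ hCM.subsingleton_ext hm (by
      rw [hmax, hd.1]
      exact_mod_cast hi))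
  have : Module.Projective R C := this
  exact Module.free_of_flat_of_isLocalRing

end Local

/-! ### Graded modules -/

namespace Gr

open DirectSum

section GradedModules

/-- A criterion for a generating family of subgroups `deg` to be a direct sum decomposition: there are
maps `π i` which vanish on `deg j` for `j ≠ i` and are injective on `deg i`. -/
theorem isInternal_of_projections {A B : Type*} [AddCommGroup A] [AddCommGroup B]
    (deg : ℤ → AddSubgroup A) (π : ℤ → A →+ B)
    (h1 : ∀ i j, ∀ x ∈ deg j, j ≠ i → π i x = 0) (h2 : ∀ i, ∀ x ∈ deg i, π i x = 0 → x = 0)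
    (h3 : ∀ x, x ∈ ⨆ i, deg i) : IsInternal deg := by
  classical
  constructor
  · rw [injective_iff_map_eq_zero]
    intro x hx
    have key : ∀ (i : ℤ) (y : ⨁ i, deg i), π i (DirectSum.coeAddMonoidHom deg y) = π i (y i) := by
      intro i y
      induction y using DirectSum.induction_on with
      | zero => simp
      | of j y =>
        rw [DirectSum.coeAddMonoidHom_of]
        by_cases hij : j = i
        · subst hij
          rw [DirectSum.of_eq_same]
        · rw [DirectSum.of_eq_of_ne _ _ _ (Ne.symm hij), h1 i j y y.2 hij]
          simp
      | add y z hy hz => rw [map_add, map_add, hy, hz, DirectSum.add_apply, AddSubgroup.coe_add,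
          map_add]
    ext i
    exact h2 i _ (x i).2 (by rw [← key, hx, map_zero])
  · intro x
    refine AddSubgroup.iSup_induction (C := fun x ↦ ∃ y, DirectSum.coeAddMonoidHom deg y = x) deg
      (h3 x) (fun i x hx ↦ ⟨DirectSum.of (fun i ↦ deg i) i ⟨x, hx⟩, by simp⟩) ⟨0, map_zero _⟩ ?_
    rintro _ _ ⟨y, rfl⟩ ⟨z, rfl⟩
    exact ⟨y + z, map_add _ _ _⟩

variable {K : Type v} [Field K] {R : Type u} [CommRing R] [Algebra K R]
  {𝒜 : ℤ → Submodule K R}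

namespace GrMod

variable (N : GrMod 𝒜)

/-- The projection of a graded module onto its component of degree `i`. -/
noncomputable def proj (i : ℤ) : N →+ N :=
  letI := N.isInternal.chooseDecomposition
  (N.deg i).subtype.comp ((DFinsupp.evalAddMonoidHom i).comp
    (decomposeAddEquiv N.deg).toAddMonoidHom)

theorem proj_mem (i : ℤ) (x : N) : N.proj i x ∈ N.deg i := SetLike.coe_mem _

variable {N} in
theorem proj_of_mem {i : ℤ} {x : N} (hx : x ∈ N.deg i) : N.proj i x = x :=
  letI := N.isInternal.chooseDecomposition
  decompose_of_mem_same N.deg hx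

variable {N} in
theorem proj_of_mem_ne {i j : ℤ} {x : N} (hx : x ∈ N.deg i) (hij : i ≠ j) : N.proj j x = 0 :=
  letI := N.isInternal.chooseDecomposition
  decompose_of_mem_ne N.deg hx hij

theorem mem_iSup_deg (x : N) : x ∈ ⨆ i, N.deg i := by
  obtain ⟨y, rfl⟩ := N.isInternal.2 x
  induction y using DirectSum.induction_on with
  | zero => simp
  | of i y =>
    rw [DirectSum.coeAddMonoidHom_of]
    exact AddSubgroup.mem_iSup_of_mem i y.2
  | add y z hy hz => rw [map_add]; exact add_mem hy hz

variable {N} in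
theorem induction {p : N → Prop} (mem : ∀ i, ∀ x ∈ N.deg i, p x)
    (add : ∀ x y, p x → p y → p (x + y)) (x : N) : p x :=
  AddSubgroup.iSup_induction (C := p) N.deg (N.mem_iSup_deg x) mem (mem 0 0 (zero_mem _)) add

theorem exists_eq_sum_proj (x : N) : ∃ s : Finset ℤ, x = ∑ i ∈ s, N.proj i x := by
  classical
  let := N.isInternal.chooseDecomposition
  exact ⟨_, (sum_support_decompose N.deg x).symm⟩

variable {N} in
theorem mem_deg_iff {i : ℤ} {x : N} : x ∈ N.deg i ↔ N.proj i x = x :=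
  ⟨proj_of_mem, fun h ↦ h ▸ N.proj_mem i x⟩

variable {N} in
theorem proj_smul_of_mem_left {i : ℤ} {r : R} (hr : r ∈ 𝒜 i) (j : ℤ) (x : N) :
    N.proj j (r • x) = r • N.proj (j - i) x := by
  induction x using GrMod.induction with
  | mem k x hx =>
    have h := N.smul_mem hr hx
    by_cases hk : i + k = j
    · rw [proj_of_mem (hk ▸ h), proj_of_mem ((show k = j - i by omega) ▸ hx)]
    · rw [proj_of_mem_ne h hk, proj_of_mem_ne hx (by omega), smul_zero]
  | add x y hx hy => rw [smul_add, map_add, map_add, hx, hy, smul_add]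

variable {N} in
theorem proj_smul_of_mem [GradedAlgebra 𝒜] {j : ℤ} {x : N} (hx : x ∈ N.deg j) (i : ℤ) (r : R) :
    N.proj i (r • x) = (decompose 𝒜 r (i - j) : R) • x := by
  induction r using DirectSum.Decomposition.inductionOn 𝒜 with
  | zero => simp
  | @homogeneous k r =>
    rw [proj_smul_of_mem_left r.2]
    by_cases hk : i - k = j
    · rw [proj_of_mem (hk ▸ hx), decompose_of_mem_same 𝒜 ((show k = i - j by omega) ▸ r.2)]
    · rw [proj_of_mem_ne hx (Ne.symm hk), smul_zero, decompose_of_mem_ne 𝒜 r.2 (by omega), zero_smul]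
  | add r s hr hs => rw [add_smul, map_add, hr, hs, decompose_add, DirectSum.add_apply,
      Submodule.coe_add, add_smul]

end GrMod

variable {M N P : GrMod 𝒜}

theorem IsGradedHom.map_proj {f : M →ₗ[R] N} (hf : IsGradedHom f) (i : ℤ) (x : M) :
    f (M.proj i x) = N.proj i (f x) := by
  induction x using GrMod.induction with
  | mem j x hx =>
    by_cases hj : j = i
    · subst hj
      rw [GrMod.proj_of_mem hx, GrMod.proj_of_mem (hf _ _ hx)]
    · rw [GrMod.proj_of_mem_ne hx hj, GrMod.proj_of_mem_ne (hf _ _ hx) hj, map_zero]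
  | add x y hx hy => simp only [map_add, hx, hy]

theorem IsGradedHom.exists_mem_deg {f : M →ₗ[R] N} (hf : IsGradedHom f)
    (hsurj : Function.Surjective f) {i : ℤ} {y : N} (hy : y ∈ N.deg i) :
    ∃ x ∈ M.deg i, f x = y := by
  obtain ⟨x, rfl⟩ := hsurj y
  exact ⟨M.proj i x, M.proj_mem i x, by rw [hf.map_proj, GrMod.proj_of_mem hy]⟩

theorem IsGradedHom.comp {g : N →ₗ[R] P} {f : M →ₗ[R] N} (hg : IsGradedHom g)
    (hf : IsGradedHom f) : IsGradedHom (g ∘ₗ f) := fun i x hx ↦ hg i _ (hf i x hx)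

theorem IsGradedHom.mem_deg_iff {e : M ≃ₗ[R] N} (he : IsGradedHom (e : M →ₗ[R] N)) (i : ℤ)
    (x : M) : x ∈ M.deg i ↔ e x ∈ N.deg i := by
  refine ⟨he i x, fun h ↦ ?_⟩
  rw [GrMod.mem_deg_iff] at h ⊢
  exact e.injective ((he.map_proj i x).trans h)

theorem GradedIso.symm (h : GradedIso M N) : GradedIso N M := by
  obtain ⟨e, he⟩ := h
  exact ⟨e.symm, fun i x ↦ by rw [he, e.apply_symm_apply]⟩

theorem GradedIso.refl (M : GrMod 𝒜) : GradedIso M M := ⟨LinearEquiv.refl R M, fun _ _ ↦ Iff.rfl⟩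

theorem GradedIso.trans (h : GradedIso M N) (h' : GradedIso N P) : GradedIso M P := by
  obtain ⟨e, he⟩ := h
  obtain ⟨e', he'⟩ := h'
  exact ⟨e.trans e', fun i x ↦ (he i x).trans (he' i _)⟩

namespace GrMod

/-- The shifted module `N(a)`, with `[N(a)]_i = [N]_{i + a}`. -/
abbrev shift (N : GrMod 𝒜) (a : ℤ) : GrMod 𝒜 where
  carrier := N
  deg i := N.deg (i + a)
  isInternal := isInternal_of_projections _ (fun i ↦ N.proj (i + a))
    (fun _ _ _ hx hij ↦ proj_of_mem_ne hx (by omega))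
    (fun _ _ hx h ↦ by rwa [proj_of_mem hx] at h) fun x ↦ by
      induction x using GrMod.induction with
      | mem i x hx => exact AddSubgroup.mem_iSup_of_mem (i - a) (by rwa [sub_add_cancel])
      | add x y hx hy => exact add_mem hx hy
  smul_mem hr hx := by
    rw [add_assoc]
    exact N.smul_mem hr hx

/-- The direct sum of two graded modules. -/
abbrev prod (M N : GrMod 𝒜) : GrMod 𝒜 where
  carrier := M × N
  deg i := (M.deg i).prod (N.deg i)
  isInternal := isInternal_of_projections _ (fun i ↦ (M.proj i).prodMap (N.proj i))
    (fun _ _ _ hx hij ↦ Prod.ext (proj_of_mem_ne hx.1 hij) (proj_of_mem_ne hx.2 hij))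
    (fun i x hx h ↦ by
      rw [← h]
      exact (Prod.ext (proj_of_mem hx.1) (proj_of_mem hx.2)).symm) fun x ↦ by
      have h1 : ∀ x : M, (x, (0 : N)) ∈ ⨆ i, (M.deg i).prod (N.deg i) := fun x ↦ by
        induction x using GrMod.induction with
        | mem i x hx => exact AddSubgroup.mem_iSup_of_mem i ⟨hx, zero_mem _⟩
        | add x y hx hy => simpa using add_mem hx hy
      have h2 : ∀ y : N, ((0 : M), y) ∈ ⨆ i, (M.deg i).prod (N.deg i) := fun y ↦ by
        induction y using GrMod.induction with
        | mem i x hx => exact AddSubgroup.mem_iSup_of_mem i ⟨zero_mem _, hx⟩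
        | add x y hx hy => simpa using add_mem hx hy
      simpa using add_mem (h1 x.1) (h2 x.2)
  smul_mem hr hx := ⟨M.smul_mem hr hx.1, N.smul_mem hr hx.2⟩

/-- The kernel of a graded homomorphism. -/
abbrev ker (f : M →ₗ[R] N) (hf : IsGradedHom f) : GrMod 𝒜 where
  carrier := LinearMap.ker f
  deg i := (M.deg i).comap (LinearMap.ker f).subtype.toAddMonoidHom
  isInternal := isInternal_of_projections _
    (fun i ↦ (M.proj i).comp (LinearMap.ker f).subtype.toAddMonoidHom)
    (fun _ _ _ hx hij ↦ proj_of_mem_ne hx hij)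
    (fun i x hx h ↦ Subtype.ext ((proj_of_mem hx).symm.trans h)) fun x ↦ by
      obtain ⟨s, hs⟩ := M.exists_eq_sum_proj x
      have hx : ∀ i, M.proj i x ∈ LinearMap.ker f := fun i ↦ by
        rw [LinearMap.mem_ker, hf.map_proj, LinearMap.mem_ker.1 x.2, map_zero]
      have : x = ∑ i ∈ s, (⟨M.proj i x, hx i⟩ : LinearMap.ker f) := by
        refine Subtype.ext (hs.trans ?_)
        rw [AddSubmonoidClass.coe_finsetSum]
      rw [this]
      exact sum_mem fun i _ ↦ AddSubgroup.mem_iSup_of_mem i (M.proj_mem i x)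
  smul_mem hr hx := M.smul_mem hr hx

/-- The quotient of a graded module by a graded submodule. -/
abbrev quotient (M : GrMod 𝒜) (S : Submodule R M) (hS : ∀ x ∈ S, ∀ i, M.proj i x ∈ S) : GrMod 𝒜 where
  carrier := M ⧸ S
  deg i := (M.deg i).map S.mkQ.toAddMonoidHom
  isInternal := isInternal_of_projections _
    (fun i ↦ (QuotientAddGroup.lift S.toAddSubgroup (S.mkQ.toAddMonoidHom.comp (M.proj i))
      fun x hx ↦ (Submodule.Quotient.mk_eq_zero S).2 (hS x hx i) : (M ⧸ S) →+ (M ⧸ S)))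
    (by
      rintro i j _ ⟨x, hx, rfl⟩ hij
      change S.mkQ (M.proj i x) = 0
      rw [proj_of_mem_ne hx hij, map_zero])
    (by
      rintro i _ ⟨x, hx, rfl⟩ h
      change S.mkQ (M.proj i x) = 0 at h
      rwa [proj_of_mem hx] at h)
    (by
      intro x
      obtain ⟨x, rfl⟩ := S.mkQ_surjective x
      induction x using GrMod.induction with
      | mem i x hx => exact AddSubgroup.mem_iSup_of_mem i ⟨x, hx, rfl⟩
      | add x y hx hy => rw [map_add]; exact add_mem hx hy)
  smul_mem := by
    rintro i j r _ hr ⟨x, hx, rfl⟩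
    exact ⟨r • x, M.smul_mem hr hx, S.mkQ.map_smul r x⟩

/-- The graded free module `⨁ R(-d k)`. -/
abbrev free [GradedAlgebra 𝒜] {ι : Type} [Fintype ι] (d : ι → ℤ) : GrMod 𝒜 where
  carrier := ι → R
  deg i :=
    { carrier := {x | ∀ k, x k ∈ 𝒜 (i - d k)}
      zero_mem' := fun _ ↦ zero_mem _
      add_mem' := fun hx hy k ↦ add_mem (hx k) (hy k)
      neg_mem' := fun hx k ↦ neg_mem (hx k) }
  isInternal := by
    classical
    refine isInternal_of_projections _
      (fun i ↦ AddMonoidHom.mk' (fun (x : ι → R) k ↦ (decompose 𝒜 (x k) (i - d k) : R))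
        fun x y ↦ ?_) ?_ ?_ ?_
    · ext k
      simp [decompose_add]
    · intro i j x hx hij
      ext k
      exact decompose_of_mem_ne 𝒜 (hx k) (by omega)
    · intro i x hx h
      rw [← h]
      ext k
      exact (decompose_of_mem_same 𝒜 (hx k)).symm
    · intro x
      rw [← Finset.univ_sum_single x]
      refine sum_mem fun k _ ↦ ?_
      induction x k using DirectSum.Decomposition.inductionOn 𝒜 with
      | zero => simp
      | @homogeneous j r =>
        refine AddSubgroup.mem_iSup_of_mem (j + d k) fun l ↦ ?_
        by_cases hl : l = k
        · subst hl
          simp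
        · simp [Pi.single_eq_of_ne hl]
      | add r s hr hs => rw [Pi.single_add]; exact add_mem hr hs
  smul_mem hr hx k := by
    have := SetLike.mul_mem_graded hr (hx k)
    rwa [← add_sub_assoc] at this

end GrMod

section Free

variable [GradedAlgebra 𝒜]

theorem isGradedHom_linearCombination {ι : Type} [Fintype ι] {d : ι → ℤ} {v : ι → N}
    (hv : ∀ k, v k ∈ N.deg (d k)) :
    IsGradedHom (M := GrMod.free d) (Fintype.linearCombination R v) := by
  intro i x hx
  refine sum_mem (f := fun k ↦ x k • v k) fun k _ ↦ ?_
  have := N.smul_mem (hx k) (hv k)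
  rwa [sub_add_cancel] at this

theorem GrMod.single_mem_free {ι : Type} [Fintype ι] [DecidableEq ι] (d : ι → ℤ) (k : ι) :
    (Pi.single k 1 : ι → R) ∈ (GrMod.free (𝒜 := 𝒜) d).deg (d k) := by
  intro l
  by_cases hl : l = k
  · subst hl
    rw [Pi.single_eq_same, sub_self]
    exact SetLike.GradedOne.one_mem
  · rw [Pi.single_eq_of_ne hl]
    exact zero_mem _

/-- Graded free modules are projective in the category of graded modules. -/
theorem exists_graded_lift {ι : Type} [Fintype ι] {d : ι → ℤ} {g : M →ₗ[R] N} (hg : IsGradedHom g)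
    (hsurj : Function.Surjective g) {f : GrMod.free (𝒜 := 𝒜) d →ₗ[R] N} (hf : IsGradedHom f) :
    ∃ h : GrMod.free (𝒜 := 𝒜) d →ₗ[R] M, IsGradedHom h ∧ g ∘ₗ h = f := by
  classical
  choose v hv hgv using fun k ↦ hg.exists_mem_deg hsurj (hf _ _ (GrMod.single_mem_free d k))
  refine ⟨Fintype.linearCombination R v, isGradedHom_linearCombination hv, ?_⟩
  refine LinearMap.pi_ext' fun k ↦ LinearMap.ext_ring ?_
  rw [LinearMap.comp_apply, LinearMap.comp_apply, LinearMap.coe_single,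
    Fintype.linearCombination_apply_single, one_smul, hgv]
  rfl

theorem IsGradedFree.gradedIso_free (h : IsGradedFree N) :
    ∃ (n : ℕ) (d : Fin n → ℤ), GradedIso (GrMod.free (𝒜 := 𝒜) d) N := by
  obtain ⟨n, b, d, hb⟩ := h
  refine ⟨n, d, b.equivFun.symm, IsGradedHom.mem_deg_iff (M := GrMod.free d)
    (e := b.equivFun.symm) ?_⟩
  have := isGradedHom_linearCombination hb
  have h2 : (b.equivFun.symm : (Fin n → R) →ₗ[R] N) = Fintype.linearCombination R b :=
    LinearMap.ext fun x ↦ b.equivFun_symm_apply x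
  rwa [← h2] at this

omit [GradedAlgebra 𝒜] in
theorem IsGradedFree.of_gradedIso (h : GradedIso M N) (hM : IsGradedFree M) : IsGradedFree N := by
  obtain ⟨n, b, d, hb⟩ := hM
  obtain ⟨e, he⟩ := h
  exact ⟨n, b.map e, d, fun k ↦ by rw [Module.Basis.map_apply]; exact (he _ _).1 (hb k)⟩

theorem GrMod.isGradedFree_free {ι : Type} [Fintype ι] (d : ι → ℤ) :
    IsGradedFree (GrMod.free (𝒜 := 𝒜) d) := by
  classical
  refine ⟨Fintype.card ι, (Pi.basisFun R ι).reindex (Fintype.equivFin ι),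
    d ∘ (Fintype.equivFin ι).symm, fun k ↦ ?_⟩
  rw [Module.Basis.reindex_apply, Pi.basisFun_apply]
  exact GrMod.single_mem_free d _

omit [GradedAlgebra 𝒜] in
theorem IsGradedFree.shift (h : IsGradedFree N) (a : ℤ) : IsGradedFree (N.shift a) := by
  obtain ⟨n, b, d, hb⟩ := h
  exact ⟨n, b, fun k ↦ d k - a, fun k ↦ show b k ∈ N.deg _ by rw [sub_add_cancel]; exact hb k⟩

omit [GradedAlgebra 𝒜] in
theorem IsGradedFree.prod (hM : IsGradedFree M) (hN : IsGradedFree N) :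
    IsGradedFree (M.prod N) := by
  obtain ⟨n, b, d, hb⟩ := hM
  obtain ⟨k, b', d', hb'⟩ := hN
  refine ⟨n + k, (b.prod b').reindex finSumFinEquiv, Sum.elim d d' ∘ finSumFinEquiv.symm,
    fun j ↦ ?_⟩
  rw [Module.Basis.reindex_apply, Function.comp_apply]
  cases finSumFinEquiv.symm j with
  | inl i =>
    rw [Sum.elim_inl]
    exact ⟨by simpa using hb i, by simp⟩
  | inr i =>
    rw [Sum.elim_inr]
    exact ⟨by simp, by simpa using hb' i⟩

omit [GradedAlgebra 𝒜] in
theorem exists_homogeneous_generators (N : GrMod 𝒜) [Module.Finite R N] :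
    ∃ (n : ℕ) (v : Fin n → N), (∀ k, ∃ i, v k ∈ N.deg i) ∧
      Submodule.span R (Set.range v) = ⊤ := by
  have h : Submodule.span R {x | ∃ i, x ∈ N.deg i} = ⊤ := by
    rw [eq_top_iff]
    intro x _
    induction x using GrMod.induction with
    | mem i x hx => exact Submodule.subset_span ⟨i, hx⟩
    | add x y hx hy => exact add_mem (hx trivial) (hy trivial)
  obtain ⟨T, hT, hspan⟩ := Submodule.fg_span_iff_fg_span_finset_subset _ |>.1
    (h ▸ Module.Finite.fg_top : (Submodule.span R {x : N | ∃ i, x ∈ N.deg i}).FG)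
  refine ⟨T.card, fun k ↦ (T.equivFin.symm k : N), fun k ↦ hT (T.equivFin.symm k).2, ?_⟩
  rw [← h, hspan]
  congr 1
  ext x
  constructor
  · rintro ⟨k, rfl⟩
    exact (T.equivFin.symm k).2
  · intro hx
    exact ⟨T.equivFin ⟨x, hx⟩, by simp⟩

theorem exists_minimal_generators (h𝒜 : IsStandardGraded 𝒜) (N : GrMod 𝒜) [Module.Finite R N] :
    ∃ (n : ℕ) (v : Fin n → N) (d : Fin n → ℤ), (∀ k, v k ∈ N.deg (d k)) ∧
      Submodule.span R (Set.range v) = ⊤ ∧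
      ∀ x ∈ LinearMap.ker (Fintype.linearCombination R v), ∀ j, x j ∈ irrelevant 𝒜 := by
  classical
  have hex := exists_homogeneous_generators N
  obtain ⟨v, hv, hspan⟩ := Nat.find_spec hex
  have hmin : ∀ k, k < Nat.find hex → _ := fun k hk ↦ Nat.find_min hex hk
  generalize Nat.find hex = n at v hv hspan hmin
  choose d hd using hv
  refine ⟨n, v, d, hd, hspan, fun x hx j ↦ ?_⟩
  rw [mem_irrelevant_iff h𝒜]
  by_contra hj
  rcases n with _ | n
  · exact j.elim0
  -- the homogeneous component of the relation in the degree of the generator `v j`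
  have hx' : ∑ k, (decompose 𝒜 (x k) (d j - d k) : R) • v k = 0 := by
    have := congrArg (N.proj (d j)) (LinearMap.mem_ker.1 hx)
    rw [map_zero, Fintype.linearCombination_apply, map_sum] at this
    rw [← this]
    exact Finset.sum_congr rfl fun k _ ↦ (GrMod.proj_smul_of_mem (hd k) _ _).symm
  refine hmin n (Nat.lt_succ_self n) ⟨v ∘ j.succAbove, fun k ↦ ⟨_, hd _⟩,
    span_succAbove_eq_top hspan hx' j ?_⟩
  rw [sub_self]
  have h0 : (decompose 𝒜 (x j) 0 : R) ∈ 𝒜 0 := SetLike.coe_mem _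
  refine isUnit_of_mem_zero h𝒜 h0 ?_
  rwa [mem_irrelevant_iff h𝒜, decompose_of_mem_same 𝒜 h0]

/-- A minimal system of homogeneous generators. -/
theorem exists_minimal_cover (h𝒜 : IsStandardGraded 𝒜) (N : GrMod 𝒜) [Module.Finite R N] :
    ∃ (n : ℕ) (d : Fin n → ℤ) (f : GrMod.free (𝒜 := 𝒜) d →ₗ[R] N), IsGradedHom f ∧
      Function.Surjective f ∧ ∀ x ∈ LinearMap.ker f, ∀ j : Fin n, x j ∈ irrelevant 𝒜 := by
  obtain ⟨n, v, d, hv, hspan, hker⟩ := exists_minimal_generators h𝒜 N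
  refine ⟨n, d, Fintype.linearCombination R v, isGradedHom_linearCombination hv, ?_, hker⟩
  rw [← LinearMap.range_eq_top, ← hspan]
  exact Fintype.range_linearCombination R v

/-- The class of finitely generated modules which underlie some graded module is closed under minimal
syzygies. The gradings are forgotten, since `Ext` is taken in the category of all modules. -/
theorem exists_linear_cover [IsNoetherianRing R] (h𝒜 : IsStandardGraded 𝒜) (X : ModuleCat.{u} R)
    (hX : Module.Finite R X ∧ ∃ N : GrMod 𝒜, Nonempty (N ≃ₗ[R] X)) :
    ∃ (n : ℕ) (f : (Fin n → R) →ₗ[R] X), Function.Surjective f ∧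
      (∀ x ∈ LinearMap.ker f, ∀ j, x j ∈ irrelevant 𝒜) ∧
      Module.Finite R (LinearMap.ker f) ∧ ∃ N : GrMod 𝒜, Nonempty (N ≃ₗ[R] LinearMap.ker f) := by
  obtain ⟨_, N, ⟨e⟩⟩ := hX
  have : Module.Finite R N := Module.Finite.equiv e.symm
  obtain ⟨n, d, f, hf, hsurj, hker⟩ := exists_minimal_cover h𝒜 N
  have hk : LinearMap.ker (e.toLinearMap ∘ₗ f) = LinearMap.ker f := LinearEquiv.ker_comp _ _
  refine ⟨n, e.toLinearMap ∘ₗ f, e.surjective.comp hsurj, ?_, ?_, GrMod.ker f hf, ?_⟩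
  · intro x hx
    rw [hk] at hx
    exact hker x hx
  · exact inferInstanceAs (Module.Finite R
      (LinearMap.ker (e.toLinearMap ∘ₗ f : (Fin n → R) →ₗ[R] X)))
  · exact ⟨(LinearEquiv.ofEq _ _ hk).symm⟩

/-- A minimal graded cover of a projective module splits, so that its kernel vanishes by the graded
Nakayama lemma. -/
theorem isGradedFree_of_projective [IsNoetherianRing R] (h𝒜 : IsStandardGraded 𝒜) (N : GrMod 𝒜)
    [Module.Finite R N] [Module.Projective R N] : IsGradedFree N := by
  obtain ⟨n, d, f, hf, hsurj, hker⟩ := exists_minimal_cover h𝒜 N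
  have hinj := injective_of_projective (m := irrelevant 𝒜) (X := N) f hsurj hker (by
    have : Module.Finite R (GrMod.ker f hf) := inferInstanceAs (Module.Finite R
      (LinearMap.ker (f : (Fin n → R) →ₗ[R] N)))
    obtain ⟨k, d', g, hg, hgsurj, hgker⟩ := exists_minimal_cover h𝒜 (GrMod.ker f hf)
    exact subsingleton_of_top_le_smul (irrelevant_isMaximal h𝒜).ne_top g hgsurj hgker)
  exact IsGradedFree.of_gradedIso ⟨LinearEquiv.ofBijective f ⟨hinj, hsurj⟩,
    IsGradedHom.mem_deg_iff (e := LinearEquiv.ofBijective f ⟨hinj, hsurj⟩) hf⟩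
    (GrMod.isGradedFree_free d)

theorem isGradedFree_of_isPerfectModule (h𝒜 : IsStandardGraded 𝒜) (hR : IsGorensteinRing R)
    (C : GrMod 𝒜) [Module.Finite R C] (hC : IsPerfectModule C (irrelevant 𝒜))
    (hmax : IsMaximalModule R C) : IsGradedFree C := by
  have := hR.noetherian
  have := irrelevant_isMaximal h𝒜
  obtain ⟨e, he⟩ := exists_hasGradeDim h𝒜 hR
  obtain ⟨hCM, n, hn⟩ := hC
  have hm : irrelevant 𝒜 • (⊤ : Submodule R C) ≠ ⊤ := by
    intro h
    obtain ⟨rs, -, h2, -⟩ := hCM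
    have := h2.nontrivial
    obtain ⟨n, d, f, hf, hsurj, hker⟩ := exists_minimal_cover h𝒜 C
    exact not_subsingleton C (subsingleton_of_top_le_smul (irrelevant_isMaximal h𝒜).ne_top f
      hsurj hker h.ge)
  have := projective_of_subsingleton_ext he
    (fun X ↦ Module.Finite R X ∧ ∃ N : GrMod 𝒜, Nonempty (N ≃ₗ[R] X))
    (exists_linear_cover h𝒜) n (ModuleCat.of R C) ⟨‹_›, C, ⟨LinearEquiv.refl R C⟩⟩ hn
    (fun i hi ↦ hCM.subsingleton_ext hm (by
      rw [hmax, he.1]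
      exact_mod_cast hi))
  have : Module.Projective R C := this
  exact isGradedFree_of_projective h𝒜 C

end Free

end GradedModules

end Gr

/-! ### Links by modules of maximal dimension -/

section Duality

variable {R : Type u} [CommRing R] {C M N P : Type u} [AddCommGroup C] [Module R C]
  [AddCommGroup M] [Module R M] [AddCommGroup N] [Module R N] [AddCommGroup P] [Module R P]

/-- The identification of `Ext^0(C, R)` with the dual of `C`. -/
noncomputable def extZeroEquiv (R : Type u) [CommRing R] (C : Type u) [AddCommGroup C]
    [Module R C] : ExtToRing R C 0 ≃ₗ[R] (C →ₗ[R] R) :=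
  (Ext.linearEquiv₀ (R := R)).trans ModuleCat.homLinearEquiv

theorem extZeroEquiv_symm_apply (f : C →ₗ[R] R) :
    (extZeroEquiv R C).symm f = Ext.mk₀ (ModuleCat.ofHom f) := rfl

/-- In codimension `0`, the kernel of the linking map of `φ` is the orthogonal complement of `ker φ`
with respect to the form `C → C → R` given by `α`. -/
theorem mem_ker_linkMap_iff (α : C ≃ₗ[R] ExtToRing R C 0) (φ : C →ₗ[R] M) (x : C) :
    x ∈ LinearMap.ker (linkMap α φ) ↔ ∀ y ∈ LinearMap.ker φ, extZeroEquiv R C (α x) y = 0 := by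
  have h1 : linkMap α φ x = Ext.mk₀ (ModuleCat.ofHom
      ((extZeroEquiv R C (α x)) ∘ₗ (LinearMap.ker φ).subtype)) := by
    have h2 : α x = Ext.mk₀ (ModuleCat.ofHom (extZeroEquiv R C (α x))) := by
      rw [← extZeroEquiv_symm_apply, LinearEquiv.symm_apply_apply]
    rw [ModuleCat.ofHom_comp, ← Ext.mk₀_comp_mk₀, ← h2]
    rfl
  rw [LinearMap.mem_ker, h1, Ext.mk₀_eq_zero_iff]
  constructor
  · intro h y hy
    exact LinearMap.congr_fun (congrArg ModuleCat.Hom.hom h) ⟨y, hy⟩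
  · intro h
    ext y
    exact h y y.2

theorem HasCodim.eq_zero [FiniteRingKrullDim R] {c : ℕ} (h : HasCodim R C c)
    (hmax : IsMaximalModule R C) : c = 0 := by
  rw [HasCodim, hmax] at h
  generalize hd : ringKrullDim R = d at h
  have h1 : d ≠ ⊥ := hd ▸ ringKrullDim_ne_bot
  have h2 : d ≠ ⊤ := hd ▸ ringKrullDim_ne_top
  induction d with
  | bot => exact absurd rfl h1
  | coe d =>
    induction d with
    | top => exact absurd rfl h2
    | coe d =>
      have : d + c = d := by exact_mod_cast h
      omega

theorem isMaximalModule_of_surjective (g : M →ₗ[R] N) (hg : Function.Surjective g)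
    (hN : IsMaximalModule R N) : IsMaximalModule R M :=
  le_antisymm (Module.supportDim_le_ringKrullDim R M)
    (hN.ge.trans (Module.supportDim_le_of_surjective g hg))

theorem isMaximalModule_self : IsMaximalModule R R := Module.supportDim_self_eq_ringKrullDim R

theorem isMaximalModule_of_free [Module.Free R M] [Nontrivial M] : IsMaximalModule R M := by
  obtain ⟨i⟩ := (Module.Free.chooseBasis R M).index_nonempty
  refine isMaximalModule_of_surjective ((Module.Free.chooseBasis R M).coord i) (fun r ↦
    ⟨r • Module.Free.chooseBasis R M i, by simp⟩) isMaximalModule_self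

/-- Two modules `M` and `P` that are linked to the same module `N` by `C` and `C'` become isomorphic
after adding `C'` and `C`: the lifts `a` and `b` of the epimorphisms onto `N` present both sums as
quotients of `C × C'` by the same submodule. The formula for the isomorphism shows that it is graded if
the given maps are. -/
theorem exists_equiv_of_linked {C' : Type u} [AddCommGroup C'] [Module R C']
    (β : C ≃ₗ[R] (C →ₗ[R] R)) (β' : C' ≃ₗ[R] (C' →ₗ[R] R))
    {ψ : C →ₗ[R] N} {χ : C →ₗ[R] M} (hχ : Function.Surjective χ)
    (hχψ : ∀ x, x ∈ LinearMap.ker χ ↔ ∀ y ∈ LinearMap.ker ψ, β x y = 0)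
    {φ' : C' →ₗ[R] N} {χ' : C' →ₗ[R] P} (hχ' : Function.Surjective χ')
    (hχφ' : ∀ x, x ∈ LinearMap.ker χ' ↔ ∀ y ∈ LinearMap.ker φ', β' x y = 0)
    (a : C →ₗ[R] C') (ha : φ' ∘ₗ a = ψ) (b : C' →ₗ[R] C) (hb : ψ ∘ₗ b = φ') :
    ∃ e : (M × C') ≃ₗ[R] (C × P), ∀ x x', e (χ x, x') =
      (x - β.symm ((β x ∘ₗ b + β' x') ∘ₗ a), χ' (β'.symm (β x ∘ₗ b + β' x'))) := by
  have ha' : ∀ x, φ' (a x) = ψ x := LinearMap.congr_fun ha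
  have hb' : ∀ x, ψ (b x) = φ' x := LinearMap.congr_fun hb
  let p : (C × C') →ₗ[R] (M × C') := χ.prodMap LinearMap.id
  let h : (C × C') →ₗ[R] (C' →ₗ[R] R) :=
    ((LinearMap.lcomp R R b) ∘ₗ β.toLinearMap).coprod β'.toLinearMap
  let q : (C × C') →ₗ[R] (C × P) :=
    (LinearMap.fst R C C' - β.symm.toLinearMap ∘ₗ LinearMap.lcomp R R a ∘ₗ h).prod
      (χ' ∘ₗ β'.symm.toLinearMap ∘ₗ h)
  have hp : Function.Surjective p := fun z ↦ by
    obtain ⟨x, hx⟩ := hχ z.1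
    exact ⟨(x, z.2), Prod.ext hx rfl⟩
  have hh : ∀ x x', h (x, x') = β x ∘ₗ b + β' x' := fun _ _ ↦ rfl
  have hq' : ∀ x x', q (x, x') =
      (x - β.symm ((β x ∘ₗ b + β' x') ∘ₗ a), χ' (β'.symm (β x ∘ₗ b + β' x'))) := fun _ _ ↦ rfl
  have hq : Function.Surjective q := by
    rintro ⟨y, z⟩
    obtain ⟨x', rfl⟩ := hχ' z
    let x := y + β.symm (β' x' ∘ₗ a)
    have h1 : β x ∘ₗ b + β' (β'.symm (β' x' - β x ∘ₗ b)) = β' x' := by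
      rw [LinearEquiv.apply_symm_apply]
      abel
    refine ⟨(x, β'.symm (β' x' - β x ∘ₗ b)), ?_⟩
    rw [hq', h1, LinearEquiv.symm_apply_apply, add_sub_cancel_right]
  have hker : LinearMap.ker p = LinearMap.ker q := by
    ext ⟨x, x'⟩
    rw [LinearMap.mem_ker, LinearMap.mem_ker, hq']
    change (χ x, x') = 0 ↔ _
    rw [Prod.mk_eq_zero, Prod.mk_eq_zero, ← LinearMap.mem_ker, hχψ, ← LinearMap.mem_ker, hχφ',
      LinearEquiv.apply_symm_apply, sub_eq_zero, LinearEquiv.eq_symm_apply]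
    constructor
    · rintro ⟨h1, rfl⟩
      rw [map_zero, add_zero]
      refine ⟨?_, fun y hy ↦ h1 _ ?_⟩
      · ext y
        rw [← sub_eq_zero, LinearMap.comp_apply, LinearMap.comp_apply, ← map_sub]
        refine h1 _ ?_
        rw [LinearMap.mem_ker, map_sub, hb', ha', sub_self]
      · rw [LinearMap.mem_ker, hb', LinearMap.mem_ker.1 hy]
    · rintro ⟨h1, h2⟩
      refine ⟨fun y hy ↦ ?_, ?_⟩
      · rw [h1]
        refine h2 _ ?_
        rw [LinearMap.mem_ker, ha', LinearMap.mem_ker.1 hy]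
      · rw [← LinearEquiv.map_eq_zero_iff β']
        ext y
        have h3 := h2 (y - a (b y)) (by rw [LinearMap.mem_ker, map_sub, ha', hb', sub_self])
        rw [map_sub, sub_eq_zero] at h3
        have h4 := LinearMap.congr_fun h1 (b y)
        rw [LinearMap.comp_apply, ← h3, LinearMap.add_apply, LinearMap.comp_apply] at h4
        simpa using h4
  let e := (p.quotKerEquivOfSurjective hp).symm.trans
    ((Submodule.quotEquivOfEq _ _ hker).trans (q.quotKerEquivOfSurjective hq))
  refine ⟨e, fun x x' ↦ ?_⟩
  have h1 : (χ x, x') = p.quotKerEquivOfSurjective hp (Submodule.Quotient.mk (x, x')) := rfl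
  rw [h1, ← hq']
  simp only [e, LinearEquiv.trans_apply, LinearEquiv.symm_apply_apply]
  rfl

/-- A module linked by a module `C` to a projective module is a direct summand of `C`. -/
theorem projective_of_linked (β : C ≃ₗ[R] (C →ₗ[R] R)) [Module.Projective R C]
    [Module.Projective R M] {φ : C →ₗ[R] M} (hφ : Function.Surjective φ) {ω : C →ₗ[R] N}
    (hω : Function.Surjective ω)
    (hωφ : ∀ x, x ∈ LinearMap.ker ω ↔ ∀ y ∈ LinearMap.ker φ, β x y = 0) :
    Module.Projective R N := by
  obtain ⟨s, hs⟩ := Module.projective_lifting_property φ LinearMap.id hφ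
  have hs' : ∀ x, φ (s x) = x := LinearMap.congr_fun hs
  -- a projection of `C` onto the kernel of `φ`
  let r : C →ₗ[R] C := LinearMap.id - s ∘ₗ φ
  have hr : ∀ x, r x = x - s (φ x) := fun _ ↦ rfl
  have hrmem : ∀ x, r x ∈ LinearMap.ker φ := fun x ↦ by
    rw [LinearMap.mem_ker, hr, map_sub, hs', sub_self]
  let h : C →ₗ[R] C := β.symm.toLinearMap ∘ₗ LinearMap.lcomp R R r ∘ₗ β.toLinearMap
  have hβ : ∀ x y, β (h x) y = β x (r y) := fun x y ↦ by
    change β (β.symm (β x ∘ₗ r)) y = _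
    rw [LinearEquiv.apply_symm_apply]
    rfl
  have hker : LinearMap.ker ω ≤ LinearMap.ker h := fun x hx ↦ by
    rw [LinearMap.mem_ker, ← LinearEquiv.map_eq_zero_iff β]
    ext y
    rw [hβ]
    exact (hωφ x).1 hx _ (hrmem y)
  have hωh : ∀ x, ω (h x) = ω x := fun x ↦ by
    rw [← sub_eq_zero, ← map_sub, ← LinearMap.mem_ker, hωφ]
    intro y hy
    rw [map_sub, LinearMap.sub_apply, hβ, hr, LinearMap.mem_ker.1 hy, map_zero, sub_zero, sub_self]
  let i : N →ₗ[R] C := (LinearMap.ker ω).liftQ h hker ∘ₗ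
    (ω.quotKerEquivOfSurjective hω).symm.toLinearMap
  refine Module.Projective.of_split i ω (LinearMap.ext fun z ↦ ?_)
  obtain ⟨x, rfl⟩ := hω z
  have h1 : ω x = ω.quotKerEquivOfSurjective hω (Submodule.Quotient.mk x) := rfl
  have h2 : i (ω x) = h x := by
    rw [h1]
    simp only [i, LinearMap.comp_apply, LinearEquiv.coe_coe, LinearEquiv.symm_apply_apply]
    rfl
  rw [LinearMap.comp_apply, h2, hωh, LinearMap.id_apply]

end Duality

section Pairing

variable {R : Type u} [CommRing R] {ι κ : Type} [Fintype ι] [Fintype κ] {M P : Type u}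
  [AddCommGroup M] [Module R M] [AddCommGroup P] [Module R P]

/-- The perfect pairing `(x, y) ↦ ∑ k, x (σ k) * y k` on `R^ι` given by a permutation `σ` of `ι`. It
is symmetric if `σ` is an involution. -/
noncomputable def pairing (R : Type u) [CommRing R] (σ : Equiv.Perm ι) :
    (ι → R) ≃ₗ[R] ((ι → R) →ₗ[R] R) := by
  classical
  exact (LinearEquiv.funCongrLeft R R σ).trans (dotProductEquiv R ι)

theorem pairing_apply (σ : Equiv.Perm ι) (x y : ι → R) :
    pairing R σ x y = ∑ k, x (σ k) * y k := rfl

theorem pairing_single [DecidableEq ι] (σ : Equiv.Perm ι) (x : ι → R) (k : ι) :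
    pairing R σ x (Pi.single k 1) = x (σ k) := by
  rw [pairing_apply, Finset.sum_eq_single k] <;> simp +contextual

theorem pairing_comm {σ : Equiv.Perm ι} (hσ : Function.Involutive σ) (x y : ι → R) :
    pairing R σ x y = pairing R σ y x := by
  rw [pairing_apply, pairing_apply, ← Equiv.sum_comp σ]
  exact Finset.sum_congr rfl fun k _ ↦ by rw [hσ k, mul_comm]

/-- The orthogonal complement of a submodule with respect to the pairing given by `σ`. -/
noncomputable def perp (σ : Equiv.Perm ι) (S : Submodule R (ι → R)) : Submodule R (ι → R) :=
  S.dualAnnihilator.comap (pairing R σ).toLinearMap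

theorem mem_perp {σ : Equiv.Perm ι} {S : Submodule R (ι → R)} {x : ι → R} :
    x ∈ perp σ S ↔ ∀ y ∈ S, pairing R σ x y = 0 := by
  rw [perp, Submodule.mem_comap, Submodule.mem_dualAnnihilator]
  rfl

/-- The kernels of `φ` and `ψ` are orthogonal complements of each other, so that `φ` and `ψ` provide
a direct link of their images. -/
def IsDualPair (σ : Equiv.Perm ι) (φ : (ι → R) →ₗ[R] M) (ψ : (ι → R) →ₗ[R] P) : Prop :=
  LinearMap.ker φ = perp σ (LinearMap.ker ψ) ∧ LinearMap.ker ψ = perp σ (LinearMap.ker φ)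

/-- If `M` is torsionless, the kernel of a map `R^ι → M` is its own double orthogonal complement. -/
theorem isDualPair_mkQ {σ : Equiv.Perm ι} (hσ : Function.Involutive σ) (φ : (ι → R) →ₗ[R] M)
    (hM : ∀ x : M, x ≠ 0 → ∃ f : M →ₗ[R] R, f x ≠ 0) :
    IsDualPair σ φ (perp σ (LinearMap.ker φ)).mkQ := by
  refine ⟨?_, Submodule.ker_mkQ _⟩
  rw [Submodule.ker_mkQ]
  ext z
  rw [mem_perp]
  constructor
  · intro hz y hy
    rw [pairing_comm hσ]
    exact mem_perp.1 hy z hz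
  · intro hz
    by_contra hne
    obtain ⟨f, hf⟩ := hM (φ z) hne
    obtain ⟨y, hy⟩ := (pairing R σ).surjective (f ∘ₗ φ)
    refine hf ?_
    have h1 : pairing R σ y z = f (φ z) := by rw [hy]; rfl
    rw [← h1, pairing_comm hσ]
    refine hz y (mem_perp.2 fun x hx ↦ ?_)
    rw [hy, LinearMap.comp_apply, LinearMap.mem_ker.1 hx, map_zero]

/-- The map `R^(ι ⊕ κ) → M × R^κ` that, for an involution `τ` of `ι ⊕ κ`, is dual to the composition
of a map `R^ι → P` dual to `φ` with the projection of `R^(ι ⊕ κ)` onto `R^ι`. -/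
noncomputable def extendLink (σ : Equiv.Perm ι) (τ : Equiv.Perm (ι ⊕ κ)) (φ : (ι → R) →ₗ[R] M) :
    (ι ⊕ κ → R) →ₗ[R] M × (κ → R) :=
  (φ ∘ₗ LinearMap.funLeft R R (fun k ↦ τ (Sum.inl (σ k)))).prod
    (LinearMap.funLeft R R (fun l ↦ τ (Sum.inr l)))

omit [Fintype ι] [Fintype κ] in
theorem extendLink_apply_symm {σ : Equiv.Perm ι} (hσ : Function.Involutive σ)
    {τ : Equiv.Perm (ι ⊕ κ)} (hτ : Function.Involutive τ) (φ : (ι → R) →ₗ[R] M) (x : ι → R)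
    (w : κ → R) : extendLink σ τ φ (fun k ↦ Sum.elim (x ∘ σ) w (τ k)) = (φ x, w) := by
  refine Prod.ext ?_ ?_
  · refine congrArg φ (funext fun k ↦ ?_)
    change Sum.elim (x ∘ σ) w (τ (τ (Sum.inl (σ k)))) = x k
    rw [hτ, Sum.elim_inl, Function.comp_apply, hσ]
  · funext l
    change Sum.elim (x ∘ σ) w (τ (τ (Sum.inr l))) = w l
    rw [hτ, Sum.elim_inr]

omit [Fintype ι] [Fintype κ] in
theorem extendLink_surjective {σ : Equiv.Perm ι} (hσ : Function.Involutive σ)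
    {τ : Equiv.Perm (ι ⊕ κ)} (hτ : Function.Involutive τ) {φ : (ι → R) →ₗ[R] M}
    (hφ : Function.Surjective φ) : Function.Surjective (extendLink σ τ φ) := by
  rintro ⟨m, w⟩
  obtain ⟨x, rfl⟩ := hφ m
  exact ⟨_, extendLink_apply_symm hσ hτ φ x w⟩

/-- The kernel of `R^(ι ⊕ κ) → R^ι → P` is the preimage of `ker ψ`, whose orthogonal complement for the
pairing of `τ` consists of the `z` for which `z ∘ τ` vanishes on `κ` and is, on `ι` and up to `σ`,
orthogonal to `ker ψ`. So it is the kernel of `extendLink σ τ φ`. -/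
theorem IsDualPair.extendLink {σ : Equiv.Perm ι} (hσ : Function.Involutive σ)
    {τ : Equiv.Perm (ι ⊕ κ)} (hτ : Function.Involutive τ) {φ : (ι → R) →ₗ[R] M}
    {ψ : (ι → R) →ₗ[R] P} (h : IsDualPair σ φ ψ) :
    IsDualPair τ (ψ ∘ₗ LinearMap.funLeft R R Sum.inl) (extendLink σ τ φ) := by
  classical
  have key : ∀ z y : ι ⊕ κ → R, pairing R τ z y =
      pairing R σ (fun k ↦ z (τ (Sum.inl (σ k)))) (y ∘ Sum.inl) +
        ∑ l, z (τ (Sum.inr l)) * y (Sum.inr l) := fun z y ↦ by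
    rw [pairing_apply, pairing_apply, Fintype.sum_sum_type]
    simp only [hσ _, Function.comp_apply]
  have hmem : ∀ z, z ∈ LinearMap.ker (ModuleLiaison.extendLink σ τ φ) ↔
      (fun k ↦ z (τ (Sum.inl (σ k)))) ∈ LinearMap.ker φ ∧ ∀ l, z (τ (Sum.inr l)) = 0 := fun z ↦ by
    rw [LinearMap.mem_ker, LinearMap.mem_ker, Prod.ext_iff, ← funext_iff]
    rfl
  have hmem' : ∀ y, y ∈ LinearMap.ker (ψ ∘ₗ LinearMap.funLeft R R (Sum.inl : ι → ι ⊕ κ)) ↔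
      y ∘ Sum.inl ∈ perp σ (LinearMap.ker φ) := fun y ↦ by
    rw [← h.2]
    rfl
  constructor
  · ext y
    rw [hmem', mem_perp, mem_perp]
    constructor
    · intro hy z hz
      rw [hmem] at hz
      rw [pairing_comm hτ, key, pairing_comm hσ, hy _ hz.1, zero_add]
      exact Finset.sum_eq_zero fun l _ ↦ by rw [hz.2, zero_mul]
    · intro hy x hx
      have h1 := extendLink_apply_symm (M := M) hσ hτ φ x 0
      have h2 := hy _ (LinearMap.mem_ker.2 (h1.trans (Prod.ext hx rfl)))
      rw [pairing_comm hτ, key] at h2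
      simp only [hτ _, Sum.elim_inl, Sum.elim_inr, Function.comp_apply, hσ _, Pi.zero_apply,
        zero_mul, Finset.sum_const_zero, add_zero] at h2
      rw [pairing_comm hσ]
      exact h2
  · ext z
    rw [hmem, mem_perp]
    constructor
    · rintro ⟨h1, h2⟩ y hy
      rw [hmem'] at hy
      rw [key, pairing_comm hσ, mem_perp.1 hy _ h1, zero_add]
      exact Finset.sum_eq_zero fun l _ ↦ by rw [h2, zero_mul]
    · intro hz
      constructor
      · rw [h.1, mem_perp]
        intro y hy
        have h1 := hz (Sum.elim y 0) ((hmem' _).2 (by rwa [Sum.elim_comp_inl, ← h.2]))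
        rw [key, Sum.elim_comp_inl] at h1
        simpa using h1
      · intro l
        have h1 := hz (Sum.elim 0 (Pi.single l 1)) ((hmem' _).2 (by
          rw [Sum.elim_comp_inl]
          exact zero_mem _))
        rw [key, Sum.elim_comp_inl, map_zero, zero_add, Finset.sum_eq_single l] at h1
        · simpa using h1
        · intro j _ hj
          rw [Sum.elim_inr, Pi.single_eq_of_ne hj, mul_zero]
        · simp

/-- A redundant generator of `M`, i.e. a basis vector `k` in `ker φ`, makes the coordinate `σ k` vanish
on `ker ψ = (ker φ)^⊥`. This coordinate thus induces a surjection of `P` onto `R`. -/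
theorem IsDualPair.isMaximalModule [DecidableEq ι] {σ : Equiv.Perm ι} {φ : (ι → R) →ₗ[R] M}
    {ψ : (ι → R) →ₗ[R] P} (h : IsDualPair σ φ ψ) (hψ : Function.Surjective ψ) {k : ι}
    (hk : φ (Pi.single k 1) = 0) : IsMaximalModule R P := by
  have hle : LinearMap.ker ψ ≤ LinearMap.ker (LinearMap.proj (σ k) : (ι → R) →ₗ[R] R) := by
    intro y hy
    rw [h.2, mem_perp] at hy
    rw [LinearMap.mem_ker, LinearMap.proj_apply, ← pairing_single σ y k]
    exact hy _ hk
  refine isMaximalModule_of_surjective (N := R)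
    ((LinearMap.ker ψ).liftQ _ hle ∘ₗ (ψ.quotKerEquivOfSurjective hψ).symm.toLinearMap)
    (Function.Surjective.comp (g := (LinearMap.ker ψ).liftQ _ hle) ?_
      (ψ.quotKerEquivOfSurjective hψ).symm.surjective) isMaximalModule_self
  intro r
  exact ⟨Submodule.Quotient.mk (Pi.single (σ k) r), by simp⟩

theorem isPerfectModule_pi [IsNoetherianRing R] {m : Ideal R} [m.IsMaximal] {d : ℕ}
    (hd : HasGradeDim R m d) [Nonempty ι] : IsPerfectModule (ι → R) m := by
  have hm : m ≠ ⊤ := Ideal.IsPrime.ne_top'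
  have : Nontrivial R := by
    by_contra hcon
    rw [not_nontrivial_iff_subsingleton] at hcon
    exact hm (Subsingleton.elim _ _)
  refine ⟨?_, 0, projective_iff_hasProjectiveDimensionLE_zero _ |>.1
    ((IsProjective.iff_projective _).1 inferInstance)⟩
  obtain ⟨h0, rs, h1, h2, h3⟩ := hd
  refine ⟨rs, h1, ⟨?_, ?_⟩, ?_⟩
  · exact ((TensorProduct.rid R (ι → R)).isWeaklyRegular_congr rs).1 h2.isWeaklyRegular_lTensor
  · intro h
    have hle : Ideal.ofList rs ≤ m := Ideal.span_le.2 h1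
    obtain ⟨k⟩ := ‹Nonempty ι›
    have h4 : (1 : ι → R) ∈ m • (⊤ : Submodule R (ι → R)) :=
      Submodule.smul_mono_left hle (h ▸ trivial)
    have h5 := Submodule.mem_map_of_mem (f := LinearMap.proj (R := R) (φ := fun _ : ι ↦ R) k) h4
    rw [Submodule.map_smul''] at h5
    exact hm ((Ideal.eq_top_iff_one m).2
      (Submodule.smul_le.2 (fun r hr y _ ↦ m.mul_mem_right y hr) h5))
  · rw [h3, ← h0]
    exact isMaximalModule_of_free.symm

end Pairing

/-! ### Liaison classes over local rings -/

section Steps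

/-! The relations `L n` of being joined by a chain of `n` steps in a symmetric relation `D`, up to an
equivalence relation `I`. This covers the local and the graded case. -/

variable {X : Type*} {I D : X → X → Prop} {L : ℕ → X → X → Prop}
  (h0 : ∀ x y, L 0 x y ↔ I x y) (hs : ∀ n x y, L (n + 1) x y ↔ ∃ z, L n x z ∧ D z y)
  (hrefl : ∀ x, I x x) (hsymm : ∀ {x y}, I x y → I y x)
  (htrans : ∀ {x y z}, I x y → I y z → I x z) (hDsymm : ∀ {x y}, D x y → D y x)
  (hDiso : ∀ {x y z}, D x y → I y z → D x z)

include h0 hs htrans hDiso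

theorem steps_trans_iso {n : ℕ} {x y z : X} (h : L n x y) (h' : I y z) : L n x z := by
  cases n with
  | zero => exact (h0 _ _).2 (htrans ((h0 _ _).1 h) h')
  | succ n =>
    obtain ⟨w, h1, h2⟩ := (hs _ _ _).1 h
    exact (hs _ _ _).2 ⟨w, h1, hDiso h2 h'⟩

theorem steps_trans {n k : ℕ} {x y z : X} (h : L n x y) (h' : L k y z) : L (n + k) x z := by
  induction k generalizing z with
  | zero => exact steps_trans_iso h0 hs htrans hDiso h ((h0 _ _).1 h')
  | succ k ih =>
    obtain ⟨w, h1, h2⟩ := (hs _ _ _).1 h'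
    exact (hs _ _ _).2 ⟨w, ih h1, h2⟩

include hrefl hsymm hDsymm

theorem steps_symm {n : ℕ} {x y : X} (h : L n x y) : L n y x := by
  induction n generalizing y with
  | zero => exact (h0 _ _).2 (hsymm ((h0 _ _).1 h))
  | succ n ih =>
    obtain ⟨w, h1, h2⟩ := (hs _ _ _).1 h
    have h3 : L 1 y w := (hs _ _ _).2 ⟨y, (h0 _ _).2 (hrefl y), hDsymm h2⟩
    rw [add_comm]
    exact steps_trans h0 hs htrans hDiso h3 (ih h1)

end Steps

section StableIso

variable {R : Type u} [CommRing R] {M N P F F' G G' : Type u} [AddCommGroup M] [Module R M]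
  [AddCommGroup N] [Module R N] [AddCommGroup P] [Module R P] [AddCommGroup F] [Module R F]
  [AddCommGroup F'] [Module R F'] [AddCommGroup G] [Module R G] [AddCommGroup G'] [Module R G']

/-- The map `L_C(φ)` depends only on the kernel of `φ`. -/
theorem linkMap_congr {C : Type u} [AddCommGroup C] [Module R C] {c : ℕ}
    {α : C ≃ₗ[R] ExtToRing R C c} {φ : C →ₗ[R] M} {ψ : C →ₗ[R] N}
    (motive : ∀ {E : Type u} [AddCommGroup E] [Module R E], (C →ₗ[R] E) → Prop)
    (h : LinearMap.ker φ = LinearMap.ker ψ) (H : motive (linkMap α φ)) : motive (linkMap α ψ) := by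
  let L (S : Submodule R C) : C →ₗ[R] ExtToRing R S c :=
    Ext.bilinearCompOfLinear R (ModuleCat.of R S) (ModuleCat.of R C) (ModuleCat.of R R) 0 c c
      (zero_add c) (Ext.mk₀ (ModuleCat.ofHom S.subtype)) ∘ₗ α.toLinearMap
  have key : ∀ S S' : Submodule R C, S = S' → motive (L S) → motive (L S') := by
    rintro S _ rfl H
    exact H
  exact key _ _ h H

theorem exists_dual_ne_zero_of_injective (f : M →ₗ[R] N) (hf : Function.Injective f)
    (hN : ∀ x : N, x ≠ 0 → ∃ g : N →ₗ[R] R, g x ≠ 0) (x : M) (hx : x ≠ 0) :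
    ∃ g : M →ₗ[R] R, g x ≠ 0 := by
  obtain ⟨g, hg⟩ := hN (f x) ((map_ne_zero_iff f hf).2 hx)
  exact ⟨g ∘ₗ f, hg⟩

theorem exists_dual_ne_zero_prod_free [Module.Free R F]
    (hM : ∀ x : M, x ≠ 0 → ∃ g : M →ₗ[R] R, g x ≠ 0) (x : M × F) (hx : x ≠ 0) :
    ∃ g : M × F →ₗ[R] R, g x ≠ 0 := by
  by_cases h1 : x.1 = 0
  · have h2 : x.2 ≠ 0 := fun h2 ↦ hx (Prod.ext h1 h2)
    rw [Ne, ← Module.forall_dual_apply_eq_zero_iff R, not_forall] at h2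
    obtain ⟨f, hf⟩ := h2
    exact ⟨f ∘ₗ LinearMap.snd R M F, hf⟩
  · obtain ⟨g, hg⟩ := hM x.1 h1
    exact ⟨g ∘ₗ LinearMap.fst R M F, hg⟩

end StableIso

namespace Loc

variable {R : Type u} [CommRing R] [IsLocalRing R] {M N P : ModuleCat.{u} R}

theorem DirectlyLinked.symm (h : DirectlyLinked M N) : DirectlyLinked N M := by
  obtain ⟨C, hC, c, α, φ, ψ, hc, hφ, hψ, h1, h2⟩ := h
  exact ⟨C, hC, c, α, ψ, φ, hc, hψ, hφ, h2, h1⟩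

theorem DirectlyLinked.trans_iso (h : DirectlyLinked M N) (e : N ≃ₗ[R] P) :
    DirectlyLinked M P := by
  obtain ⟨C, hC, c, α, φ, ψ, hc, hφ, hψ, ⟨e1⟩, ⟨e2⟩⟩ := h
  have hk : LinearMap.ker (e.toLinearMap ∘ₗ ψ) = LinearMap.ker ψ := LinearEquiv.ker_comp _ _
  refine ⟨C, hC, c, α, φ, e.toLinearMap ∘ₗ ψ, hc, hφ, ⟨e.surjective.comp hψ.1, ?_⟩, ?_,
    ⟨e.symm.trans e2⟩⟩
  · rw [← hψ.2]
    exact (Module.supportDim_eq_of_equiv e).symm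
  · exact linkMap_congr (fun f ↦ Nonempty (M ≃ₗ[R] LinearMap.range f)) hk.symm ⟨e1⟩

theorem LinkedInSteps.symm {s : ℕ} (h : LinkedInSteps s M N) : LinkedInSteps s N M :=
  steps_symm (I := fun M N : ModuleCat.{u} R ↦ Nonempty (M ≃ₗ[R] N)) (L := LinkedInSteps)
    (fun _ _ ↦ Iff.rfl) (fun _ _ _ ↦ Iff.rfl) (fun M ↦ ⟨LinearEquiv.refl R M⟩)
    (fun ⟨e⟩ ↦ ⟨e.symm⟩) (fun ⟨e⟩ ⟨e'⟩ ↦ ⟨e.trans e'⟩) DirectlyLinked.symm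
    (fun h ⟨e⟩ ↦ h.trans_iso e) h

theorem LinkedInSteps.trans {s t : ℕ} (h : LinkedInSteps s M N) (h' : LinkedInSteps t N P) :
    LinkedInSteps (s + t) M P :=
  steps_trans (I := fun M N : ModuleCat.{u} R ↦ Nonempty (M ≃ₗ[R] N)) (L := LinkedInSteps)
    (fun _ _ ↦ Iff.rfl) (fun _ _ _ ↦ Iff.rfl)
    (fun ⟨e⟩ ⟨e'⟩ ↦ ⟨e.trans e'⟩) (fun h ⟨e⟩ ↦ h.trans_iso e) h h'

/-- The data of a direct link between maximal modules, with the isomorphisms onto the images of the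
maps `L_C` replaced by the resulting epimorphisms from `C`. -/
theorem DirectlyLinked.exists_epi (hR : IsGorensteinRing R) (h : DirectlyLinked M N)
    (hM : IsMaximalModule R M) : IsMaximalModule R N ∧
      ∃ (C : ModuleCat.{u} R) (β : C ≃ₗ[R] (C →ₗ[R] R)) (φ χ : C →ₗ[R] M) (ψ ω : C →ₗ[R] N),
        Module.Finite R C ∧ Module.Free R C ∧ Function.Surjective φ ∧ Function.Surjective χ ∧
        Function.Surjective ψ ∧ Function.Surjective ω ∧
        (∀ x, x ∈ LinearMap.ker χ ↔ ∀ y ∈ LinearMap.ker ψ, β x y = 0) ∧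
        (∀ x, x ∈ LinearMap.ker ω ↔ ∀ y ∈ LinearMap.ker φ, β x y = 0) := by
  obtain ⟨d, hd⟩ := exists_hasGradeDim_of_isLocalRing hR
  have := hd.finiteRingKrullDim
  obtain ⟨C, ⟨hfin, hperf, -⟩, c, α, φ, ψ, hc, hφ, hψ, ⟨e1⟩, ⟨e2⟩⟩ := h
  have hCmax : IsMaximalModule R C := hφ.2.symm.trans hM
  obtain rfl := hc.eq_zero hCmax
  refine ⟨hψ.2.trans hCmax, C, α.trans (extZeroEquiv R C), φ,
    e1.symm.toLinearMap ∘ₗ (linkMap α ψ).rangeRestrict, ψ,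
    e2.symm.toLinearMap ∘ₗ (linkMap α φ).rangeRestrict, hfin,
    free_of_isPerfectModule hR hperf hCmax, hφ.1,
    e1.symm.surjective.comp (linkMap α ψ).surjective_rangeRestrict, hψ.1,
    e2.symm.surjective.comp (linkMap α φ).surjective_rangeRestrict, ?_, ?_⟩
  · intro x
    rw [LinearEquiv.ker_comp, LinearMap.ker_rangeRestrict]
    exact mem_ker_linkMap_iff α ψ x
  · intro x
    rw [LinearEquiv.ker_comp, LinearMap.ker_rangeRestrict]
    exact mem_ker_linkMap_iff α φ x

omit [IsLocalRing R] in
theorem stablyEquivalent_of_iso (hM : IsMaximalModule R M) (e : M ≃ₗ[R] N) :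
    StablyEquivalent M N :=
  ⟨hM, (Module.supportDim_eq_of_equiv e).symm.trans hM, ModuleCat.of R PUnit.{u + 1},
    ModuleCat.of R PUnit.{u + 1}, inferInstanceAs (Module.Finite R PUnit.{u + 1}),
    inferInstanceAs (Module.Free R PUnit.{u + 1}), inferInstanceAs (Module.Finite R PUnit.{u + 1}),
    inferInstanceAs (Module.Free R PUnit.{u + 1}), ⟨e.prodCongr (LinearEquiv.refl R _)⟩⟩

omit [IsLocalRing R] in
theorem StablyEquivalent.trans (h : StablyEquivalent M N) (h' : StablyEquivalent N P) :
    StablyEquivalent M P := by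
  obtain ⟨hM, -, F, G, hF1, hF2, hG1, hG2, ⟨e⟩⟩ := h
  obtain ⟨-, hP, F', G', hF1', hF2', hG1', hG2', ⟨e'⟩⟩ := h'
  refine ⟨hM, hP, ModuleCat.of R (F × F'), ModuleCat.of R (G' × G),
    inferInstanceAs (Module.Finite R (F × F')), inferInstanceAs (Module.Free R (F × F')),
    inferInstanceAs (Module.Finite R (G' × G)), inferInstanceAs (Module.Free R (G' × G)), ⟨?_⟩⟩
  have e1 : ((N × G) × F') ≃ₗ[R] ((N × F') × G) :=
    (LinearEquiv.prodAssoc R N G F').trans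
      (((LinearEquiv.refl R N).prodCongr (LinearEquiv.prodComm R G F')).trans
        (LinearEquiv.prodAssoc R N F' G).symm)
  exact (LinearEquiv.prodAssoc R M F F').symm.trans ((e.prodCongr (LinearEquiv.refl R F')).trans
    (e1.trans ((e'.prodCongr (LinearEquiv.refl R G)).trans (LinearEquiv.prodAssoc R P G' G))))

theorem StablyEquivalent.of_directlyLinked (hR : IsGorensteinRing R) (hM : IsMaximalModule R M)
    (h : DirectlyLinked M N) (h' : DirectlyLinked N P) : StablyEquivalent M P := by
  obtain ⟨hN, C, β, -, χ, ψ, -, hfin, hfree, -, hχ, hψ, -, h1, -⟩ := h.exists_epi hR hM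
  obtain ⟨hP, C', β', φ', -, -, χ', hfin', hfree', hφ', -, -, hχ', -, h2⟩ := h'.exists_epi hR hN
  obtain ⟨a, ha⟩ := Module.projective_lifting_property φ' ψ hφ'
  obtain ⟨b, hb⟩ := Module.projective_lifting_property ψ φ' hψ
  obtain ⟨e, -⟩ := exists_equiv_of_linked β β' hχ h1 hχ' h2 a ha b hb
  exact ⟨hM, hP, C', C, hfin', hfree', hfin, hfree, ⟨e.trans (LinearEquiv.prodComm R C P)⟩⟩

theorem stablyEquivalent_of_linkedInSteps (hR : IsGorensteinRing R) (hM : IsMaximalModule R M)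
    (k : ℕ) (h : LinkedInSteps (k + k) M N) : StablyEquivalent M N := by
  induction k generalizing N with
  | zero =>
    obtain ⟨e⟩ := h
    exact stablyEquivalent_of_iso hM e
  | succ k ih =>
    rw [show k + 1 + (k + 1) = k + k + 1 + 1 by omega] at h
    obtain ⟨P, ⟨Q, hQ, hQP⟩, hPN⟩ := h
    have h1 := ih hQ
    exact h1.trans (.of_directlyLinked hR h1.2.1 hQP hPN)

theorem directlyLinked_of_isDualPair (hR : IsGorensteinRing R) {ι : Type} [Fintype ι] [Nonempty ι]
    {σ : Equiv.Perm ι} {φ : (ι → R) →ₗ[R] M} {ψ : (ι → R) →ₗ[R] N} (hφ : Function.Surjective φ)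
    (hψ : Function.Surjective ψ) (h : IsDualPair σ φ ψ) (hM : IsMaximalModule R M)
    (hN : IsMaximalModule R N) : DirectlyLinked M N := by
  have := hR.noetherian
  obtain ⟨d, hd⟩ := exists_hasGradeDim_of_isLocalRing hR
  let α : (ι → R) ≃ₗ[R] ExtToRing R (ι → R) 0 := (pairing R σ).trans (extZeroEquiv R _).symm
  have hmax : IsMaximalModule R (ι → R) := isMaximalModule_of_free
  have hcodim : HasCodim R (ι → R) 0 := by
    rw [HasCodim, hmax]
    simp
  have hker : ∀ {X : ModuleCat.{u} R} (ξ : (ι → R) →ₗ[R] X),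
      LinearMap.ker (linkMap α ξ) = perp σ (LinearMap.ker ξ) := fun ξ ↦ by
    ext x
    rw [mem_ker_linkMap_iff, mem_perp]
    simp only [α, LinearEquiv.trans_apply, LinearEquiv.apply_symm_apply]
  refine ⟨ModuleCat.of R (ι → R), ⟨inferInstanceAs (Module.Finite R (ι → R)),
    isPerfectModule_pi hd, 0, hcodim, ⟨α⟩⟩, 0, α, φ, ψ, hcodim, ⟨hφ, hM.trans hmax.symm⟩,
    ⟨hψ, hN.trans hmax.symm⟩, ⟨?_⟩, ⟨?_⟩⟩
  · exact (φ.quotKerEquivOfSurjective hφ).symm.trans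
      ((Submodule.quotEquivOfEq _ _ (h.1.trans (hker ψ).symm)).trans (linkMap α ψ).quotKerEquivRange)
  · exact (ψ.quotKerEquivOfSurjective hψ).symm.trans
      ((Submodule.quotEquivOfEq _ _ (h.2.trans (hker φ).symm)).trans (linkMap α φ).quotKerEquivRange)

/-- A torsionless maximal module is linked in two steps to its direct sum with a free module. -/
theorem linkedInSteps_prod (hR : IsGorensteinRing R) [Module.Finite R M] (hM : IsMaximalModule R M)
    (htl : ∀ x : M, x ≠ 0 → ∃ f : M →ₗ[R] R, f x ≠ 0) (n : ℕ) :
    LinkedInSteps 2 M (ModuleCat.of R (M × (Fin n → R))) := by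
  classical
  have := hR.noetherian
  obtain ⟨k, φ₀, hφ₀⟩ := Module.Finite.exists_fin' R M
  have hM0 : Nontrivial M := by
    rw [← Module.supportDim_ne_bot_iff_nontrivial R, hM]
    exact ringKrullDim_ne_bot
  have hk : k ≠ 0 := by
    rintro rfl
    exact not_subsingleton M hφ₀.subsingleton
  let j : Fin k := ⟨0, Nat.pos_of_ne_zero hk⟩
  have : Nonempty (Fin k) := ⟨j⟩
  let σ : Equiv.Perm (Fin k ⊕ Fin k) := Equiv.sumComm _ _
  have hσ : Function.Involutive σ := Sum.swap_swap
  let τ : Equiv.Perm ((Fin k ⊕ Fin k) ⊕ Fin n) := Equiv.sumCongr σ (Equiv.refl _)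
  have hτ : Function.Involutive τ := by rintro (x | x) <;> simp [τ, σ]
  let φ : (Fin k ⊕ Fin k → R) →ₗ[R] M := φ₀ ∘ₗ LinearMap.funLeft R R Sum.inl
  have hφ : Function.Surjective φ :=
    hφ₀.comp (LinearMap.funLeft_surjective_of_injective R R _ Sum.inl_injective)
  have hφj : φ (Pi.single (Sum.inr j) 1) = 0 := by
    have : (Pi.single (Sum.inr j) 1 : Fin k ⊕ Fin k → R) ∘ Sum.inl = 0 := by
      ext i
      simp
    change φ₀ ((Pi.single (Sum.inr j) 1 : Fin k ⊕ Fin k → R) ∘ Sum.inl) = 0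
    rw [this, map_zero]
  have h1 := isDualPair_mkQ hσ φ htl
  have hQ := h1.isMaximalModule (Submodule.mkQ_surjective _) hφj
  have h2 := h1.extendLink hσ hτ
  refine ⟨ModuleCat.of R (_ ⧸ perp σ (LinearMap.ker φ)),
    ⟨M, ⟨LinearEquiv.refl R M⟩, directlyLinked_of_isDualPair hR hφ (Submodule.mkQ_surjective _) h1
      hM hQ⟩, directlyLinked_of_isDualPair hR ?_ (extendLink_surjective hσ hτ hφ) h2 hQ ?_⟩
  · exact (Submodule.mkQ_surjective _).comp
      (LinearMap.funLeft_surjective_of_injective R R _ Sum.inl_injective)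
  · exact isMaximalModule_of_surjective (LinearMap.fst R M (Fin n → R)) Prod.fst_surjective hM

theorem linkedInSteps_prod_free (hR : IsGorensteinRing R) [Module.Finite R M]
    (hM : IsMaximalModule R M) (htl : ∀ x : M, x ≠ 0 → ∃ f : M →ₗ[R] R, f x ≠ 0)
    (F : ModuleCat.{u} R) [Module.Finite R F] [Module.Free R F] :
    LinkedInSteps 2 M (ModuleCat.of R (M × F)) :=
  (linkedInSteps_prod hR hM htl (Module.finrank R F)).trans (t := 0)
    ⟨(LinearEquiv.refl R M).prodCongr (Module.finBasis R F).equivFun.symm⟩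

theorem linkedInSteps_of_stablyEquivalent (hR : IsGorensteinRing R) [Module.Finite R M]
    (htl : ∀ x : M, x ≠ 0 → ∃ f : M →ₗ[R] R, f x ≠ 0) (h : StablyEquivalent M N) :
    LinkedInSteps 4 M N := by
  obtain ⟨hM, hN, F, G, hF1, hF2, hG1, hG2, ⟨e⟩⟩ := h
  have hNfin : Module.Finite R N :=
    Module.Finite.of_surjective (LinearMap.fst R N G ∘ₗ e.toLinearMap)
      (Prod.fst_surjective.comp e.surjective)
  have htlN := exists_dual_ne_zero_of_injective (e.symm.toLinearMap ∘ₗ LinearMap.inl R N G)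
    (e.symm.injective.comp LinearMap.inl_injective) (exists_dual_ne_zero_prod_free htl)
  have h1 : LinkedInSteps 2 M (ModuleCat.of R (N × G)) :=
    (linkedInSteps_prod_free hR hM htl F).trans (t := 0) ⟨e⟩
  exact h1.trans (linkedInSteps_prod_free hR hN htlN G).symm

theorem inEvenLiaisonClass_iff (hR : IsGorensteinRing R) (hfin : Module.Finite R M)
    (hunm : IsUnmixed R M) (hM : IsMaximalModule R M) :
    InEvenLiaisonClass M N ↔ StablyEquivalent M N := by
  obtain ⟨d, hd⟩ := exists_hasGradeDim_of_isLocalRing hR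
  have := hd.finiteRingKrullDim
  constructor
  · rintro ⟨s, ⟨k, rfl⟩, h⟩
    exact stablyEquivalent_of_linkedInSteps hR hM k h
  · exact fun h ↦ ⟨4, ⟨2, rfl⟩, linkedInSteps_of_stablyEquivalent hR
      (fun x hx ↦ exists_dual_ne_zero_of_isUnmixed hR hunm hM hx) h⟩

theorem inLiaisonClass_self_iff (hR : IsGorensteinRing R) :
    InLiaisonClass (ModuleCat.of R R) N ↔
      (Module.Finite R N ∧ Module.Free R N ∧ Nontrivial N) := by
  have := hR.noetherian
  constructor
  · rintro ⟨s, h⟩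
    suffices H : Module.Finite R N ∧ Module.Free R N ∧ IsMaximalModule R N by
      refine ⟨H.1, H.2.1, ?_⟩
      rw [← Module.supportDim_ne_bot_iff_nontrivial R, H.2.2]
      exact ringKrullDim_ne_bot
    induction s generalizing N with
    | zero =>
      obtain ⟨e⟩ := h
      exact ⟨Module.Finite.equiv (M := R) e, Module.Free.of_equiv (M := R) e,
        (Module.supportDim_eq_of_equiv (M := R) e).symm.trans isMaximalModule_self⟩
    | succ s ih =>
      obtain ⟨P, hP, hPN⟩ := h
      obtain ⟨h1, h2, h3⟩ := ih hP
      obtain ⟨hN, C, β, φ, χ, ψ, ω, hfin, hfree, hφ, -, -, hω, -, h4⟩ := hPN.exists_epi hR h3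
      have h5 : Module.Finite R N := Module.Finite.of_surjective ω hω
      have : Module.Projective R N := projective_of_linked β hφ hω h4
      exact ⟨h5, Module.free_of_flat_of_isLocalRing, hN⟩
  · rintro ⟨h1, h2, h3⟩
    have hN : IsMaximalModule R N := isMaximalModule_of_free
    refine ⟨4, linkedInSteps_of_stablyEquivalent (M := ModuleCat.of R R) hR
      (fun x hx ↦ ⟨LinearMap.id, hx⟩) ⟨isMaximalModule_self, hN, N, ModuleCat.of R R, h1, h2,
        inferInstanceAs (Module.Finite R R), inferInstanceAs (Module.Free R R),
        ⟨LinearEquiv.prodComm R R N⟩⟩⟩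

end Loc

/-! ### Liaison classes over standard graded algebras -/

namespace Gr

open DirectSum

variable {K : Type v} [Field K] {R : Type u} [CommRing R] [Algebra K R]
  {𝒜 : ℤ → Submodule K R}

section GradedIso

variable {M M' N N' P : GrMod 𝒜}

theorem GradedIso.of_isGradedHom (e : M ≃ₗ[R] N) (he : IsGradedHom (e : M →ₗ[R] N)) :
    GradedIso M N := ⟨e, he.mem_deg_iff⟩

theorem GradedIso.prod (h : GradedIso M M') (h' : GradedIso N N') :
    GradedIso (M.prod N) (M'.prod N') := by
  obtain ⟨e, he⟩ := h
  obtain ⟨e', he'⟩ := h'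
  exact .of_isGradedHom (e.prodCongr e') fun i x hx ↦ ⟨(he _ _).1 hx.1, (he' _ _).1 hx.2⟩

theorem GradedIso.shift (h : GradedIso M N) (a : ℤ) : GradedIso (M.shift a) (N.shift a) := by
  obtain ⟨e, he⟩ := h
  exact ⟨e, fun i x ↦ he _ x⟩

theorem GradedIso.prod_comm (M N : GrMod 𝒜) : GradedIso (M.prod N) (N.prod M) :=
  .of_isGradedHom (LinearEquiv.prodComm R M N) fun _ _ hx ↦ ⟨hx.2, hx.1⟩

theorem GradedIso.prod_assoc (M N P : GrMod 𝒜) :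
    GradedIso ((M.prod N).prod P) (M.prod (N.prod P)) :=
  .of_isGradedHom (LinearEquiv.prodAssoc R M N P) fun _ _ hx ↦ ⟨hx.1.1, hx.1.2, hx.2⟩

theorem GradedIso.prod_right_comm (M N P : GrMod 𝒜) :
    GradedIso ((M.prod N).prod P) ((M.prod P).prod N) :=
  (prod_assoc M N P).trans (((GradedIso.refl M).prod (prod_comm N P)).trans (prod_assoc M P N).symm)

theorem GradedIso.shift_prod (M N : GrMod 𝒜) (a : ℤ) :
    GradedIso ((M.prod N).shift a) ((M.shift a).prod (N.shift a)) :=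
  .of_isGradedHom (LinearEquiv.refl R (M × N)) fun _ _ hx ↦ hx

theorem GradedIso.shift_shift (M : GrMod 𝒜) (a b : ℤ) :
    GradedIso ((M.shift a).shift b) (M.shift (b + a)) :=
  .of_isGradedHom (LinearEquiv.refl R M) fun i x hx ↦ by
    change x ∈ M.deg (i + (b + a))
    rw [← add_assoc]
    exact hx

theorem GradedIso.shift_eq_zero (M : GrMod 𝒜) {a : ℤ} (ha : a = 0) : GradedIso (M.shift a) M :=
  .of_isGradedHom (LinearEquiv.refl R M) fun i x hx ↦ by
    subst ha
    change x ∈ M.deg i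
    rw [← add_zero i]
    exact hx

theorem isMaximalModule_of_gradedIso (h : GradedIso M N) (hM : IsMaximalModule R M) :
    IsMaximalModule R N := by
  obtain ⟨e, -⟩ := h
  exact (Module.supportDim_eq_of_equiv e).symm.trans hM

theorem stablyEquivalent_iff : StablyEquivalent M N ↔
    IsMaximalModule R M ∧ IsMaximalModule R N ∧ ∃ (F G : GrMod 𝒜) (s : ℤ),
      IsGradedFree F ∧ IsGradedFree G ∧ GradedIso (M.prod F) ((N.shift s).prod G) := by
  constructor
  · rintro ⟨h1, h2, F, G, s, e, hF, hG, he⟩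
    exact ⟨h1, h2, F, G, s, hF, hG, e, he⟩
  · rintro ⟨h1, h2, F, G, s, hF, hG, e, he⟩
    exact ⟨h1, h2, F, G, s, e, hF, hG, he⟩

theorem StablyEquivalent.trans (h : StablyEquivalent M N) (h' : StablyEquivalent N P) :
    StablyEquivalent M P := by
  rw [stablyEquivalent_iff] at h h' ⊢
  obtain ⟨hM, -, F, G, s, hF, hG, e⟩ := h
  obtain ⟨-, hP, F', G', t, hF', hG', e'⟩ := h'
  refine ⟨hM, hP, F.prod (F'.shift s), (G'.shift s).prod G, s + t, hF.prod (hF'.shift s),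
    (hG'.shift s).prod hG, ?_⟩
  refine (GradedIso.prod_assoc _ _ _).symm.trans ((e.prod (.refl _)).trans
    ((GradedIso.prod_right_comm _ _ _).trans ((GradedIso.prod ?_ (.refl G)).trans
      (GradedIso.prod_assoc _ _ _))))
  exact (GradedIso.shift_prod _ _ s).symm.trans ((e'.shift s).trans
    ((GradedIso.shift_prod _ _ s).trans ((GradedIso.shift_shift P t s).prod (.refl _))))

theorem stablyEquivalent_of_gradedIso [GradedAlgebra 𝒜] (hM : IsMaximalModule R M)
    (h : GradedIso M N) : StablyEquivalent M N :=
  stablyEquivalent_iff.2 ⟨hM, isMaximalModule_of_gradedIso h hM, GrMod.free (Fin.elim0 : Fin 0 → ℤ),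
    GrMod.free (Fin.elim0 : Fin 0 → ℤ), 0, GrMod.isGradedFree_free _, GrMod.isGradedFree_free _,
    (h.trans (GradedIso.shift_eq_zero N rfl).symm).prod (.refl _)⟩

theorem IsGradedFree.exists_lift [GradedAlgebra 𝒜] (h : IsGradedFree P) {g : M →ₗ[R] N}
    (hg : IsGradedHom g) (hsurj : Function.Surjective g) {f : P →ₗ[R] N} (hf : IsGradedHom f) :
    ∃ k : P →ₗ[R] M, IsGradedHom k ∧ g ∘ₗ k = f := by
  obtain ⟨n, d, e, he⟩ := h.gradedIso_free
  obtain ⟨k, hk, hgk⟩ := exists_graded_lift hg hsurj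
    (f := f ∘ₗ (e : GrMod.free (𝒜 := 𝒜) d →ₗ[R] P)) (hf.comp fun i x hx ↦ (he i x).1 hx)
  refine ⟨k ∘ₗ (e.symm : P →ₗ[R] GrMod.free (𝒜 := 𝒜) d), hk.comp fun i x hx ↦ ?_, ?_⟩
  · refine (he i _).2 ?_
    rwa [LinearEquiv.coe_coe, LinearEquiv.apply_symm_apply]
  · rw [← LinearMap.comp_assoc, hgk, LinearMap.comp_assoc, LinearEquiv.comp_symm,
      LinearMap.comp_id]

theorem IsGradedFree.finite (h : IsGradedFree M) : Module.Finite R M :=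
  let ⟨_, b, _⟩ := h
  Module.Finite.of_basis b

theorem IsGradedFree.free (h : IsGradedFree M) : Module.Free R M :=
  let ⟨_, b, _⟩ := h
  Module.Free.of_basis b

end GradedIso

section Linkage

variable {M N P : GrMod 𝒜}

theorem DirectlyLinked.symm (h : DirectlyLinked M N) : DirectlyLinked N M := by
  obtain ⟨C, hC, c, s, α, φ, ψ, hc, hα, hφ, hφ', hψ, hψ', h1, h2⟩ := h
  exact ⟨C, hC, c, s, α, ψ, φ, hc, hα, hψ, hψ', hφ, hφ', h2, h1⟩

theorem DirectlyLinked.trans_iso (h : DirectlyLinked M N) (e : GradedIso N P) :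
    DirectlyLinked M P := by
  obtain ⟨C, hC, c, s, α, φ, ψ, hc, hα, hφ, hφ', hψ, hψ', h1, e2, he2⟩ := h
  obtain ⟨e, he⟩ := e
  have hk : LinearMap.ker (e.toLinearMap ∘ₗ ψ) = LinearMap.ker ψ := LinearEquiv.ker_comp _ _
  refine ⟨C, hC, c, s, α, φ, e.toLinearMap ∘ₗ ψ, hc, hα, hφ, hφ',
    fun i x hx ↦ (he _ _).1 (hψ i x hx), ⟨e.surjective.comp hψ'.1, ?_⟩, ?_, e.symm.trans e2, ?_⟩
  · rw [← hψ'.2]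
    exact (Module.supportDim_eq_of_equiv e).symm
  · exact linkMap_congr (fun f ↦ IsoToGradedImage M f) hk.symm h1
  · intro i x
    rw [LinearEquiv.trans_apply, ← he2, he, LinearEquiv.apply_symm_apply]

theorem LinkedInSteps.symm {s : ℕ} (h : LinkedInSteps s M N) : LinkedInSteps s N M :=
  steps_symm (I := GradedIso) (L := LinkedInSteps) (fun _ _ ↦ Iff.rfl) (fun _ _ _ ↦ Iff.rfl)
    GradedIso.refl GradedIso.symm GradedIso.trans DirectlyLinked.symm
    DirectlyLinked.trans_iso h

theorem LinkedInSteps.trans {s t : ℕ} (h : LinkedInSteps s M N) (h' : LinkedInSteps t N P) :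
    LinkedInSteps (s + t) M P :=
  steps_trans (I := GradedIso) (L := LinkedInSteps) (fun _ _ ↦ Iff.rfl) (fun _ _ _ ↦ Iff.rfl)
    GradedIso.trans DirectlyLinked.trans_iso h h'

theorem InEvenLiaisonClass.symm (h : InEvenLiaisonClass M N) : InEvenLiaisonClass N M :=
  let ⟨s, hs, h⟩ := h
  ⟨s, hs, h.symm⟩

theorem InEvenLiaisonClass.trans (h : InEvenLiaisonClass M N) (h' : InEvenLiaisonClass N P) :
    InEvenLiaisonClass M P :=
  let ⟨_, hs, h⟩ := h
  let ⟨_, ht, h'⟩ := h'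
  ⟨_, hs.add ht, h.trans h'⟩

theorem GradedIso.inEvenLiaisonClass (h : GradedIso M N) : InEvenLiaisonClass M N :=
  ⟨0, Even.zero, h⟩

theorem isHomogExt_zero_iff {C : GrMod 𝒜} {i : ℤ} {e : ExtToRing R C 0} :
    IsHomogExt 0 C i e ↔ ∀ j, ∀ x ∈ C.deg j, extZeroEquiv R C e x ∈ 𝒜 (j + i) := by
  constructor
  · rintro ⟨f, hf, rfl⟩
    rwa [← extZeroEquiv_symm_apply, LinearEquiv.apply_symm_apply]
  · intro h
    refine ⟨_, h, ?_⟩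
    rw [← extZeroEquiv_symm_apply, LinearEquiv.symm_apply_apply]

theorem isoToGradedImage_of_ker_eq {C : GrMod 𝒜} {φ : C →ₗ[R] M} (hφ : IsGradedHom φ)
    (hsurj : Function.Surjective φ) {E : Type u} [AddCommGroup E] [Module R E] {f : C →ₗ[R] E}
    (h : LinearMap.ker φ = LinearMap.ker f) : IsoToGradedImage M f := by
  let e : M ≃ₗ[R] LinearMap.range f := (φ.quotKerEquivOfSurjective hsurj).symm.trans
    ((Submodule.quotEquivOfEq _ _ h).trans f.quotKerEquivRange)
  have he : ∀ y, (e (φ y) : E) = f y := fun y ↦ by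
    have h1 : φ y = φ.quotKerEquivOfSurjective hsurj (Submodule.Quotient.mk y) := rfl
    rw [h1]
    simp only [e, LinearEquiv.trans_apply, LinearEquiv.symm_apply_apply]
    rfl
  refine ⟨e, fun i x ↦ ⟨fun hx ↦ ?_, ?_⟩⟩
  · obtain ⟨y, hy, rfl⟩ := hφ.exists_mem_deg hsurj hx
    exact ⟨y, hy, (he y).symm⟩
  · rintro ⟨y, hy, hyx⟩
    rw [← he y] at hyx
    rw [← e.injective (Subtype.ext hyx)]
    exact hφ _ _ hy

variable [GradedAlgebra 𝒜] (h𝒜 : IsStandardGraded 𝒜) (hR : IsGorensteinRing R)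

include h𝒜 hR

/-- The data of a direct link between maximal modules, with the isomorphisms onto the images of the
maps `L_C` replaced by the resulting epimorphisms from `C`. -/
theorem DirectlyLinked.exists_epi (h : DirectlyLinked M N) (hM : IsMaximalModule R M) :
    IsMaximalModule R N ∧
      ∃ (C : GrMod 𝒜) (s : ℤ) (β : C ≃ₗ[R] (C →ₗ[R] R)) (φ χ : C →ₗ[R] M) (ψ ω : C →ₗ[R] N),
        IsGradedFree C ∧
        (∀ i x, x ∈ C.deg i ↔ ∀ j, ∀ y ∈ C.deg j, β x y ∈ 𝒜 (j + (i + s))) ∧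
        (IsGradedHom φ ∧ Function.Surjective φ) ∧ (IsGradedHom χ ∧ Function.Surjective χ) ∧
        (IsGradedHom ψ ∧ Function.Surjective ψ) ∧ (IsGradedHom ω ∧ Function.Surjective ω) ∧
        (∀ x, x ∈ LinearMap.ker χ ↔ ∀ y ∈ LinearMap.ker ψ, β x y = 0) ∧
        (∀ x, x ∈ LinearMap.ker ω ↔ ∀ y ∈ LinearMap.ker φ, β x y = 0) := by
  obtain ⟨d, hd⟩ := exists_hasGradeDim h𝒜 hR
  have := hd.finiteRingKrullDim
  have := h𝒜.nontrivial
  obtain ⟨C, ⟨hfin, hperf, -⟩, c, s, α, φ, ψ, hc, hα, hφ, hφ', hψ, hψ', ⟨e1, he1⟩, ⟨e2, he2⟩⟩ := h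
  have hCmax : IsMaximalModule R C := hφ'.2.symm.trans hM
  obtain rfl := hc.eq_zero hCmax
  refine ⟨hψ'.2.trans hCmax, C, s, α.trans (extZeroEquiv R C), φ,
    e1.symm.toLinearMap ∘ₗ (linkMap α ψ).rangeRestrict, ψ,
    e2.symm.toLinearMap ∘ₗ (linkMap α φ).rangeRestrict,
    isGradedFree_of_isPerfectModule h𝒜 hR C hperf hCmax, ?_, ⟨hφ, hφ'.1⟩,
    ⟨fun i x hx ↦ ?_, e1.symm.surjective.comp (linkMap α ψ).surjective_rangeRestrict⟩,
    ⟨hψ, hψ'.1⟩,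
    ⟨fun i x hx ↦ ?_, e2.symm.surjective.comp (linkMap α φ).surjective_rangeRestrict⟩,
    fun x ↦ ?_, fun x ↦ ?_⟩
  · intro i x
    rw [hα, isHomogExt_zero_iff]
    rfl
  · rw [he1]
    refine ⟨x, hx, ?_⟩
    rw [LinearMap.comp_apply, LinearEquiv.coe_coe, LinearEquiv.apply_symm_apply]
    rfl
  · rw [he2]
    refine ⟨x, hx, ?_⟩
    rw [LinearMap.comp_apply, LinearEquiv.coe_coe, LinearEquiv.apply_symm_apply]
    rfl
  · rw [LinearEquiv.ker_comp, LinearMap.ker_rangeRestrict]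
    exact mem_ker_linkMap_iff α ψ x
  · rw [LinearEquiv.ker_comp, LinearMap.ker_rangeRestrict]
    exact mem_ker_linkMap_iff α φ x

theorem StablyEquivalent.of_directlyLinked (hM : IsMaximalModule R M)
    (h : DirectlyLinked M N) (h' : DirectlyLinked N P) : StablyEquivalent M P := by
  obtain ⟨hN, C, s, β, -, χ, ψ, -, hC, hβ, -, ⟨hχg, hχ⟩, ⟨hψg, hψ⟩, -, h1, -⟩ :=
    h.exists_epi h𝒜 hR hM
  obtain ⟨hP, C', s', β', φ', -, -, χ', hC', hβ', ⟨hφg', hφ'⟩, -, -, ⟨hχg', hχ'⟩, -, h2⟩ :=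
    h'.exists_epi h𝒜 hR hN
  obtain ⟨a, hag, ha⟩ := hC.exists_lift hφg' hφ' hψg
  obtain ⟨b, hbg, hb⟩ := hC'.exists_lift hψg hψ hφg'
  obtain ⟨e, he⟩ := exists_equiv_of_linked β β' hχ h1 hχ' h2 a ha b hb
  have hgr : GradedIso (M.prod (C'.shift (s - s'))) (C.prod (P.shift (s - s'))) := by
    refine .of_isGradedHom e ?_
    rintro i ⟨m, x'⟩ ⟨hm, hx'⟩
    obtain ⟨x, hx, rfl⟩ := hχg.exists_mem_deg hχ hm
    rw [LinearEquiv.coe_coe, he]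
    have hdeg : ∀ j, ∀ y ∈ C'.deg j, (β x ∘ₗ b + β' x') y ∈ 𝒜 (j + (i + s)) := by
      intro j y hy
      refine add_mem ((hβ i x).1 hx j _ (hbg j y hy)) ?_
      have := (hβ' _ x').1 hx' j y hy
      rwa [show i + (s - s') + s' = i + s by omega] at this
    refine ⟨(C.deg i).sub_mem hx ?_, hχg' _ _ ?_⟩
    · rw [hβ]
      intro j y hy
      rw [LinearEquiv.apply_symm_apply]
      exact hdeg j _ (hag j y hy)
    · rw [hβ']
      intro j y hy
      rw [LinearEquiv.apply_symm_apply, show i + (s - s') + s' = i + s by omega]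
      exact hdeg j y hy
  exact stablyEquivalent_iff.2 ⟨hM, hP, C'.shift (s - s'), C, s - s', hC'.shift _, hC,
    hgr.trans (.prod_comm _ _)⟩

theorem stablyEquivalent_of_linkedInSteps (hM : IsMaximalModule R M) (k : ℕ)
    (h : LinkedInSteps (k + k) M N) : StablyEquivalent M N := by
  induction k generalizing N with
  | zero => exact stablyEquivalent_of_gradedIso hM h
  | succ k ih =>
    rw [show k + 1 + (k + 1) = k + k + 1 + 1 by omega] at h
    obtain ⟨P, ⟨Q, hQ, hQP⟩, hPN⟩ := h
    have h1 := ih hQ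
    exact h1.trans (.of_directlyLinked h𝒜 hR h1.2.1 hQP hPN)

end Linkage

section Pairing

variable [GradedAlgebra 𝒜] {ι κ : Type} [Fintype ι] [Fintype κ]

/-- If the degrees of the basis vectors `k` and `σ k` add up to `u` for all `k`, the pairing of `σ` is an
isomorphism of the graded free module onto its dual, shifted by `u`. -/
theorem mem_deg_free_iff_pairing {σ : Equiv.Perm ι} (hσ : Function.Involutive σ) {d : ι → ℤ} {u : ℤ}
    (hu : ∀ k, d k + d (σ k) = u) (i : ℤ) (x : ι → R) :
    x ∈ (GrMod.free (𝒜 := 𝒜) d).deg i ↔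
      ∀ j, ∀ y ∈ (GrMod.free (𝒜 := 𝒜) d).deg j, pairing R σ x y ∈ 𝒜 (j + (i + -u)) := by
  classical
  constructor
  · intro hx j y hy
    rw [pairing_apply]
    refine sum_mem fun k _ ↦ ?_
    have := SetLike.mul_mem_graded (hx (σ k)) (hy k)
    rwa [show i - d (σ k) + (j - d k) = j + (i + -u) by rw [← hu k]; ring] at this
  · intro h k
    have := h _ _ (GrMod.single_mem_free d (σ k))
    rw [pairing_single, hσ] at this
    rwa [show d (σ k) + (i + -u) = i - d k by rw [← hu k]; ring] at this

theorem pairing_proj {σ : Equiv.Perm ι} (hσ : Function.Involutive σ) {d : ι → ℤ} {u : ℤ}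
    (hu : ∀ k, d k + d (σ k) = u) (i j : ℤ) (x : GrMod.free (𝒜 := 𝒜) d) {y : ι → R}
    (hy : y ∈ (GrMod.free (𝒜 := 𝒜) d).deg j) :
    pairing R σ ((GrMod.free (𝒜 := 𝒜) d).proj i x) y =
      (decompose 𝒜 (pairing R σ x y) (j + (i + -u)) : R) := by
  let B : GrMod.free (𝒜 := 𝒜) d →ₗ[R] R := (pairing R σ).toLinearMap.flip y
  change B _ = (decompose 𝒜 (B x) (j + (i + -u)) : R)
  induction x using GrMod.induction with
  | mem k x hx =>
    have h1 : B x ∈ 𝒜 (j + (k + -u)) := (mem_deg_free_iff_pairing hσ hu k x).1 hx j y hy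
    by_cases hk : k = i
    · subst hk
      rw [GrMod.proj_of_mem hx, decompose_of_mem_same 𝒜 h1]
    · rw [GrMod.proj_of_mem_ne hx hk, decompose_of_mem_ne 𝒜 h1 (by omega), map_zero]
  | add x x' hx hx' => rw [map_add, map_add, map_add, hx, hx', decompose_add, DirectSum.add_apply,
      Submodule.coe_add]

theorem proj_mem_perp {σ : Equiv.Perm ι} (hσ : Function.Involutive σ) {d : ι → ℤ} {u : ℤ}
    (hu : ∀ k, d k + d (σ k) = u) {S : Submodule R (ι → R)}
    (hS : ∀ x ∈ S, ∀ i, (GrMod.free (𝒜 := 𝒜) d).proj i x ∈ S) :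
    ∀ x ∈ perp σ S, ∀ i, (GrMod.free (𝒜 := 𝒜) d).proj i x ∈ perp σ S := by
  intro x hx i
  rw [mem_perp] at hx ⊢
  intro y hy
  obtain ⟨T, hT⟩ := (GrMod.free (𝒜 := 𝒜) d).exists_eq_sum_proj y
  rw [hT, map_sum]
  refine Finset.sum_eq_zero fun j _ ↦ ?_
  rw [pairing_proj hσ hu i j x (GrMod.proj_mem _ j y), hx _ (hS y hy j), decompose_zero]
  rfl

theorem directlyLinked_of_isDualPair (h𝒜 : IsStandardGraded 𝒜) (hR : IsGorensteinRing R)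
    [Nonempty ι] {M N : GrMod 𝒜} {σ : Equiv.Perm ι} (hσ : Function.Involutive σ) {d : ι → ℤ} {u : ℤ}
    (hu : ∀ k, d k + d (σ k) = u) {φ : GrMod.free (𝒜 := 𝒜) d →ₗ[R] M}
    {ψ : GrMod.free (𝒜 := 𝒜) d →ₗ[R] N} (hφg : IsGradedHom φ) (hφ : Function.Surjective φ)
    (hψg : IsGradedHom ψ) (hψ : Function.Surjective ψ) (h : IsDualPair σ φ ψ)
    (hM : IsMaximalModule R M) (hN : IsMaximalModule R N) : DirectlyLinked M N := by
  have := hR.noetherian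
  have := h𝒜.nontrivial
  have := irrelevant_isMaximal h𝒜
  obtain ⟨e, he⟩ := exists_hasGradeDim h𝒜 hR
  let C : GrMod 𝒜 := GrMod.free d
  let α : C ≃ₗ[R] ExtToRing R C 0 := (pairing R σ).trans (extZeroEquiv R _).symm
  have hα : ∀ x, extZeroEquiv R C (α x) = pairing R σ x := fun x ↦
    (extZeroEquiv R C).apply_symm_apply _
  have hmax : IsMaximalModule R C := isMaximalModule_of_free (M := ι → R)
  have hcodim : HasCodim R C 0 := by
    rw [HasCodim, hmax]
    simp
  have hdual : IsGradedDuality (-u) α := fun i x ↦ by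
    rw [isHomogExt_zero_iff, hα]
    exact mem_deg_free_iff_pairing hσ hu i x
  have hker : ∀ {X : GrMod 𝒜} (ξ : C →ₗ[R] X),
      LinearMap.ker (linkMap α ξ) = perp σ (LinearMap.ker ξ) := fun ξ ↦ by
    ext x
    rw [mem_ker_linkMap_iff, hα]
    exact mem_perp.symm
  exact ⟨C, ⟨inferInstanceAs (Module.Finite R (ι → R)), isPerfectModule_pi he, 0, -u, α, hcodim,
    hdual⟩, 0, -u, α, φ, ψ, hcodim, hdual, hφg, ⟨hφ, hM.trans hmax.symm⟩, hψg,
    ⟨hψ, hN.trans hmax.symm⟩, isoToGradedImage_of_ker_eq hφg hφ (h.1.trans (hker ψ).symm),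
    isoToGradedImage_of_ker_eq hψg hψ (h.2.trans (hker φ).symm)⟩

section Backward

variable (h𝒜 : IsStandardGraded 𝒜) (hR : IsGorensteinRing R) {M N : GrMod 𝒜}

include h𝒜 hR

/-- A torsionless maximal module `M` that is covered by a graded free module with a redundant
generator is linked in two steps to the direct sum of a shift of `M` and a free module. -/
theorem linkedInSteps_extendLink [DecidableEq ι] {σ : Equiv.Perm ι} (hσ : Function.Involutive σ)
    {d : ι → ℤ} {u : ℤ} (hu : ∀ k, d k + d (σ k) = u) {φ : GrMod.free (𝒜 := 𝒜) d →ₗ[R] M}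
    (hφg : IsGradedHom φ) (hφ : Function.Surjective φ) {j : ι}
    (hj : φ (Pi.single j 1 : ι → R) = 0) (hM : IsMaximalModule R M)
    (htl : ∀ x : M, x ≠ 0 → ∃ f : M →ₗ[R] R, f x ≠ 0) {τ : Equiv.Perm (ι ⊕ κ)}
    (hτ : Function.Involutive τ) {e : κ → ℤ} {u' : ℤ}
    (hu' : ∀ k, Sum.elim d e k + Sum.elim d e (τ k) = u') :
    LinkedInSteps 2 M ((M.shift (u - u')).prod (GrMod.free fun l ↦ u' - e l)) := by
  have : Nonempty ι := ⟨j⟩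
  have h1 := isDualPair_mkQ hσ φ htl
  have hQ := h1.isMaximalModule (Submodule.mkQ_surjective _) hj
  have h2 := h1.extendLink hσ hτ
  let Q : GrMod 𝒜 := GrMod.quotient (GrMod.free d) (perp σ (LinearMap.ker φ))
    (proj_mem_perp hσ hu fun x hx i ↦ by
      rw [LinearMap.mem_ker] at hx ⊢
      rw [hφg.map_proj, hx, map_zero])
  let ψ : GrMod.free (𝒜 := 𝒜) d →ₗ[R] Q := (perp σ (LinearMap.ker φ)).mkQ
  have hψ : Function.Surjective ψ := Submodule.mkQ_surjective _
  have hψg : IsGradedHom ψ := fun i x hx ↦ ⟨x, hx, rfl⟩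
  let ψ' : GrMod.free (𝒜 := 𝒜) (Sum.elim d e) →ₗ[R] Q := ψ ∘ₗ LinearMap.funLeft R R Sum.inl
  have hψ' : Function.Surjective ψ' :=
    hψ.comp (LinearMap.funLeft_surjective_of_injective R R _ Sum.inl_injective)
  have hψg' : IsGradedHom ψ' := fun i x hx ↦ hψg i _ fun k ↦ hx (Sum.inl k)
  refine ⟨Q, ⟨M, GradedIso.refl M, directlyLinked_of_isDualPair h𝒜 hR hσ hu hφg hφ hψg hψ h1 hM hQ⟩,
    directlyLinked_of_isDualPair h𝒜 hR hτ hu' (φ := ψ') (ψ := extendLink σ τ φ) hψg' hψ' ?_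
      (extendLink_surjective hσ hτ hφ) h2 hQ ?_⟩
  · refine fun i z hz ↦ ⟨hφg _ _ fun k ↦ ?_, fun l ↦ ?_⟩
    · have h3 := hz (τ (Sum.inl (σ k)))
      have h4 := hu' (Sum.inl (σ k))
      rw [Sum.elim_inl] at h4
      rwa [show i - Sum.elim d e (τ (Sum.inl (σ k))) = i + (u - u') - d k by
        rw [← h4, ← hu k]; ring] at h3
    · have h3 := hz (τ (Sum.inr l))
      have h4 := hu' (Sum.inr l)
      rw [Sum.elim_inr] at h4
      rwa [show i - Sum.elim d e (τ (Sum.inr l)) = i - (u' - e l) by rw [← h4]; ring] at h3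
  · exact isMaximalModule_of_surjective (LinearMap.fst R M (κ → R)) Prod.fst_surjective hM

/-- A finitely generated graded module is covered by a graded free module with a perfect symmetric
pairing of any degree and with a redundant generator. -/
theorem exists_cover (M : GrMod 𝒜) [Module.Finite R M] (hM : IsMaximalModule R M) (u : ℤ) :
    ∃ (n : ℕ) (d : Fin n ⊕ Fin n → ℤ) (φ : GrMod.free (𝒜 := 𝒜) d →ₗ[R] M) (j : Fin n ⊕ Fin n),
      (∀ k, d k + d k.swap = u) ∧ IsGradedHom φ ∧ Function.Surjective φ ∧
      φ (Pi.single j 1 : Fin n ⊕ Fin n → R) = 0 := by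
  have := hR.noetherian
  have := h𝒜.nontrivial
  obtain ⟨dim, hdim⟩ := exists_hasGradeDim h𝒜 hR
  have := hdim.finiteRingKrullDim
  obtain ⟨n, d, φ, hφg, hφ, -⟩ := exists_minimal_cover h𝒜 M
  have hM0 : Nontrivial M := by
    rw [← Module.supportDim_ne_bot_iff_nontrivial R, hM]
    exact ringKrullDim_ne_bot
  have hn : n ≠ 0 := by
    rintro rfl
    exact not_subsingleton M hφ.subsingleton
  refine ⟨n, Sum.elim d fun k ↦ u - d k, φ ∘ₗ LinearMap.funLeft R R Sum.inl,
    Sum.inr ⟨0, Nat.pos_of_ne_zero hn⟩, ?_, fun i x hx ↦ hφg i _ fun k ↦ hx (Sum.inl k),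
    hφ.comp (LinearMap.funLeft_surjective_of_injective R R _ Sum.inl_injective), ?_⟩
  · rintro (k | k)
    · exact add_sub_cancel _ _
    · exact sub_add_cancel _ _
  · have h1 : LinearMap.funLeft R R Sum.inl
        (Pi.single (Sum.inr ⟨0, Nat.pos_of_ne_zero hn⟩) 1 : Fin n ⊕ Fin n → R) = 0 := by
      ext i
      simp [LinearMap.funLeft_apply]
    exact (congrArg φ h1).trans (map_zero φ)

/-- With `τ` fixing the new basis vector, the degrees of all pairs under `τ` have the sum `2 * a`. As the
same sum is chosen for `σ`, the second link does not shift `M`. -/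
theorem inEvenLiaisonClass_prod_unit [Module.Finite R M] (hM : IsMaximalModule R M)
    (htl : ∀ x : M, x ≠ 0 → ∃ f : M →ₗ[R] R, f x ≠ 0) (a : ℤ) :
    InEvenLiaisonClass M (M.prod (GrMod.free fun _ : Unit ↦ a)) := by
  obtain ⟨n, d, φ, j, hu, hφg, hφ, hj⟩ := exists_cover h𝒜 hR M hM (a + a)
  let σ : Equiv.Perm (Fin n ⊕ Fin n) := Equiv.sumComm _ _
  have hσ : Function.Involutive σ := Sum.swap_swap
  let τ : Equiv.Perm ((Fin n ⊕ Fin n) ⊕ Unit) := Equiv.sumCongr σ (Equiv.refl _)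
  have hτ : Function.Involutive τ := by rintro (x | x) <;> simp [τ, σ]
  have h := linkedInSteps_extendLink h𝒜 hR hσ hu hφg hφ hj hM htl hτ (e := fun _ : Unit ↦ a)
    (u' := a + a) (by
      rintro (k | k)
      · exact hu k
      · rfl)
  refine InEvenLiaisonClass.trans ⟨2, even_two, h⟩ (GradedIso.inEvenLiaisonClass ?_)
  rw [add_sub_cancel_right]
  exact (GradedIso.shift_eq_zero M (sub_self _)).prod (.refl _)

/-- With `κ = ι` and `τ` exchanging the two copies of `ι`, the degree sum of `τ` is arbitrary, and its
difference from the degree sum of `σ` is the shift of `M`. -/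
theorem exists_inEvenLiaisonClass_shift_prod [Module.Finite R M] (hM : IsMaximalModule R M)
    (htl : ∀ x : M, x ≠ 0 → ∃ f : M →ₗ[R] R, f x ≠ 0) (s : ℤ) :
    ∃ F : GrMod 𝒜, IsGradedFree F ∧ InEvenLiaisonClass M ((M.shift s).prod F) := by
  obtain ⟨n, d, φ, j, hu, hφg, hφ, hj⟩ := exists_cover h𝒜 hR M hM 0
  have h := linkedInSteps_extendLink h𝒜 hR (σ := Equiv.sumComm _ _) Sum.swap_swap hu hφg hφ hj hM
    htl (τ := Equiv.sumComm _ _) Sum.swap_swap (e := fun k ↦ -s - d k) (u' := -s) (by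
      rintro (k | k)
      · exact add_sub_cancel _ _
      · exact sub_add_cancel _ _)
  rw [zero_sub, neg_neg] at h
  exact ⟨_, GrMod.isGradedFree_free _, 2, even_two, h⟩

omit h𝒜 hR in
theorem GradedIso.free_succ {n : ℕ} (d : Fin (n + 1) → ℤ) :
    GradedIso ((GrMod.free (𝒜 := 𝒜) fun k : Fin n ↦ d k.succ).prod (GrMod.free fun _ : Unit ↦ d 0))
      (GrMod.free d) := by
  let e : ((Fin n → R) × (Unit → R)) ≃ₗ[R] (Fin (n + 1) → R) :=
    { toFun := fun x ↦ Fin.cons (x.2 ()) x.1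
      invFun := fun x ↦ (fun k ↦ x k.succ, fun _ ↦ x 0)
      map_add' := fun x y ↦ by
        ext k
        refine Fin.cases rfl (fun k ↦ rfl) k
      map_smul' := fun r x ↦ by
        ext k
        refine Fin.cases rfl (fun k ↦ rfl) k
      left_inv := fun x ↦ rfl
      right_inv := fun x ↦ by
        ext k
        refine Fin.cases rfl (fun k ↦ rfl) k }
  refine .of_isGradedHom e fun i x hx k ↦ ?_
  refine Fin.cases ?_ (fun k ↦ ?_) k
  · exact hx.2 ()
  · exact hx.1 k

theorem inEvenLiaisonClass_prod [Module.Finite R M] (hM : IsMaximalModule R M)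
    (htl : ∀ x : M, x ≠ 0 → ∃ f : M →ₗ[R] R, f x ≠ 0) {F : GrMod 𝒜} (hF : IsGradedFree F) :
    InEvenLiaisonClass M (M.prod F) := by
  suffices H : ∀ (n : ℕ) (d : Fin n → ℤ), InEvenLiaisonClass M (M.prod (GrMod.free d)) by
    obtain ⟨n, d, e⟩ := hF.gradedIso_free
    exact (H n d).trans (((GradedIso.refl M).prod e).inEvenLiaisonClass)
  intro n
  induction n with
  | zero =>
    intro d
    have : Subsingleton (Fin 0 → R) := inferInstance
    exact (GradedIso.of_isGradedHom (N := M.prod (GrMod.free d))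
      (LinearEquiv.prodUnique (R := R) (M := M) (M₂ := Fin 0 → R)).symm
      fun i x hx ↦ ⟨hx, fun k ↦ k.elim0⟩).inEvenLiaisonClass
  | succ n ih =>
    intro d
    have hfin : Module.Finite R (M.prod (GrMod.free fun k : Fin n ↦ d k.succ)) :=
      inferInstanceAs (Module.Finite R (M × (Fin n → R)))
    have h1 := inEvenLiaisonClass_prod_unit h𝒜 hR (M := M.prod (GrMod.free fun k : Fin n ↦ d k.succ))
      (isMaximalModule_of_surjective (LinearMap.fst R M (Fin n → R)) Prod.fst_surjective hM)
      (exists_dual_ne_zero_prod_free (F := Fin n → R) htl) (d 0)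
    exact (ih _).trans (h1.trans ((GradedIso.prod_assoc _ _ _).trans
      ((GradedIso.refl M).prod (GradedIso.free_succ d))).inEvenLiaisonClass)

theorem inEvenLiaisonClass_of_stablyEquivalent [Module.Finite R M]
    (htl : ∀ x : M, x ≠ 0 → ∃ f : M →ₗ[R] R, f x ≠ 0) (h : StablyEquivalent M N) :
    InEvenLiaisonClass M N := by
  obtain ⟨hM, hN, F, G, s, hF, hG, heq⟩ := stablyEquivalent_iff.1 h
  obtain ⟨e, he⟩ := heq
  have := hF.finite
  have := hF.free
  have := hG.finite
  have := hG.free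
  have hsurj : Function.Surjective (LinearMap.fst R N G ∘ₗ e.toLinearMap) :=
    Prod.fst_surjective.comp e.surjective
  have hNfin : Module.Finite R N :=
    have : Module.Finite R (M.prod F) := inferInstanceAs (Module.Finite R (M × F))
    Module.Finite.of_surjective _ hsurj
  have htlN : ∀ x : N, x ≠ 0 → ∃ f : N →ₗ[R] R, f x ≠ 0 :=
    exists_dual_ne_zero_of_injective (e.symm.toLinearMap ∘ₗ LinearMap.inl R N G)
      (e.symm.injective.comp LinearMap.inl_injective) (exists_dual_ne_zero_prod_free (F := F) htl)
  obtain ⟨F', hF', h1⟩ := exists_inEvenLiaisonClass_shift_prod h𝒜 hR hN htlN s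
  have := hF'.finite
  have := hF'.free
  have : Module.Finite R ((N.shift s).prod F') := inferInstanceAs (Module.Finite R (N × F'))
  have : Module.Finite R ((N.shift s).prod G) := inferInstanceAs (Module.Finite R (N × G))
  have h2 := inEvenLiaisonClass_prod h𝒜 hR (M := (N.shift s).prod F')
    (isMaximalModule_of_surjective (LinearMap.fst R N F') Prod.fst_surjective hN)
    (exists_dual_ne_zero_prod_free (F := F') htlN) hG
  have h3 := inEvenLiaisonClass_prod h𝒜 hR (M := (N.shift s).prod G)
    (isMaximalModule_of_surjective (LinearMap.fst R N G) Prod.fst_surjective hN)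
    (exists_dual_ne_zero_prod_free (F := G) htlN) hF'
  have h4 := (inEvenLiaisonClass_prod h𝒜 hR hM htl hF).trans
    (GradedIso.inEvenLiaisonClass ⟨e, he⟩)
  exact h4.trans (h3.trans ((GradedIso.prod_right_comm _ _ _).inEvenLiaisonClass.trans
    (h1.trans h2).symm))

theorem inEvenLiaisonClass_iff (hfin : Module.Finite R M) (hunm : IsUnmixed R M)
    (hM : IsMaximalModule R M) : InEvenLiaisonClass M N ↔ StablyEquivalent M N := by
  obtain ⟨d, hd⟩ := exists_hasGradeDim h𝒜 hR
  have := hd.finiteRingKrullDim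
  constructor
  · rintro ⟨s, ⟨k, rfl⟩, h⟩
    exact stablyEquivalent_of_linkedInSteps h𝒜 hR hM k h
  · exact inEvenLiaisonClass_of_stablyEquivalent h𝒜 hR
      fun x hx ↦ exists_dual_ne_zero_of_isUnmixed hR hunm hM hx

omit h𝒜 hR in
theorem isGradedFree_ringMod : IsGradedFree (ringMod 𝒜) :=
  ⟨1, Module.Basis.singleton (Fin 1) R, fun _ ↦ 0, fun k ↦ by
    change Module.Basis.singleton (Fin 1) R k ∈ 𝒜 0
    rw [Module.Basis.singleton_apply]
    exact SetLike.GradedOne.one_mem⟩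

theorem inLiaisonClass_ringMod_iff :
    InLiaisonClass (ringMod 𝒜) N ↔ IsGradedFree N ∧ Nontrivial N := by
  obtain ⟨d, hd⟩ := exists_hasGradeDim h𝒜 hR
  have := hd.finiteRingKrullDim
  have := hR.noetherian
  have := h𝒜.nontrivial
  constructor
  · rintro ⟨s, h⟩
    suffices H : IsGradedFree N ∧ IsMaximalModule R N by
      refine ⟨H.1, ?_⟩
      rw [← Module.supportDim_ne_bot_iff_nontrivial R, H.2]
      exact ringKrullDim_ne_bot
    induction s generalizing N with
    | zero => exact ⟨isGradedFree_ringMod.of_gradedIso h,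
        isMaximalModule_of_gradedIso h isMaximalModule_self⟩
    | succ s ih =>
      obtain ⟨P, hP, hPN⟩ := h
      obtain ⟨h1, h2⟩ := ih hP
      obtain ⟨hN, C, t, β, φ, χ, ψ, ω, hC, -, ⟨-, hφ⟩, -, -, ⟨-, hω⟩, -, h4⟩ :=
        hPN.exists_epi h𝒜 hR h2
      have := hC.finite
      have := hC.free
      have := h1.free
      have : Module.Finite R N := Module.Finite.of_surjective ω hω
      have : Module.Projective R N := projective_of_linked β hφ hω h4
      exact ⟨isGradedFree_of_projective h𝒜 N, hN⟩
  · rintro ⟨h1, h2⟩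
    have := h1.free
    have hN : IsMaximalModule R N := isMaximalModule_of_free
    have : Module.Finite R (ringMod 𝒜) := isGradedFree_ringMod.finite
    obtain ⟨s, -, h⟩ := inEvenLiaisonClass_of_stablyEquivalent h𝒜 hR (M := ringMod 𝒜) (N := N)
      (fun x hx ↦ ⟨LinearMap.id, hx⟩) (stablyEquivalent_iff.2 ⟨isMaximalModule_self, hN, N,
        ringMod 𝒜, 0, h1, isGradedFree_ringMod, (GradedIso.prod_comm _ _).trans
          ((GradedIso.shift_eq_zero N rfl).symm.prod (.refl _))⟩)
    exact ⟨s, h⟩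

end Backward

end Pairing

end Gr

end ModuleLiaison

theorem mainTheorem10 :
    (∀ (R : Type u) [CommRing R] [IsLocalRing R],
      ModuleLiaison.IsGorensteinRing R →
        (∀ M : ModuleCat.{u} R, Module.Finite R M → ModuleLiaison.IsUnmixed R M →
          ModuleLiaison.IsMaximalModule R M →
          ∀ N : ModuleCat.{u} R,
            ModuleLiaison.Loc.InEvenLiaisonClass M N ↔
              ModuleLiaison.Loc.StablyEquivalent M N) ∧
        (∀ N : ModuleCat.{u} R,
          ModuleLiaison.Loc.InLiaisonClass (ModuleCat.of R R) N ↔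
            (Module.Finite R N ∧ Module.Free R N ∧ Nontrivial N))) ∧
    (∀ (K : Type v) (R : Type u) [Field K] [CommRing R] [Algebra K R]
      (𝒜 : ℤ → Submodule K R) [GradedAlgebra 𝒜],
      ModuleLiaison.Gr.IsStandardGraded 𝒜 → ModuleLiaison.IsGorensteinRing R →
        (∀ M : ModuleLiaison.Gr.GrMod 𝒜, Module.Finite R M → ModuleLiaison.IsUnmixed R M →
          ModuleLiaison.IsMaximalModule R M →
          ∀ N : ModuleLiaison.Gr.GrMod 𝒜,
            ModuleLiaison.Gr.InEvenLiaisonClass M N ↔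
              ModuleLiaison.Gr.StablyEquivalent M N) ∧
        (∀ N : ModuleLiaison.Gr.GrMod 𝒜,
          ModuleLiaison.Gr.InLiaisonClass (ModuleLiaison.Gr.ringMod 𝒜) N ↔
            (ModuleLiaison.Gr.IsGradedFree N ∧ Nontrivial N))) := by
  refine ⟨fun R _ _ hR ↦ ⟨fun M hfin hunm hM N ↦ ?_, fun N ↦ ?_⟩,
    fun K R _ _ _ 𝒜 _ h𝒜 hR ↦ ⟨fun M hfin hunm hM N ↦ ?_, fun N ↦ ?_⟩⟩
  · exact ModuleLiaison.Loc.inEvenLiaisonClass_iff hR hfin hunm hM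
  · exact ModuleLiaison.Loc.inLiaisonClass_self_iff hR
  · exact ModuleLiaison.Gr.inEvenLiaisonClass_iff h𝒜 hR hfin hunm hM
  · exact ModuleLiaison.Gr.inLiaisonClass_ringMod_iff h𝒜 hR
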